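/- Let $k$ be an algebraically closed field of characteristic $0$. For $u,v\in k$ put $$F=4v^2x^3+v^2x^2+2vx+1,\qquad G=v^2x^3+uvx^2+vx+1,$$ and let $\mathcal X_{u,v}$ be the curve $y^2=F(x)G(x)$ whenever $FG$ has degree $5$ or $6$ and no multiple root, so that it is a genus $2$ curve. These are the curves of the surface $\mathfrak S_3$ of genus $2$ curves with a degree $3$ elliptic subcover. For a sextic with Igusa invariants $J_2,J_4,J_6$ (normalized so that $J_2=-240a_0a_6+40a_1a_5-16a_2a_4+6a_3^2$, i.e. the Igusa–Clebsch invariants), discriminant $J_{10}$, and $J_2\ne0$, put $$i_1=144\frac{J_4}{J_2^2},\quad i_2=-1728\frac{J_2J_4-3J_6}{J_2^3},\quad i_3=486\frac{J_{10}}{J_2^5}.$$ For cubics $F=\sum a_ix^i$, $G=\sum b_ix^i$ put $H=a_3b_0-\frac13a_2b_1+\frac13a_1b_2-a_0b_3$, let $D$ be the discriminant, and let $R=a_3^3b_3^3\prod_{i,j}(\beta_j-\alpha_i)$ be the resultant, where $\alpha_i,\beta_j$ are the roots of $F,G$; put $r_1=H^3/R$ and $r_2=H^4/(D(F)D(G))$.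 Let $\Phi:(r_1,r_2)\mapsto(i_1,i_2,i_3)$ be the rational map given, with $q=r_1^2+96r_1r_2-1152r_2^2$, by $$i_1=\frac{9}{4r_1q^2}\bigl(r_1^5+192r_1^4r_2+13824r_1^3r_2^2+442368r_1^2r_2^3+5308416r_1r_2^4+786432r_1r_2^3+9437184r_2^4\bigr),$$ $$\begin{aligned}i_2=\frac{27}{8r_1^2q^3}\bigl(&r_1^8+288r_1^7r_2+34560r_1^6r_2^2+2211840r_1^5r_2^3+79626240r_1^4r_2^4+1528823808r_1^3r_2^5+12230590464r_1^2r_2^6\\&-2359296r_1^4r_2^3-212336640r_1^3r_2^4-4076863488r_1^2r_2^5+32614907904r_1r_2^6+14495514624r_2^6\bigr),\end{aligned}$$ $$i_3=-521838526464\,\frac{r_2^9}{r_1^2q^5}.$$ Let $\mathcal T_3$, the singular locus of $\mathfrak S_3$ computed with this parametrization, be the set of points $\Phi(r_1,r_2)$, where $(r_1,r_2)\in k^2$ is such that $\Phi$ is defined at $(r_1,r_2)$ (i.e. $r_1\ne0$ and $q\ne0$; the locus $q=0$ is the locus $J_2=0$), $i_3\neq0$ (so that the point lies in the moduli space), and all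 $2\times2$ minors of the Jacobian matrix $\partial(i_1,i_2,i_3)/\partial(r_1,r_2)$ vanish at $(r_1,r_2)$. Then: 1. Every genus $2$ curve $\mathcal X_{u,v}$ is a degree $3$ cover of an elliptic curve, and if $J_2\neq0$ and $H(F,G)\ne0$ then $\Phi(r_1(F,G),r_2(F,G))$ is the triple $(i_1,i_2,i_3)$ of absolute invariants of $\mathcal X_{u,v}$. 2. $\mathcal T_3$ consists of exactly three points, namely $$P_1=\left(-\tfrac{8019}{20},-\tfrac{1240029}{200},-\tfrac{531441}{100000}\right),\quad P_2=\left(81,-\tfrac{5103}{25},-\tfrac{729}{12500}\right),\quad P_3=\left(\tfrac{729}{2116},\tfrac{1240029}{97336},\tfrac{531441}{13181630464}\right).$$ 3. For each $j\in\{1,2,3\}$ there is a genus $2$ curve $\mathcal X_{u,v}$ with $J_2\ne0$ and $(i_1,i_2,i_3)=P_j$, and every such curve has automorphism group (the group of $k$-automorphisms of its function field) isomorphic to $D_4$ for $j=1$, to $D_6$ for $j=2$, and to $D_4$ for $j=3$, where $D_n$ is the dihedral group of order $2n$. -/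

import Mathlib

noncomputable section

namespace ShaskaSurface

/-! ### Curves `y² = f(x)` and their function fields -/

/-- `y² = f(x)` is an (affine) equation of a genus 2 curve: `f` has degree 5 or 6 and no
multiple root. -/
def IsGenusTwo {k : Type*} [Field k] (f : Polynomial k) : Prop :=
  f.Separable ∧ (f.natDegree = 5 ∨ f.natDegree = 6)

/-- The function field `k(x)[y]/(y² - f(x))` of the curve `y² = f(x)`. -/
abbrev CurveField {k : Type*} [Field k] (f : Polynomial k) : Type _ :=
  AdjoinRoot ((Polynomial.X : Polynomial (RatFunc k)) ^ 2
    - Polynomial.C (algebraMap (Polynomial k) (RatFunc k) f))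

/-- The automorphism group of the curve `y² = f(x)` over `k`, i.e. the group of
`k`-automorphisms of its function field. -/
abbrev CurveAut {k : Type*} [Field k] (f : Polynomial k) : Type _ :=
  CurveField f ≃ₐ[k] CurveField f

/-- The curve `y² = f(x)` is a covering of degree 3 of some elliptic curve `y² = g(x)`
(`g` a separable cubic): the function field of the elliptic curve embeds over `k` with index 3.
Because 3 is prime, such a covering does not factor through a nontrivial isogeny. -/
def HasDegreeThreeEllipticSubcover {k : Type*} [Field k] (f : Polynomial k) : Prop :=
  ∃ g : Polynomial k, g.Separable ∧ g.natDegree = 3 ∧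
    ∃ ψ : CurveField g →ₐ[k] CurveField f, Module.finrank ψ.range (CurveField f) = 3

/-! ### Invariants of sextics -/

/-- Igusa's invariant `J₂` of the sextic `a₆ X⁶ + ⋯ + a₀`. -/
def J2 {k : Type*} [Field k] (f : Polynomial k) : k :=
  let a : ℕ → k := f.coeff
  6 * a 3 ^ 2 - 16 * a 2 * a 4 + 40 * a 1 * a 5 - 240 * a 0 * a 6

/-- Igusa's invariant `J₄`. -/
def J4 {k : Type*} [Field k] (f : Polynomial k) : k :=
  let a : ℕ → k := f.coeff
  4 * a 2 ^ 2 * a 4 ^ 2 - 12 * a 2 ^ 2 * a 3 * a 5 + 48 * a 2 ^ 3 * a 6 - 12 * a 1 * a 3 * a 4 ^ 2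
    + 36 * a 1 * a 3 ^ 2 * a 5 + 4 * a 1 * a 2 * a 4 * a 5 - 180 * a 1 * a 2 * a 3 * a 6
    - 80 * a 1 ^ 2 * a 5 ^ 2 + 300 * a 1 ^ 2 * a 4 * a 6 + 48 * a 0 * a 4 ^ 3 - 180 * a 0 * a 3 * a 4 * a 5
    + 324 * a 0 * a 3 ^ 2 * a 6 + 300 * a 0 * a 2 * a 5 ^ 2 - 504 * a 0 * a 2 * a 4 * a 6
    - 540 * a 0 * a 1 * a 5 * a 6 + 1620 * a 0 ^ 2 * a 6 ^ 2

/-- Igusa's invariant `J₆`. -/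
def J6 {k : Type*} [Field k] (f : Polynomial k) : k :=
  let a : ℕ → k := f.coeff
  8 * a 2 ^ 2 * a 3 ^ 2 * a 4 ^ 2 - 24 * a 2 ^ 2 * a 3 ^ 3 * a 5 - 24 * a 2 ^ 3 * a 4 ^ 3
    + 76 * a 2 ^ 3 * a 3 * a 4 * a 5 + 60 * a 2 ^ 3 * a 3 ^ 2 * a 6 - 36 * a 2 ^ 4 * a 5 ^ 2
    - 160 * a 2 ^ 4 * a 4 * a 6 - 24 * a 1 * a 3 ^ 3 * a 4 ^ 2 + 72 * a 1 * a 3 ^ 4 * a 5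
    + 76 * a 1 * a 2 * a 3 * a 4 ^ 3 - 238 * a 1 * a 2 * a 3 ^ 2 * a 4 * a 5 - 198 * a 1 * a 2 * a 3 ^ 3 * a 6
    + 28 * a 1 * a 2 ^ 2 * a 4 ^ 2 * a 5 + 26 * a 1 * a 2 ^ 2 * a 3 * a 5 ^ 2 + 492 * a 1 * a 2 ^ 2 * a 3 * a 4 * a 6
    + 616 * a 1 * a 2 ^ 3 * a 5 * a 6 - 36 * a 1 ^ 2 * a 4 ^ 4 + 26 * a 1 ^ 2 * a 3 * a 4 ^ 2 * a 5
    + 176 * a 1 ^ 2 * a 3 ^ 2 * a 5 ^ 2 + 330 * a 1 ^ 2 * a 3 ^ 2 * a 4 * a 6 + 64 * a 1 ^ 2 * a 2 * a 4 * a 5 ^ 2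
    - 640 * a 1 ^ 2 * a 2 * a 4 ^ 2 * a 6 - 1860 * a 1 ^ 2 * a 2 * a 3 * a 5 * a 6
    - 900 * a 1 ^ 2 * a 2 ^ 2 * a 6 ^ 2 - 320 * a 1 ^ 3 * a 5 ^ 3 + 1600 * a 1 ^ 3 * a 4 * a 5 * a 6
    + 2250 * a 1 ^ 3 * a 3 * a 6 ^ 2 + 60 * a 0 * a 3 ^ 2 * a 4 ^ 3 - 198 * a 0 * a 3 ^ 3 * a 4 * a 5
    + 162 * a 0 * a 3 ^ 4 * a 6 - 160 * a 0 * a 2 * a 4 ^ 4 + 492 * a 0 * a 2 * a 3 * a 4 ^ 2 * a 5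
    + 330 * a 0 * a 2 * a 3 ^ 2 * a 5 ^ 2 - 468 * a 0 * a 2 * a 3 ^ 2 * a 4 * a 6
    - 640 * a 0 * a 2 ^ 2 * a 4 * a 5 ^ 2 + 424 * a 0 * a 2 ^ 2 * a 4 ^ 2 * a 6
    - 876 * a 0 * a 2 ^ 2 * a 3 * a 5 * a 6 - 96 * a 0 * a 2 ^ 3 * a 6 ^ 2 + 616 * a 0 * a 1 * a 4 ^ 3 * a 5
    - 1860 * a 0 * a 1 * a 3 * a 4 * a 5 ^ 2 - 876 * a 0 * a 1 * a 3 * a 4 ^ 2 * a 6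
    + 1818 * a 0 * a 1 * a 3 ^ 2 * a 5 * a 6 + 1600 * a 0 * a 1 * a 2 * a 5 ^ 3
    + 3472 * a 0 * a 1 * a 2 * a 4 * a 5 * a 6 + 3060 * a 0 * a 1 * a 2 * a 3 * a 6 ^ 2
    - 2240 * a 0 * a 1 ^ 2 * a 5 ^ 2 * a 6 - 18600 * a 0 * a 1 ^ 2 * a 4 * a 6 ^ 2
    - 900 * a 0 ^ 2 * a 4 ^ 2 * a 5 ^ 2 - 96 * a 0 ^ 2 * a 4 ^ 3 * a 6 + 2250 * a 0 ^ 2 * a 3 * a 5 ^ 3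
    + 3060 * a 0 ^ 2 * a 3 * a 4 * a 5 * a 6 - 10044 * a 0 ^ 2 * a 3 ^ 2 * a 6 ^ 2
    - 18600 * a 0 ^ 2 * a 2 * a 5 ^ 2 * a 6 + 20664 * a 0 ^ 2 * a 2 * a 4 * a 6 ^ 2
    + 59940 * a 0 ^ 2 * a 1 * a 5 * a 6 ^ 2 - 119880 * a 0 ^ 3 * a 6 ^ 3

/-- `J₁₀`: the discriminant of the binary form `f(X, Z)` of degree 6. If `f` has degree 5, the
form has a simple root at infinity and its discriminant is `a₅²` times that of `f`. -/
def J10 {k : Type*} [Field k] (f : Polynomial k) : k :=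
  if f.natDegree = 6 then f.discr else f.coeff 5 ^ 2 * f.discr

/-- The absolute invariants `(i₁, i₂, i₃)`, meaningful when `J₂ ≠ 0`. -/
def absInv {k : Type*} [Field k] (f : Polynomial k) : Fin 3 → k :=
  ![144 * J4 f / J2 f ^ 2,
    -1728 * (J2 f * J4 f - 3 * J6 f) / J2 f ^ 3,
    486 * J10 f / J2 f ^ 5]

/-! ### Invariants of pairs of cubics -/

/-- The invariant `H(F, G) = a₃ b₀ - a₂ b₁ / 3 + a₁ b₂ / 3 - a₀ b₃`. -/
def cubicH {k : Type*} [Field k] (F G : Polynomial k) : k :=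
  F.coeff 3 * G.coeff 0 - 1 / 3 * (F.coeff 2 * G.coeff 1) + 1 / 3 * (F.coeff 1 * G.coeff 2)
    - F.coeff 0 * G.coeff 3

/-- The resultant of two cubics, normalized as `a₃³ b₃³ ∏ (βⱼ - αᵢ)` with `αᵢ`, `βⱼ` the roots
of `F` and `G`. -/
def cubicR {k : Type*} [Field k] (F G : Polynomial k) : k :=
  Polynomial.resultant G F 3 3

/-- The pair of invariants `r₁ = H³ / R`, `r₂ = H⁴ / (D(F) D(G))`. -/
def cubicInv {k : Type*} [Field k] (F G : Polynomial k) : Fin 2 → k :=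
  ![cubicH F G ^ 3 / cubicR F G, cubicH F G ^ 4 / (F.discr * G.discr)]

/-! ### The curves of the surface of level 3 -/

/-- The first cubic `4v²x³ + v²x² + 2vx + 1`. -/
def cubicF {k : Type*} [Field k] (v : k) : Polynomial k :=
  Polynomial.C (4 * v ^ 2) * Polynomial.X ^ 3 + Polynomial.C (v ^ 2) * Polynomial.X ^ 2
    + Polynomial.C (2 * v) * Polynomial.X + 1

/-- The second cubic `v²x³ + uvx² + vx + 1`. -/
def cubicG {k : Type*} [Field k] (u v : k) : Polynomial k :=
  Polynomial.C (v ^ 2) * Polynomial.X ^ 3 + Polynomial.C (u * v) * Polynomial.X ^ 2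
    + Polynomial.C v * Polynomial.X + 1

/-- The sextic `F G`; the curves of the surface are `y² = F(x) G(x)`. -/
def sextic {k : Type*} [Field k] (u v : k) : Polynomial k :=
  cubicF v * cubicG u v

/-- `y² = F(x) G(x)` is a genus 2 curve with `J₂ ≠ 0` whose absolute invariants are `P`. -/
def CurveOver {k : Type*} [Field k] (u v : k) (P : Fin 3 → k) : Prop :=
  IsGenusTwo (sextic u v) ∧ J2 (sextic u v) ≠ 0 ∧ absInv (sextic u v) = P

/-! ### The parametrization `(r₁, r₂) ↦ (i₁, i₂, i₃)` -/

/-- The polynomial `r₁² + 96 r₁ r₂ - 1152 r₂²`, whose zero locus is the locus `J₂ = 0`. -/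
def polyJ2 (k : Type*) [Field k] : MvPolynomial (Fin 2) k :=
  let r₁ : MvPolynomial (Fin 2) k := MvPolynomial.X 0
  let r₂ : MvPolynomial (Fin 2) k := MvPolynomial.X 1
  r₁ ^ 2 + 96 * r₁ * r₂ - 1152 * r₂ ^ 2

/-- Numerators of `i₁, i₂, i₃` as rational functions of `r₁, r₂`. -/
def num (k : Type*) [Field k] : Fin 3 → MvPolynomial (Fin 2) k :=
  let r₁ : MvPolynomial (Fin 2) k := MvPolynomial.X 0
  let r₂ : MvPolynomial (Fin 2) k := MvPolynomial.X 1
  ![9 * (13824 * r₁ ^ 3 * r₂ ^ 2 + 442368 * r₁ ^ 2 * r₂ ^ 3 + 5308416 * r₁ * r₂ ^ 4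
      + 192 * r₁ ^ 4 * r₂ + r₁ ^ 5 + 786432 * r₁ * r₂ ^ 3 + 9437184 * r₂ ^ 4),
    27 * (79626240 * r₁ ^ 4 * r₂ ^ 4 - 4076863488 * r₁ ^ 2 * r₂ ^ 5 + 34560 * r₁ ^ 6 * r₂ ^ 2
      + 12230590464 * r₁ ^ 2 * r₂ ^ 6 + 32614907904 * r₁ * r₂ ^ 6 + 14495514624 * r₂ ^ 6
      + 288 * r₁ ^ 7 * r₂ + 2211840 * r₁ ^ 5 * r₂ ^ 3 + r₁ ^ 8 - 212336640 * r₁ ^ 3 * r₂ ^ 4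
      + 1528823808 * r₁ ^ 3 * r₂ ^ 5 - 2359296 * r₁ ^ 4 * r₂ ^ 3),
    -521838526464 * r₂ ^ 9]

/-- Denominators of `i₁, i₂, i₃` as rational functions of `r₁, r₂`. -/
def den (k : Type*) [Field k] : Fin 3 → MvPolynomial (Fin 2) k :=
  let r₁ : MvPolynomial (Fin 2) k := MvPolynomial.X 0
  ![4 * r₁ * polyJ2 k ^ 2, 8 * r₁ ^ 2 * polyJ2 k ^ 3, r₁ ^ 2 * polyJ2 k ^ 5]

/-- The parametrization `(r₁, r₂) ↦ (i₁, i₂, i₃)`. -/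
def param {k : Type*} [Field k] (r : Fin 2 → k) : Fin 3 → k :=
  fun j => MvPolynomial.eval r (num k j) / MvPolynomial.eval r (den k j)

/-- The Jacobian matrix of the parametrization at a point where it is defined (quotient rule). -/
def jacobian {k : Type*} [Field k] (r : Fin 2 → k) : Matrix (Fin 3) (Fin 2) k :=
  Matrix.of fun j l =>
    (MvPolynomial.eval r (MvPolynomial.pderiv l (num k j)) * MvPolynomial.eval r (den k j)
      - MvPolynomial.eval r (num k j) * MvPolynomial.eval r (MvPolynomial.pderiv l (den k j)))
      / MvPolynomial.eval r (den k j) ^ 2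

/-- The singular locus computed from the parametrization: the points `param r` for which the
parametrization is defined at `r`, the point `param r` belongs to the moduli space (`i₃ ≠ 0`,
i.e. nonzero discriminant), and all the `2 × 2` minors of the Jacobian matrix vanish at `r`. -/
def singularLocus (k : Type*) [Field k] : Set (Fin 3 → k) :=
  {P | ∃ r : Fin 2 → k, (∀ j, MvPolynomial.eval r (den k j) ≠ 0) ∧ param r 2 ≠ 0 ∧
    (∀ a b : Fin 3, ((jacobian r).submatrix ![a, b] id).det = 0) ∧ param r = P}

/-- The point with invariants `(-8019/20, -1240029/200, -531441/100000)`. -/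
def pointA (k : Type*) [Field k] : Fin 3 → k :=
  ![-8019 / 20, -1240029 / 200, -531441 / 100000]

/-- The point with invariants `(81, -5103/25, -729/12500)`. -/
def pointB (k : Type*) [Field k] : Fin 3 → k :=
  ![81, -5103 / 25, -729 / 12500]

/-- The point with invariants `(729/2116, 1240029/97336, 531441/13181630464)`. -/
def pointC (k : Type*) [Field k] : Fin 3 → k :=
  ![729 / 2116, 1240029 / 97336, 531441 / 13181630464]

end ShaskaSurface

end

/-! Invariants. Put t = v - 27, h = 9 - v + 2u and let w be `discrFactor`. Up to constants, D(F),
D(G), R and H are v⁴t, v³w, v⁵w and v²h. The absolute invariants of the curve depend only on n = h/t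
and τ = w/(vt³): they are polynomials in n, τ over powers of q(n) = 1 + 2n - n²/2 (`absInv_sextic`).
Since n = 48r₂/r₁ and τ = n³/(27r₁), the given map in r₁, r₂ is the same formula
(`param_eq_normalInv`), and part 1 on invariants follows.

Elliptic subcover. The function x²/G(x) has degree 3 in x, and F(x)(v²x³ - vx - 2)² is a cubic form
in x² and G(x) (`cubicF_mul_sq`). This identity is a morphism to the elliptic curve given by that
cubic.

Singular locus. Substituting r₂ = r₁n/48 turns two of the minors, up to powers of r₁, into a linear
and a quadratic polynomial in r₁. Eliminating r₁ leaves n = 8, 1/2, -10 (`eq_of_minors_eq_zero`).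
For each of the three points the pair (n, τ) is unique, and fixing it leaves a quadratic equation
for v, hence explicit curves.

Automorphisms. On a genus 2 curve the subfield k(x) is canonical: an element outside it satisfies no
relation of degree 2 in x (`no_quadratic_relation`). So every automorphism acts on x by a Möbius
transformation and sends y to ey/(cx + d)³, where the matrix multiplies the sextic form by e²
(`exists_aut_form`). Explicit substitutions bring the curves to y² = x⁵ + sx³ + x or y² = x⁶ + sx³ +
1. For these, covariants of the form force the matrix to be monomial, and counting the scalings
gives D₄ and D₆. -/

namespace ShaskaSurface

open Polynomial IntermediateField

/-! ### Squarefree polynomials and irreducibility of y² - f. -/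

section Squarefree

variable {k : Type*} [Field k]

/-- If `r² f` is a polynomial for a squarefree polynomial `f`, then `r` is a polynomial. -/
theorem exists_polynomial_of_sq_mul_eq {f h : k[X]} (hf : Squarefree f) {r : RatFunc k}
    (e : r ^ 2 * algebraMap k[X] (RatFunc k) f = algebraMap k[X] (RatFunc k) h) :
    ∃ p : k[X], r = algebraMap k[X] (RatFunc k) p := by
  have hd : algebraMap k[X] (RatFunc k) r.denom ≠ 0 :=
    RatFunc.algebraMap_ne_zero r.denom_ne_zero
  have h1 : r.num ^ 2 * f = h * r.denom ^ 2 := by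
    apply RatFunc.algebraMap_injective k
    have := r.num_div_denom
    rw [div_eq_iff hd] at this
    simp only [map_mul, map_pow, this, ← e]
    ring
  have h2 : r.denom ^ 2 ∣ f :=
    (r.isCoprime_num_denom.symm.pow (m := 2) (n := 2)).dvd_of_dvd_mul_left ⟨h, by rw [h1]; ring⟩
  have h3 : IsUnit r.denom := hf _ (by rwa [← sq])
  have h4 : r.denom = 1 := r.monic_denom.eq_one_of_isUnit h3
  exact ⟨r.num, by simpa [h4] using r.num_div_denom.symm⟩

theorem sq_ne_algebraMap {f : k[X]} (hf : Squarefree f) (hd : 0 < f.natDegree) (r : RatFunc k) :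
    r ^ 2 ≠ algebraMap k[X] (RatFunc k) f := by
  intro h
  have hf0 : f ≠ 0 := fun h0 => by simp [h0] at hd
  -- If r² = f then r²f = f² is a polynomial, so r is one, and f would be a square.
  obtain ⟨p, rfl⟩ := exists_polynomial_of_sq_mul_eq (h := f ^ 2) (r := r) hf (by
    rw [h, ← map_mul, sq])
  rw [← map_pow] at h
  have h' := RatFunc.algebraMap_injective k h
  have hu : IsUnit p := hf p ⟨1, by rw [← h']; ring⟩
  rw [← h', natDegree_pow, natDegree_eq_zero_of_isUnit hu] at hd
  simp at hd

theorem irreducible_curve {f : k[X]} (hf : Squarefree f) (hd : 0 < f.natDegree) :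
    Irreducible ((X : (RatFunc k)[X]) ^ 2 - C (algebraMap k[X] (RatFunc k) f)) :=
  (X_pow_sub_C_irreducible_iff_of_prime Nat.prime_two).2 (sq_ne_algebraMap hf hd)

end Squarefree

/-! ### The function field k(x, y): normal form of elements, homomorphisms out of it. -/

namespace CurveField

variable {k : Type*} [Field k] (f : k[X])

/-- The coordinate `x` of the curve `y² = f(x)`. -/
noncomputable def x : CurveField f := algebraMap (RatFunc k) _ RatFunc.X

/-- The coordinate `y` of the curve `y² = f(x)`. -/
noncomputable def y : CurveField f := AdjoinRoot.root _

theorem algebraMap_algebraMap (p : k[X]) :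
    algebraMap (RatFunc k) (CurveField f) (algebraMap k[X] (RatFunc k) p) = aeval (x f) p := by
  rw [x, aeval_algebraMap_apply, RatFunc.aeval_X_left_eq_algebraMap]

theorem y_sq : y f ^ 2 = aeval (x f) f := by
  have h := AdjoinRoot.eval₂_root
    ((X : (RatFunc k)[X]) ^ 2 - C (algebraMap k[X] (RatFunc k) f))
  rw [eval₂_sub, eval₂_pow, eval₂_X, eval₂_C, sub_eq_zero] at h
  rw [← algebraMap_algebraMap]
  exact h

theorem monic_curve : ((X : (RatFunc k)[X]) ^ 2 - C (algebraMap k[X] (RatFunc k) f)).Monic :=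
  monic_X_pow_sub_C _ two_ne_zero

theorem exists_rep (z : CurveField f) : ∃ A B : RatFunc k,
    z = algebraMap (RatFunc k) _ A + algebraMap (RatFunc k) _ B * y f := by
  obtain ⟨p, rfl⟩ := AdjoinRoot.mk_surjective z
  have hdeg : (p %ₘ ((X : (RatFunc k)[X]) ^ 2 - C (algebraMap k[X] (RatFunc k) f))).degree < 2 := by
    refine (degree_modByMonic_lt _ (monic_curve f)).trans_eq ?_
    exact degree_X_pow_sub_C two_pos _
  have h1 : AdjoinRoot.mk _ p = AdjoinRoot.mk ((X : (RatFunc k)[X]) ^ 2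
      - C (algebraMap k[X] (RatFunc k) f)) (p %ₘ (X ^ 2 - C (algebraMap k[X] (RatFunc k) f))) := by
    rw [AdjoinRoot.mk_eq_mk]
    exact ⟨p /ₘ _, by rw [sub_eq_iff_eq_add, add_comm, modByMonic_add_div]⟩
  rw [h1, eq_X_add_C_of_degree_le_one (p := p %ₘ _) (Order.le_of_lt_succ hdeg)]
  refine ⟨(p %ₘ (X ^ 2 - C (algebraMap k[X] (RatFunc k) f))).coeff 0,
    (p %ₘ (X ^ 2 - C (algebraMap k[X] (RatFunc k) f))).coeff 1, ?_⟩
  rw [map_add, map_mul, add_comm]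
  rfl

variable [hirr : Fact (Irreducible ((X : (RatFunc k)[X]) ^ 2 - C (algebraMap k[X] (RatFunc k) f)))]

theorem y_ne_algebraMap (A : RatFunc k) : y f ≠ algebraMap (RatFunc k) _ A := by
  intro h
  refine (X_pow_sub_C_irreducible_iff_of_prime Nat.prime_two).1 hirr.out A ?_
  apply (algebraMap (RatFunc k) (CurveField f)).injective
  rw [map_pow, ← h, y_sq, algebraMap_algebraMap]

theorem rep_eq_zero {A B : RatFunc k}
    (h : algebraMap (RatFunc k) (CurveField f) A + algebraMap (RatFunc k) _ B * y f = 0) :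
    A = 0 ∧ B = 0 := by
  have hB : B = 0 := by
    by_contra hB
    refine y_ne_algebraMap f (-A / B) ?_
    have : algebraMap (RatFunc k) (CurveField f) B ≠ 0 := by simpa using hB
    rw [map_div₀, eq_div_iff this, map_neg]
    linear_combination h
  refine ⟨?_, hB⟩
  simpa [hB] using h

theorem finrank_eq_two : Module.finrank (RatFunc k) (CurveField f) = 2 := by
  have h := (AdjoinRoot.powerBasis hirr.out.ne_zero).finrank
  rw [AdjoinRoot.powerBasis_dim, natDegree_X_pow_sub_C] at h
  exact h

theorem transcendental_x : Transcendental k (x f) :=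
  (transcendental_algebraMap_iff (algebraMap (RatFunc k) (CurveField f)).injective).2
    RatFunc.transcendental_X

variable {f}

/-- Homomorphisms out of the function field `k(x, y)`. -/
theorem exists_lift {L : Type*} [Field L] [Algebra k L] {U V : L} (hU : Transcendental k U)
    (hV : V ^ 2 = aeval U f) : ∃ ψ : CurveField f →ₐ[k] L, ψ (x f) = U ∧ ψ (y f) = V := by
  let i : RatFunc k →ₐ[k] L := (k⟮U⟯).val.comp (RatFunc.algEquivOfTranscendental U hU).toAlgHom
  have hi : i RatFunc.X = U := by simp [i]
  have hif (p : k[X]) : i (algebraMap k[X] (RatFunc k) p) = aeval U p := by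
    rw [← RatFunc.aeval_X_left_eq_algebraMap, ← aeval_algHom_apply, hi]
  have hev : ((X : (RatFunc k)[X]) ^ 2 - C (algebraMap k[X] (RatFunc k) f)).eval₂
      (i : RatFunc k →+* L) V = 0 := by
    rw [eval₂_sub, eval₂_pow, eval₂_X, eval₂_C, hV]
    exact sub_eq_zero.2 (hif f).symm
  refine ⟨AdjoinRoot.liftAlgHom _ i V hev, ?_, ?_⟩
  · exact (AdjoinRoot.liftAlgHom_of _ i V hev RatFunc.X).trans hi
  · exact AdjoinRoot.liftAlgHom_root _ i V hev

theorem adjoin_eq_top : IntermediateField.adjoin k {x f, y f} = ⊤ := by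
  rw [eq_top_iff]
  rintro z -
  obtain ⟨A, B, rfl⟩ := exists_rep f z
  have hx : x f ∈ IntermediateField.adjoin k {x f, y f} :=
    IntermediateField.subset_adjoin _ _ (by simp)
  have hy : y f ∈ IntermediateField.adjoin k {x f, y f} :=
    IntermediateField.subset_adjoin _ _ (by simp)
  have hA (A : RatFunc k) : algebraMap (RatFunc k) (CurveField f) A ∈
      IntermediateField.adjoin k {x f, y f} := by
    rw [← A.num_div_denom, map_div₀, algebraMap_algebraMap, algebraMap_algebraMap]
    have h (p : k[X]) : aeval (x f) p ∈ IntermediateField.adjoin k {x f, y f} := by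
      rw [aeval_eq_sum_range]
      exact sum_mem fun i _ => IntermediateField.smul_mem _ (pow_mem hx i)
    exact div_mem (h _) (h _)
  exact add_mem (hA A) (mul_mem (hA B) hy)

/-- Homomorphisms out of the function field are determined by the images of `x` and `y`. -/
theorem algHom_ext {L : Type*} [Field L] [Algebra k L] {ψ φ : CurveField f →ₐ[k] L}
    (hx : ψ (x f) = φ (x f)) (hy : ψ (y f) = φ (y f)) : ψ = φ := by
  refine AlgHom.ext fun z => ?_
  have hA (A : RatFunc k) : ψ (algebraMap (RatFunc k) (CurveField f) A) =
      φ (algebraMap (RatFunc k) (CurveField f) A) := by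
    rw [← A.num_div_denom, map_div₀, algebraMap_algebraMap, algebraMap_algebraMap, map_div₀,
      map_div₀, ← aeval_algHom_apply, ← aeval_algHom_apply, ← aeval_algHom_apply,
      ← aeval_algHom_apply, hx]
  obtain ⟨A, B, rfl⟩ := exists_rep f z
  rw [map_add, map_add, map_mul, map_mul, hA, hA, hy]

end CurveField
end ShaskaSurface

/-! ### Elements outside k(x) satisfy no quadratic relation in x. -/

namespace ShaskaSurface

open Polynomial IntermediateField

theorem coeff_coeff_swap {R : Type*} [CommRing R] (p : R[X][X]) (i j : ℕ) :
    ((Bivariate.swap p).coeff j).coeff i = (p.coeff i).coeff j := by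
  induction p using Polynomial.induction_on' with
  | add p q hp hq => simp [hp, hq]
  | monomial n a =>
    induction a using Polynomial.induction_on' with
    | add p q hp hq => simp only [map_add, coeff_add, hp, hq]
    | monomial m r =>
      rw [Bivariate.swap_monomial_monomial]
      simp only [coeff_monomial]
      split_ifs <;> simp_all [coeff_monomial]

/-- After swapping the two variables, the bound on the inner degree becomes a bound on `natDegree`,
which passes to divisors over a domain. -/
theorem natDegree_coeff_le_of_dvd {R : Type*} [CommRing R] [IsDomain R] {M P : R[X][X]} (hP : P ≠ 0)
    (h : M ∣ P) {n : ℕ} (hn : ∀ i, (P.coeff i).natDegree ≤ n) (i : ℕ) :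
    (M.coeff i).natDegree ≤ n := by
  have hsP : Bivariate.swap P ≠ 0 := by simpa using hP
  have h1 : (Bivariate.swap P).natDegree ≤ n := by
    rw [natDegree_le_iff_coeff_eq_zero]
    intro N hN
    ext i
    rw [coeff_coeff_swap, coeff_zero]
    exact coeff_eq_zero_of_natDegree_lt ((hn i).trans_lt hN)
  have h2 : (Bivariate.swap M).natDegree ≤ n :=
    (natDegree_le_of_dvd (map_dvd Bivariate.swap h) hsP).trans h1
  rw [natDegree_le_iff_coeff_eq_zero]
  intro N hN
  rw [← coeff_coeff_swap, coeff_eq_zero_of_natDegree_lt (h2.trans_lt hN), coeff_zero]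

theorem exists_isPrimitive_map_eq {R K : Type*} [CommRing R] [IsDomain R]
    [UniqueFactorizationMonoid R] [Field K] [Algebra R K] [IsFractionRing R K] {m : K[X]}
    (hm : m ≠ 0) : ∃ (M : R[X]) (c : K), M.IsPrimitive ∧ c ≠ 0 ∧
      M.map (algebraMap R K) = C c * m := by
  classical
  let _ : NormalizedGCDMonoid R := Classical.choice inferInstance
  obtain ⟨b, hbm, hb⟩ := IsLocalization.integerNormalization_spec (nonZeroDivisors R) m
  set q := IsLocalization.integerNormalization (nonZeroDivisors R) m with hq
  have hb0 : algebraMap R K b ≠ 0 := by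
    simpa using nonZeroDivisors.ne_zero hbm
  have hq' : q.map (algebraMap R K) = C (algebraMap R K b) * m := by
    rw [hb, ← smul_eq_C_mul, algebraMap_smul]
  have hq0 : q ≠ 0 := by
    intro h0
    rw [h0, Polynomial.map_zero] at hq'
    exact mul_ne_zero (by simpa using hb0) hm hq'.symm
  have hc0 : algebraMap R K q.content ≠ 0 := by
    simpa [content_eq_zero_iff] using hq0
  refine ⟨q.primPart, algebraMap R K b / algebraMap R K q.content, q.isPrimitive_primPart,
    div_ne_zero hb0 hc0, ?_⟩
  rw [q.eq_C_content_mul_primPart, Polynomial.map_mul, map_C] at hq'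
  apply mul_left_cancel₀ (C_ne_zero.2 hc0)
  rw [hq', ← mul_assoc, ← C_mul, mul_div_cancel₀ _ hc0]

namespace CurveField

variable {k : Type*} [Field k] {f : k[X]}

section
variable [hirr : Fact (Irreducible ((X : (RatFunc k)[X]) ^ 2 - C (algebraMap k[X] (RatFunc k) f)))]

/-- An element of `k(x, y)` outside `k(x)` has at least three poles: it satisfies no relation of
degree 2 in `x`. -/
theorem no_quadratic_relation [CharZero k] (hf : Squarefree f) (hd : 5 ≤ f.natDegree)
    {z : CurveField f} (hz : ∀ A : RatFunc k, z ≠ algebraMap (RatFunc k) _ A) {p₀ p₁ p₂ : k[X]}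
    (hp : p₂ ≠ 0)
    (h : aeval z p₀ + aeval z p₁ * x f + aeval z p₂ * x f ^ 2 = 0) : False := by
  obtain ⟨A, B, hAB⟩ := exists_rep f z
  have hB : B ≠ 0 := by
    rintro rfl
    exact hz A (by simpa using hAB)
  set F : RatFunc k := algebraMap k[X] (RatFunc k) f with hF
  -- The polynomial of z = A + By over k(x), with trace 2A and norm A² - B²f.
  set m : (RatFunc k)[X] := X ^ 2 + C (-2 * A) * X + C (A ^ 2 - B ^ 2 * F) with hm
  have hmm : m.Monic := by
    rw [hm, add_assoc]
    exact monic_X_pow_add (n := 2) (degree_linear_le.trans_lt (by norm_num))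
  have hmd : m.degree = 2 := by
    rw [hm, add_assoc, degree_add_eq_left_of_degree_lt] <;> rw [degree_X_pow]
    · norm_num
    · exact degree_linear_le.trans_lt (by norm_num)
  have hy2 : y f ^ 2 = algebraMap (RatFunc k) _ F := by rw [y_sq, algebraMap_algebraMap]
  have hmz : aeval z m = 0 := by
    simp only [hm, map_add, map_mul, map_pow, aeval_X, aeval_C, map_sub, map_neg, hAB, ← hy2,
      map_ofNat]
    ring
  -- The assumed relation as a polynomial in z (outer variable) with coefficients in k[x] of degree
  -- at most 2 (inner variable).
  set P : k[X][X] := p₀.map C + p₁.map C * C X + p₂.map C * C (X ^ 2) with hP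
  have hPc (i : ℕ) : P.coeff i = C (p₀.coeff i) + C (p₁.coeff i) * X + C (p₂.coeff i) * X ^ 2 := by
    simp [hP, -map_pow]
  have hP0 : P ≠ 0 := by
    intro h0
    apply hp
    ext i
    have := congrArg (fun q : k[X][X] => (q.coeff i).coeff 2) h0
    simp only [hPc, coeff_zero, coeff_add, coeff_C_mul, coeff_C_succ, coeff_X_pow, coeff_X] at this
    simpa using this
  have hPd (i : ℕ) : (P.coeff i).natDegree ≤ 2 := by
    rw [hPc]
    compute_degree
  have hev (p : k[X]) :
      aeval z ((p.map C).map (algebraMap k[X] (RatFunc k)) : (RatFunc k)[X]) = aeval z p := by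
    rw [Polynomial.map_map, aeval_def, eval₂_map, aeval_def]
    congr 1
  have hPz : aeval z (P.map (algebraMap k[X] (RatFunc k))) = 0 := by
    rw [hP]
    simp only [Polynomial.map_add, Polynomial.map_mul, map_add, map_mul, hev, map_C, aeval_C]
    rw [algebraMap_algebraMap, algebraMap_algebraMap, map_pow, aeval_X]
    exact h
  have hdvd : m ∣ P.map (algebraMap k[X] (RatFunc k)) := by
    rw [← modByMonic_eq_zero_iff_dvd hmm]
    set r := P.map (algebraMap k[X] (RatFunc k)) %ₘ m with hr
    have hrd : r.degree < 2 := hmd ▸ degree_modByMonic_lt _ hmm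
    have hrz : aeval z r = 0 := by
      have := modByMonic_add_div (P.map (algebraMap k[X] (RatFunc k))) m
      rw [← this, map_add, map_mul, hmz, zero_mul, add_zero] at hPz
      exact hPz
    -- A remainder of degree at most 1 that vanishes at z is zero, because B ≠ 0 makes 1 and z
    -- independent over k(x).
    have hre := eq_X_add_C_of_degree_le_one (p := r) (Order.le_of_lt_succ hrd)
    rw [hre] at hrz
    simp only [map_add, map_mul, aeval_C, aeval_X, hAB] at hrz
    have := rep_eq_zero f (A := r.coeff 1 * A + r.coeff 0) (B := r.coeff 1 * B) (by
      rw [map_add, map_mul, map_mul]; linear_combination hrz)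
    have h1 : r.coeff 1 = 0 := by simpa [hB] using this.2
    have h0 : r.coeff 0 = 0 := by simpa [h1] using this.1
    rw [hre, h1, h0]
    simp
  -- By Gauss's lemma the primitive multiple M of m already divides P over k[x], so its coefficients
  -- also have degree at most 2 in x.
  obtain ⟨M, c, hMp, hc, hM⟩ := exists_isPrimitive_map_eq (R := k[X]) hmm.ne_zero
  have hMP : M ∣ P := by
    refine hMp.dvd_of_fraction_map_dvd_fraction_map (K := RatFunc k) ?_
    rw [hM]
    exact (IsUnit.mul_left_dvd (by simpa using hc)).2 hdvd
  have hMd := natDegree_coeff_le_of_dvd hP0 hMP hPd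
  have hMc (i : ℕ) : algebraMap k[X] (RatFunc k) (M.coeff i) = c * m.coeff i := by
    rw [← coeff_map, hM, coeff_C_mul]
  have m0 : m.coeff 0 = A ^ 2 - B ^ 2 * F := by
    simp only [hm, coeff_add, coeff_X_pow, coeff_C_mul, coeff_X, coeff_C]
    norm_num
  have m1 : m.coeff 1 = -2 * A := by
    simp only [hm, coeff_add, coeff_X_pow, coeff_C_mul, coeff_X, coeff_C]
    norm_num
  have m2 : m.coeff 2 = 1 := by
    simp only [hm, coeff_add, coeff_X_pow, coeff_C_mul, coeff_X, coeff_C]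
    norm_num
  -- The discriminant of M has degree at most 4 in x, but it equals (2cB)²f. As f is squarefree, 2cB
  -- is a nonzero polynomial, so the degree is at least 5.
  have key : (2 * c * B) ^ 2 * F = algebraMap k[X] (RatFunc k)
      (M.coeff 1 ^ 2 - 4 * M.coeff 0 * M.coeff 2) := by
    simp only [map_sub, map_mul, map_pow, hMc, m0, m1, m2, map_ofNat]
    ring
  obtain ⟨p, hpe⟩ := exists_polynomial_of_sq_mul_eq hf key
  have hp0 : p ≠ 0 := by
    rintro rfl
    rw [map_zero] at hpe
    have h2 : (2 : RatFunc k) ≠ 0 := by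
      rw [← map_ofNat (algebraMap k (RatFunc k)) 2]
      exact (_root_.map_ne_zero _).2 two_ne_zero
    exact mul_ne_zero (mul_ne_zero h2 hc) hB hpe
  rw [hpe, hF, ← map_pow, ← map_mul] at key
  have key' := RatFunc.algebraMap_injective k key
  have hle : (M.coeff 1 ^ 2 - 4 * M.coeff 0 * M.coeff 2).natDegree ≤ 4 := by
    have h0 := hMd 0
    have h1 := hMd 1
    have h2 := hMd 2
    compute_degree
    refine max_le (by lia) (by lia)
  rw [← key', natDegree_mul (pow_ne_zero 2 hp0) (fun h0 => by simp [h0] at hd)] at hle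
  lia

end
end CurveField
end ShaskaSurface

/-! ### Möbius transformations of sextic forms and the shape of automorphisms. -/

namespace ShaskaSurface

open Polynomial IntermediateField

section Mobius

variable {k : Type*} [Field k]

/-- The binary sextic form of `f`, evaluated at `(a X + b, c X + d)`. -/
noncomputable def mobius (f : k[X]) (a b c d : k) : k[X] :=
  ∑ i ∈ Finset.range 7, C (f.coeff i) * (C a * X + C b) ^ i * (C c * X + C d) ^ (6 - i)

theorem aeval_mobius {L : Type*} [Field L] [Algebra k L] {f : k[X]} (hf : f.natDegree ≤ 6)
    {a b c d : k} {U V : L} (h : V * (algebraMap k L c * U + algebraMap k L d) =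
      algebraMap k L a * U + algebraMap k L b) :
    aeval U (mobius f a b c d) =
      (algebraMap k L c * U + algebraMap k L d) ^ 6 * aeval V f := by
  rw [aeval_eq_sum_range' (Nat.lt_succ_of_le hf) V, Finset.mul_sum, mobius, map_sum]
  refine Finset.sum_congr rfl fun i hi => ?_
  have hi' : i + (6 - i) = 6 := by
    have := Finset.mem_range.1 hi
    lia
  simp only [map_mul, map_pow, map_add, aeval_C, aeval_X, Algebra.smul_def]
  rw [← h, mul_pow, show (algebraMap k L c * U + algebraMap k L d) ^ 6 =
    (algebraMap k L c * U + algebraMap k L d) ^ i *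
      (algebraMap k L c * U + algebraMap k L d) ^ (6 - i) by rw [← pow_add, hi']]
  ring

theorem natDegree_mobius_le (f : k[X]) (a b c d : k) : (mobius f a b c d).natDegree ≤ 6 := by
  refine natDegree_sum_le_of_forall_le _ _ fun i hi => ?_
  have := Finset.mem_range.1 hi
  refine natDegree_mul_le.trans ?_
  have h1 : ((C a * X + C b) ^ i : k[X]).natDegree ≤ i * 1 := natDegree_pow_le_of_le _ natDegree_linear_le
  have h2 : ((C c * X + C d) ^ (6 - i) : k[X]).natDegree ≤ (6 - i) * 1 :=
    natDegree_pow_le_of_le _ natDegree_linear_le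
  have h3 : (C (f.coeff i) * (C a * X + C b) ^ i).natDegree ≤ i * 1 :=
    (natDegree_C_mul_le _ _).trans h1
  lia

end Mobius

/-- A generator of `k(x)` is a Möbius transform of `x`. -/
theorem exists_mobius_of_adjoin_eq_top {k : Type*} [Field k] {A : RatFunc k}
    (h : (RatFunc.X : RatFunc k) ∈ k⟮A⟯) : ∃ a b c d : k, a * d - b * c ≠ 0 ∧
      A.num = C a * X + C b ∧ A.denom = C c * X + C d := by
  have htop : k⟮A⟯ = ⊤ := by
    rw [eq_top_iff, ← RatFunc.adjoin_X, IntermediateField.adjoin_simple_le_iff]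
    exact h
  -- The degree of k(x) over k(A) is the larger of the degrees of numerator and denominator, here 1.
  have h1 := RatFunc.finrank_eq_max_natDegree A
  rw [htop, IntermediateField.finrank_top] at h1
  have hn : A.num.natDegree ≤ 1 := h1 ▸ le_max_left _ _
  have hd : A.denom.natDegree ≤ 1 := h1 ▸ le_max_right _ _
  have en := eq_X_add_C_of_natDegree_le_one hn
  have ed := eq_X_add_C_of_natDegree_le_one hd
  refine ⟨_, _, _, _, ?_, en, ed⟩
  intro hdet
  set a := A.num.coeff 1
  set b := A.num.coeff 0
  set c := A.denom.coeff 1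
  set d := A.denom.coeff 0
  have hrel : C c * A.num = C a * A.denom := by
    rw [en, ed]
    have hdet' : C a * C d - C b * C c = (0 : k[X]) := by
      rw [← C_mul, ← C_mul, ← C_sub, hdet, C_0]
    linear_combination -hdet'
  have hcop := A.isCoprime_num_denom
  by_cases ha : a = 0
  · have hn0 : A.num.natDegree = 0 := by rw [en, ha]; simp
    have hc : c ≠ 0 := by
      intro hc
      have hd0 : A.denom.natDegree = 0 := by rw [ed, hc]; simp
      rw [hn0, hd0] at h1
      simp at h1
    rw [ha, C_0, zero_mul, mul_eq_zero, C_eq_zero] at hrel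
    have hnum : A.num = 0 := hrel.resolve_left hc
    rw [hnum, isCoprime_zero_left] at hcop
    rw [hn0, natDegree_eq_zero_of_isUnit hcop] at h1
    simp at h1
  · have hdvd : A.num ∣ C a := hcop.dvd_of_dvd_mul_right ⟨C c, by rw [← hrel]; ring⟩
    have hu : IsUnit A.num := isUnit_of_dvd_unit hdvd (isUnit_C.2 (Ne.isUnit ha))
    have := natDegree_eq_zero_of_isUnit hu
    exact ha (coeff_eq_zero_of_natDegree_lt (by lia))

namespace CurveField

variable {k : Type*} [Field k] {f : k[X]}
variable [hirr : Fact (Irreducible ((X : (RatFunc k)[X]) ^ 2 - C (algebraMap k[X] (RatFunc k) f)))]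

theorem algHom_algebraMap {L : Type*} [Field L] [Algebra k L] (φ : CurveField f →ₐ[k] L)
    (A : RatFunc k) : φ (algebraMap (RatFunc k) (CurveField f) A) =
      aeval (φ (x f)) A.num / aeval (φ (x f)) A.denom := by
  conv_lhs => rw [← A.num_div_denom]
  rw [map_div₀, algebraMap_algebraMap, algebraMap_algebraMap, map_div₀, ← aeval_algHom_apply,
    ← aeval_algHom_apply]

/-- Write σ⁻¹(x) = A + By and apply σ: x = A(z) + B(z)σ(y) with z = σ(x). Since σ(y)² = f(z),
eliminating σ(y) gives a quadratic equation for x over k[z], which `no_quadratic_relation` excludes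
unless z lies in k(x). -/
theorem exists_aut_x [CharZero k] (hf : Squarefree f) (hd : 5 ≤ f.natDegree)
    (σ : CurveField f ≃ₐ[k] CurveField f) :
    ∃ A : RatFunc k, σ (x f) = algebraMap (RatFunc k) _ A := by
  by_contra! hz
  obtain ⟨A, B, hAB⟩ := exists_rep f (σ.symm (x f))
  have hA := A.num_div_denom
  have hB := B.num_div_denom
  have hA0 : algebraMap k[X] (RatFunc k) A.denom ≠ 0 := RatFunc.algebraMap_ne_zero A.denom_ne_zero
  have hB0 : algebraMap k[X] (RatFunc k) B.denom ≠ 0 := RatFunc.algebraMap_ne_zero B.denom_ne_zero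
  rw [div_eq_iff hA0] at hA
  rw [div_eq_iff hB0] at hB
  have e1 : aeval (x f) A.denom * aeval (x f) B.denom * σ.symm (x f) =
      aeval (x f) A.num * aeval (x f) B.denom + aeval (x f) B.num * aeval (x f) A.denom * y f := by
    simp only [← algebraMap_algebraMap, hA, hB, hAB, map_mul]
    ring
  have e2 := congrArg σ e1
  simp only [map_mul, map_add, AlgEquiv.apply_symm_apply] at e2
  have hσ (p : k[X]) : σ (aeval (x f) p) = aeval (σ (x f)) p := (aeval_algHom_apply σ _ p).symm
  have hy : σ (y f) ^ 2 = aeval (σ (x f)) f := by rw [← map_pow, y_sq, hσ]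
  simp only [hσ] at e2
  refine no_quadratic_relation hf hd hz
    (p₀ := (A.num * B.denom) ^ 2 - (B.num * A.denom) ^ 2 * f)
    (p₁ := -2 * (A.num * B.denom) * (A.denom * B.denom))
    (p₂ := (A.denom * B.denom) ^ 2)
    (pow_ne_zero 2 (mul_ne_zero A.denom_ne_zero B.denom_ne_zero)) ?_
  simp only [map_sub, map_mul, map_pow, map_neg, map_ofNat, ← hy]
  linear_combination (aeval (σ (x f)) A.denom * aeval (σ (x f)) B.denom * x f
    - aeval (σ (x f)) A.num * aeval (σ (x f)) B.denom
    + aeval (σ (x f)) B.num * aeval (σ (x f)) A.denom * σ (y f)) * e2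

/-- Both σ and σ⁻¹ preserve k(x), so σ is Möbius on x. On y, the equation σ(y)² ∈ k(x) leaves only a
multiple Dy, and D times the cube of the denominator must be a constant e because f is squarefree of
degree at least 5. -/
theorem exists_aut_form [CharZero k] (hf : Squarefree f) (hd : 5 ≤ f.natDegree)
    (hd6 : f.natDegree ≤ 6) (σ : CurveField f ≃ₐ[k] CurveField f) :
    ∃ a b c d e : k, a * d - b * c ≠ 0 ∧ e ≠ 0 ∧
      mobius f a b c d = C (e ^ 2) * f ∧
      algebraMap k _ c * x f + algebraMap k _ d ≠ 0 ∧
      σ (x f) * (algebraMap k _ c * x f + algebraMap k _ d) =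
        algebraMap k _ a * x f + algebraMap k _ b ∧
      σ (y f) * (algebraMap k _ c * x f + algebraMap k _ d) ^ 3 = algebraMap k _ e * y f := by
  obtain ⟨A, hA⟩ := exists_aut_x hf hd σ
  obtain ⟨A', hA'⟩ := exists_aut_x hf hd σ.symm
  -- With σ⁻¹(x) = A'(x), applying σ gives x = A'(A).
  have hmem : (RatFunc.X : RatFunc k) ∈ k⟮A⟯ := by
    have h1 : x f = algebraMap (RatFunc k) _ (aeval A A'.num / aeval A A'.denom) := by
      have h2 := congrArg σ hA'
      rw [AlgEquiv.apply_symm_apply] at h2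
      rw [h2]
      refine (algHom_algebraMap (σ : CurveField f →ₐ[k] CurveField f) A').trans ?_
      rw [map_div₀]
      simp only [AlgEquiv.coe_toAlgHom, hA, aeval_algebraMap_apply]
    have h3 := (algebraMap (RatFunc k) (CurveField f)).injective h1
    rw [h3]
    have h (p : k[X]) : aeval A p ∈ k⟮A⟯ := by
      rw [aeval_eq_sum_range]
      exact sum_mem fun i _ => IntermediateField.smul_mem _
        (pow_mem (IntermediateField.mem_adjoin_simple_self k A) i)
    exact div_mem (h _) (h _)
  obtain ⟨a, b, c, d, hdet, hn, hden⟩ := exists_mobius_of_adjoin_eq_top hmem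
  have hq0 : algebraMap k[X] (RatFunc k) A.denom ≠ 0 := RatFunc.algebraMap_ne_zero A.denom_ne_zero
  have hx0 : algebraMap k (CurveField f) c * x f + algebraMap k _ d =
      algebraMap (RatFunc k) _ (algebraMap k[X] (RatFunc k) A.denom) := by
    rw [algebraMap_algebraMap, hden]
    simp
  have hx1 : algebraMap k (CurveField f) a * x f + algebraMap k _ b =
      algebraMap (RatFunc k) _ (algebraMap k[X] (RatFunc k) A.num) := by
    rw [algebraMap_algebraMap, hn]
    simp
  have hx2 : algebraMap k (CurveField f) c * x f + algebraMap k _ d ≠ 0 := by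
    rw [hx0]
    simpa using A.denom_ne_zero
  have hσx : σ (x f) * (algebraMap k _ c * x f + algebraMap k _ d) =
        algebraMap k _ a * x f + algebraMap k _ b := by
    rw [hx0, hx1, hA, ← map_mul]
    congr 1
    have := A.num_div_denom
    rwa [div_eq_iff hq0, eq_comm] at this
  obtain ⟨B, D, hBD⟩ := exists_rep f (σ (y f))
  have hσy : σ (y f) ^ 2 = aeval (σ (x f)) f := by
    rw [← map_pow, y_sq]
    exact (aeval_algHom_apply σ _ f).symm
  have hyF : y f ^ 2 = algebraMap (RatFunc k) _ (algebraMap k[X] (RatFunc k) f) := by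
    rw [y_sq, algebraMap_algebraMap]
  -- Comparing the components of σ(y)² = (B + Dy)² with f(A) ∈ k(x): the coefficient 2BD of y
  -- vanishes.
  have h0 : B ^ 2 + D ^ 2 * algebraMap k[X] (RatFunc k) f - aeval A f = 0 ∧ 2 * B * D = 0 := by
    refine rep_eq_zero f ?_
    rw [hA, aeval_algebraMap_apply, hBD] at hσy
    simp only [map_sub, map_add, map_mul, map_pow, map_ofNat, ← hyF]
    linear_combination hσy
  -- If D = 0 then σ(y) lies in k(x), and σ⁻¹ would put y into k(x).
  have hD : D ≠ 0 := by
    rintro rfl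
    rw [map_zero, zero_mul, add_zero] at hBD
    have h1 := congrArg σ.symm hBD
    rw [AlgEquiv.symm_apply_apply] at h1
    have h2 := h1.trans (algHom_algebraMap (σ.symm : CurveField f →ₐ[k] CurveField f) B)
    simp only [AlgEquiv.coe_toAlgHom, hA', aeval_algebraMap_apply, ← map_div₀] at h2
    exact y_ne_algebraMap f _ h2
  have hB : B = 0 := by
    have h2 : (2 : RatFunc k) ≠ 0 := by
      rw [← map_ofNat (algebraMap k (RatFunc k)) 2]
      exact (_root_.map_ne_zero _).2 two_ne_zero
    simpa [hD, h2] using h0.2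
  rw [hB, map_zero, zero_add] at hBD
  have hmob := aeval_mobius hd6 hσx
  have key : (D * algebraMap k[X] (RatFunc k) A.denom ^ 3) ^ 2 * algebraMap k[X] (RatFunc k) f =
      algebraMap k[X] (RatFunc k) (mobius f a b c d) := by
    apply (algebraMap (RatFunc k) (CurveField f)).injective
    rw [algebraMap_algebraMap, hmob, ← hσy, hBD, hx0]
    simp only [map_mul, map_pow, mul_pow, hyF]
    ring
  obtain ⟨p, hp⟩ := exists_polynomial_of_sq_mul_eq hf key
  have hp0 : p ≠ 0 := by
    rintro rfl
    rw [map_zero] at hp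
    exact mul_ne_zero hD (pow_ne_zero 3 hq0) hp
  rw [hp, ← map_pow, ← map_mul] at key
  have key' := RatFunc.algebraMap_injective k key
  have hle := natDegree_mobius_le f a b c d
  -- Here p²f is the transformed sextic, of degree at most 6, while f has degree at least 5; so p is
  -- constant.
  rw [← key', natDegree_mul (pow_ne_zero 2 hp0) (fun h0 => by simp [h0] at hd),
    natDegree_pow] at hle
  obtain ⟨e, rfl⟩ := natDegree_eq_zero.1 (show p.natDegree = 0 by lia)
  refine ⟨a, b, c, d, e, hdet, by simpa using hp0, by rw [← key', C_pow], hx2, hσx, ?_⟩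
  have := congrArg (algebraMap (RatFunc k) (CurveField f)) hp
  rw [algebraMap_algebraMap, aeval_C, map_mul, map_pow, ← hx0] at this
  rw [hBD, ← this]
  ring

end CurveField
end ShaskaSurface

/-! ### Dihedral groups; automorphism groups from stabilizers of sextic forms. -/

namespace ShaskaSurface

open Polynomial IntermediateField

/-- The isomorphism sends `r i` to ρ^i and `sr i` to τρ^i. It is injective because τ is not a power
of ρ, and surjective by the last hypothesis. -/
theorem nonempty_mulEquiv_dihedralGroup {G : Type*} [Group G] {n : ℕ} [NeZero n] {ρ τ : G}
    (hρ : orderOf ρ = n) (hτ : τ * τ = 1) (hτρ : τ * ρ * τ = ρ⁻¹) (hne : ∀ i : ℕ, ρ ^ i ≠ τ)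
    (hall : ∀ g : G, ∃ i : ℕ, g = ρ ^ i ∨ g = τ * ρ ^ i) :
    Nonempty (G ≃* DihedralGroup n) := by
  have hρn : ρ ^ n = 1 := hρ ▸ pow_orderOf_eq_one ρ
  let φ : ZMod n → G := fun i => ρ ^ i.val
  have hφadd (i j : ZMod n) : φ (i + j) = φ i * φ j := by
    simp only [φ, ZMod.val_add, ← pow_add]
    exact (pow_eq_pow_mod _ hρn).symm
  have hφ0 : φ 0 = 1 := by simp [φ]
  have hφneg (i : ZMod n) : φ (-i) = (φ i)⁻¹ := by
    rw [eq_inv_iff_mul_eq_one, ← hφadd, neg_add_cancel, hφ0]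
  have hφsub (i j : ZMod n) : φ (j - i) = (φ i)⁻¹ * φ j := by
    rw [sub_eq_neg_add, hφadd, hφneg]
  have hτinv : τ⁻¹ = τ := inv_eq_of_mul_eq_one_left hτ
  have hconj (m : ℕ) : τ * ρ ^ m * τ = (ρ ^ m)⁻¹ := by
    have : τ * ρ * τ⁻¹ = ρ⁻¹ := by rw [hτinv, hτρ]
    calc τ * ρ ^ m * τ = τ * ρ ^ m * τ⁻¹ := by rw [hτinv]
      _ = (τ * ρ * τ⁻¹) ^ m := by rw [conj_pow]
      _ = _ := by rw [this, inv_pow]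
  have hswap (m : ℕ) : ρ ^ m * τ = τ * (ρ ^ m)⁻¹ := by
    rw [← hconj m, ← mul_assoc, ← mul_assoc, hτ, one_mul]
  let Φ : DihedralGroup n →* G := MonoidHom.mk'
    (fun g => match g with
      | .r i => φ i
      | .sr i => τ * φ i) (by
    rintro (i | i) (j | j)
    · simp only [DihedralGroup.r_mul_r, hφadd]
    · simp only [DihedralGroup.r_mul_sr, hφsub]
      rw [← mul_assoc, ← mul_assoc, hswap]
    · simp only [DihedralGroup.sr_mul_r, hφadd, mul_assoc]
    · simp only [DihedralGroup.sr_mul_sr, hφsub]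
      rw [← mul_assoc, hconj])
  refine ⟨(MulEquiv.ofBijective Φ ⟨?_, ?_⟩).symm⟩
  · rw [injective_iff_map_eq_one]
    rintro (i | i) h
    · have h' : ρ ^ i.val = 1 := h
      rw [← orderOf_dvd_iff_pow_eq_one, hρ] at h'
      have h0 := Nat.eq_zero_of_dvd_of_lt h' (ZMod.val_lt i)
      rw [ZMod.val_eq_zero] at h0
      rw [h0, DihedralGroup.one_def]
    · have h' : τ * ρ ^ i.val = 1 := h
      exact absurd ((eq_inv_of_mul_eq_one_right h').trans hτinv) (hne _)
  · intro g
    have hi (i : ℕ) : φ (i : ZMod n) = ρ ^ i := by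
      simp only [φ, ZMod.val_natCast]
      exact (pow_eq_pow_mod _ hρn).symm
    obtain ⟨i, rfl | rfl⟩ := hall g
    · exact ⟨.r i, hi i⟩
    · exact ⟨.sr i, congrArg (τ * ·) (hi i)⟩

namespace CurveField

variable {k : Type*} [Field k] {f g : k[X]}
variable [hirr : Fact (Irreducible ((X : (RatFunc k)[X]) ^ 2 - C (algebraMap k[X] (RatFunc k) f)))]
variable [hirr' : Fact (Irreducible ((X : (RatFunc k)[X]) ^ 2 - C (algebraMap k[X] (RatFunc k) g)))]

omit hirr in
theorem linear_ne_zero {a b c d : k} (hdet : a * d - b * c ≠ 0) :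
    algebraMap k (CurveField g) c * x g + algebraMap k _ d ≠ 0 := by
  intro h
  refine transcendental_x g ⟨C c * X + C d, ?_, by simpa using h⟩
  intro h0
  have h1 : c = 0 := by simpa using congrArg (fun p => coeff p 1) h0
  have h2 : d = 0 := by simpa using congrArg (fun p => coeff p 0) h0
  simp [h1, h2] at hdet

/-- The map is x ↦ (ax + b)/(cx + d), y ↦ ey/(cx + d)³. The images generate the target since the
Möbius map on x can be inverted. -/
theorem exists_equiv_of_mobius (hf6 : f.natDegree ≤ 6) {a b c d e : k}
    (hdet : a * d - b * c ≠ 0) (he : e ≠ 0) (h : mobius f a b c d = C (e ^ 2) * g) :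
    ∃ ψ : CurveField f ≃ₐ[k] CurveField g,
      ψ (x f) * (algebraMap k _ c * x g + algebraMap k _ d) =
        algebraMap k _ a * x g + algebraMap k _ b ∧
      ψ (y f) * (algebraMap k _ c * x g + algebraMap k _ d) ^ 3 = algebraMap k _ e * y g := by
  have hq := linear_ne_zero (g := g) hdet
  set q := algebraMap k (CurveField g) c * x g + algebraMap k _ d with hqdef
  set U := (algebraMap k (CurveField g) a * x g + algebraMap k _ b) / q with hUdef
  set V := algebraMap k (CurveField g) e * y g / q ^ 3 with hVdef
  have hU : U * q = algebraMap k (CurveField g) a * x g + algebraMap k _ b := div_mul_cancel₀ _ hq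
  have hV : V * q ^ 3 = algebraMap k (CurveField g) e * y g := div_mul_cancel₀ _ (pow_ne_zero 3 hq)
  have he' : algebraMap k (CurveField g) e ≠ 0 := by simpa using he
  have hdet' : algebraMap k (CurveField g) (a * d - b * c) ≠ 0 := (_root_.map_ne_zero _).2 hdet
  have hUc : (algebraMap k _ a - algebraMap k (CurveField g) c * U) * q =
      algebraMap k _ (a * d - b * c) := by
    simp only [map_sub, map_mul]
    rw [hqdef] at hU ⊢
    linear_combination -algebraMap k (CurveField g) c * hU
  have hUc0 : algebraMap k _ a - algebraMap k (CurveField g) c * U ≠ 0 := by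
    intro h0
    rw [h0, zero_mul] at hUc
    exact hdet' hUc.symm
  have hx : x g = (algebraMap k _ d * U - algebraMap k _ b) /
      (algebraMap k _ a - algebraMap k (CurveField g) c * U) := by
    rw [eq_div_iff hUc0]
    rw [hqdef] at hU
    linear_combination -hU
  have hy : y g = V * q ^ 3 / algebraMap k _ e := by
    rw [eq_div_iff he', hV, mul_comm]
  have hUt : Transcendental k U := by
    intro hal
    apply transcendental_x g
    rw [hx, div_eq_mul_inv]
    have hc (r : k) : IsAlgebraic k (algebraMap k (CurveField g) r) := isAlgebraic_algebraMap r
    exact (((hc d).mul hal).sub (hc b)).mul ((hc a).sub ((hc c).mul hal)).inv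
  have hVU : V ^ 2 = aeval U f := by
    have h1 := aeval_mobius hf6 hU
    rw [h, map_mul, aeval_C, ← y_sq, map_pow, ← mul_pow, ← hV] at h1
    apply mul_left_cancel₀ (pow_ne_zero 6 hq)
    rw [← h1]
    ring
  obtain ⟨ψ, hψx, hψy⟩ := exists_lift (f := f) hUt hVU
  have htop : ψ.fieldRange = ⊤ := by
    rw [eq_top_iff, ← adjoin_eq_top, IntermediateField.adjoin_le_iff]
    have hUm : U ∈ ψ.fieldRange := ⟨x f, hψx⟩
    have hVm : V ∈ ψ.fieldRange := ⟨y f, hψy⟩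
    have hc (r : k) : algebraMap k (CurveField g) r ∈ ψ.fieldRange := ψ.fieldRange.algebraMap_mem r
    have hxm : x g ∈ ψ.fieldRange := by
      rw [hx]
      exact div_mem (sub_mem (mul_mem (hc d) hUm) (hc b)) (sub_mem (hc a) (mul_mem (hc c) hUm))
    rintro z (rfl | rfl)
    · exact hxm
    · rw [hy]
      exact div_mem (mul_mem hVm (pow_mem (add_mem (mul_mem (hc c) hxm) (hc d)) 3)) (hc e)
  have hsurj : Function.Surjective ψ := by
    intro z
    have : z ∈ ψ.fieldRange := htop ▸ IntermediateField.mem_top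
    exact this
  have hbij : Function.Bijective ψ := ⟨ψ.toRingHom.injective, hsurj⟩
  refine ⟨AlgEquiv.ofBijective ψ hbij, ?_, ?_⟩
  · rw [AlgEquiv.ofBijective_apply, hψx, hU]
  · rw [AlgEquiv.ofBijective_apply, hψy, hV]

-- The generators are ρ : (x, y) ↦ (ζ²x, ζ³y) and τ : (x, y) ↦ (1/x, y/x³). With these exponents ρ
-- has order exactly n, as ζ = ζ³/ζ². Multiplying (a, b, c, d) by λ and e by λ³ gives the same
-- automorphism, so the two alternatives in the last hypothesis describe ρ^i and τρ^i up to such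
-- scaling.
omit hirr in
theorem nonempty_curveAut_mulEquiv_dihedralGroup [CharZero k] (hg : Squarefree g)
    (hg5 : 5 ≤ g.natDegree) (hg6 : g.natDegree ≤ 6) {n : ℕ} [NeZero n] {ζ : k}
    (hζ : IsPrimitiveRoot ζ n)
    (hr : mobius g (ζ ^ 2) 0 0 1 = C ((ζ ^ 3) ^ 2) * g) (hs : mobius g 0 1 1 0 = g)
    (hall : ∀ a b c d e : k, a * d - b * c ≠ 0 → e ≠ 0 → mobius g a b c d = C (e ^ 2) * g →
      ∃ i : ℕ, (b = 0 ∧ c = 0 ∧ a = (ζ ^ i) ^ 2 * d ∧ e = (ζ ^ i) ^ 3 * d ^ 3) ∨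
        (a = 0 ∧ d = 0 ∧ b = (ζ ^ i) ^ 2 * c ∧ e = (ζ ^ i) ^ 3 * c ^ 3)) :
    Nonempty (CurveAut g ≃* DihedralGroup n) := by
  have hζ0 : ζ ≠ 0 := hζ.ne_zero (NeZero.ne n)
  obtain ⟨ρ, hρx, hρy⟩ := exists_equiv_of_mobius (f := g) (g := g) hg6 (a := ζ ^ 2) (b := 0)
    (c := 0) (d := 1) (e := ζ ^ 3) (by simpa using hζ0) (pow_ne_zero 3 hζ0) hr
  obtain ⟨τ, hτx, hτy⟩ := exists_equiv_of_mobius (f := g) (g := g) hg6 (a := 0) (b := 1)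
    (c := 1) (d := 0) (e := 1) (by simp) one_ne_zero (by simpa using hs)
  simp only [map_zero, map_one, zero_mul, zero_add, one_pow, mul_one, add_zero] at hρx hρy
  simp only [map_zero, map_one, zero_mul, zero_add, one_mul, add_zero] at hτx hτy
  have hx0 : x g ≠ 0 := by
    simpa using linear_ne_zero (g := g) (a := 0) (b := 1) (c := 1) (d := 0) (by simp)
  have hx3 : x g ^ 3 ≠ 0 := pow_ne_zero 3 hx0
  replace hτx : τ (x g) = (x g)⁻¹ := eq_inv_of_mul_eq_one_left hτx
  replace hτy : τ (y g) = y g / x g ^ 3 := by rw [eq_div_iff hx3, hτy]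
  have hext {σ σ' : CurveAut g} (h1 : σ (x g) = σ' (x g)) (h2 : σ (y g) = σ' (y g)) : σ = σ' := by
    have := algHom_ext (ψ := (σ : CurveField g →ₐ[k] CurveField g))
      (φ := (σ' : CurveField g →ₐ[k] CurveField g)) h1 h2
    exact AlgEquiv.ext fun z => DFunLike.congr_fun this z
  have hρpow (i : ℕ) : (ρ ^ i) (x g) = algebraMap k _ ((ζ ^ i) ^ 2) * x g ∧
      (ρ ^ i) (y g) = algebraMap k _ ((ζ ^ i) ^ 3) * y g := by
    induction i with
    | zero => simp
    | succ i ih =>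
      have hi : ρ ^ (i + 1) = ρ * ρ ^ i := pow_succ' ρ i
      rw [hi, AlgEquiv.mul_apply, AlgEquiv.mul_apply, ih.1, ih.2, map_mul, map_mul,
        AlgEquiv.commutes, AlgEquiv.commutes, hρx, hρy, ← mul_assoc, ← mul_assoc, ← map_mul,
        ← map_mul, pow_succ ζ i, mul_pow, mul_pow]
      exact ⟨rfl, rfl⟩
  have hy0 : y g ≠ 0 := by simpa using y_ne_algebraMap g 0
  have hinj := (algebraMap k (CurveField g)).injective
  have hord (i : ℕ) : ρ ^ i = 1 ↔ n ∣ i := by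
    rw [← hζ.pow_eq_one_iff_dvd]
    constructor
    · intro h
      have h1 := (hρpow i).1
      have h2 := (hρpow i).2
      rw [h, AlgEquiv.one_apply, eq_comm, mul_eq_right₀ hx0, ← map_one (algebraMap k _)] at h1
      rw [h, AlgEquiv.one_apply, eq_comm, mul_eq_right₀ hy0, ← map_one (algebraMap k _)] at h2
      have h1' := hinj h1
      have h2' := hinj h2
      rw [pow_succ, h1', one_mul] at h2'
      exact h2'
    · intro h
      refine hext ?_ ?_
      · rw [(hρpow i).1, h, one_pow, map_one, one_mul, AlgEquiv.one_apply]
      · rw [(hρpow i).2, h, one_pow, map_one, one_mul, AlgEquiv.one_apply]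
  have hζ2 : algebraMap k (CurveField g) (ζ ^ 2) ≠ 0 := by simpa using hζ0
  refine nonempty_mulEquiv_dihedralGroup (ρ := ρ) (τ := τ) ?_ ?_ ?_ ?_ ?_
  · refine Nat.dvd_antisymm (orderOf_dvd_of_pow_eq_one ((hord n).2 dvd_rfl))
      ((hord _).1 (pow_orderOf_eq_one ρ))
  · refine hext ?_ ?_
    · rw [AlgEquiv.mul_apply, hτx, map_inv₀, hτx, inv_inv, AlgEquiv.one_apply]
    · rw [AlgEquiv.mul_apply, hτy, map_div₀, map_pow, hτx, hτy, AlgEquiv.one_apply]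
      field_simp
  · rw [eq_inv_iff_mul_eq_one]
    refine hext ?_ ?_
    · simp only [AlgEquiv.mul_apply, hρx, hτx, map_mul, map_inv₀, AlgEquiv.commutes,
        AlgEquiv.one_apply]
      field_simp
    · simp only [AlgEquiv.mul_apply, hρx, hρy, hτx, hτy, map_mul, map_div₀, map_pow,
        AlgEquiv.commutes, AlgEquiv.one_apply]
      have hζ' : algebraMap k (CurveField g) ζ ≠ 0 := by simpa using hζ0
      field_simp
  · intro i h
    have h1 := (hρpow i).1
    rw [h, hτx] at h1
    replace h1 := congrArg (· * x g) h1
    simp only [inv_mul_cancel₀ hx0] at h1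
    refine transcendental_x g ⟨C ((ζ ^ i) ^ 2) * X ^ 2 - 1, fun h0 => ?_, ?_⟩
    · simpa using congrArg (fun p => coeff p 0) h0
    · rw [map_sub, map_mul, aeval_C, aeval_X_pow, map_one, sub_eq_zero, h1]
      ring
  · intro σ
    obtain ⟨a, b, c, d, e, hdet, he, hm, hq, h1, h2⟩ := exists_aut_form hg hg5 hg6 σ
    obtain ⟨i, ⟨rfl, rfl, rfl, rfl⟩ | ⟨rfl, rfl, rfl, rfl⟩⟩ := hall a b c d e hdet he hm
    · refine ⟨i, Or.inl (hext ?_ ?_)⟩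
      · rw [(hρpow i).1]
        simp only [map_zero, zero_mul, zero_add, add_zero, map_mul] at h1 hq ⊢
        apply mul_right_cancel₀ hq
        rw [h1]
        ring
      · rw [(hρpow i).2]
        simp only [map_zero, zero_mul, zero_add, map_mul, map_pow] at h2 hq ⊢
        apply mul_right_cancel₀ (pow_ne_zero 3 hq)
        rw [h2]
        ring
    · refine ⟨i, Or.inr (hext ?_ ?_)⟩
      · rw [AlgEquiv.mul_apply, (hρpow i).1, map_mul, AlgEquiv.commutes, hτx]
        simp only [map_zero, zero_mul, zero_add, add_zero, map_mul] at h1 hq ⊢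
        apply mul_right_cancel₀ hq
        rw [h1]
        field_simp
      · rw [AlgEquiv.mul_apply, (hρpow i).2, map_mul, AlgEquiv.commutes, hτy]
        simp only [map_zero, add_zero, map_mul, map_pow] at h2 hq ⊢
        apply mul_right_cancel₀ (pow_ne_zero 3 hq)
        rw [h2]
        field_simp

end CurveField
end ShaskaSurface

/-! ### The normal forms x⁵ + sx³ + x and x⁶ + sx³ + 1 and their stabilizers. -/

namespace ShaskaSurface

open Polynomial

variable {k : Type*} [Field k]

theorem sextic_coeff_eq {a₀ a₁ a₂ a₃ a₄ a₅ a₆ b₀ b₁ b₂ b₃ b₄ b₅ b₆ : k}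
    (h : C a₀ + C a₁ * X + C a₂ * X ^ 2 + C a₃ * X ^ 3 + C a₄ * X ^ 4 + C a₅ * X ^ 5 + C a₆ * X ^ 6 =
      C b₀ + C b₁ * X + C b₂ * X ^ 2 + C b₃ * X ^ 3 + C b₄ * X ^ 4 + C b₅ * X ^ 5 + C b₆ * X ^ 6) :
    a₀ = b₀ ∧ a₁ = b₁ ∧ a₂ = b₂ ∧ a₃ = b₃ ∧ a₄ = b₄ ∧ a₅ = b₅ ∧ a₆ = b₆ := by
  have key (n : ℕ) := congrArg (fun p => coeff p n) h
  simp only [coeff_add, coeff_C_mul, coeff_C, coeff_X, coeff_X_pow] at key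
  refine ⟨?_, ?_, ?_, ?_, ?_, ?_, ?_⟩
  · simpa using key 0
  · simpa using key 1
  · simpa using key 2
  · simpa using key 3
  · simpa using key 4
  · simpa using key 5
  · simpa using key 6

theorem mobius_comp_C_mul_X (f : k[X]) (a b c d μ : k) :
    mobius f (a * μ) b (c * μ) d = (mobius f a b c d).comp (C μ * X) := by
  simp only [mobius, sum_comp, mul_comp, pow_comp, add_comp, C_comp, X_comp, C_mul,
    mul_assoc]

/-- The sextic form `X (X⁴ + s X² + 1)`. -/
noncomputable def quinticNormalForm (s : k) : k[X] := X ^ 5 + C s * X ^ 3 + X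

/-- The sextic `X⁶ + s X³ + 1`. -/
noncomputable def sexticNormalForm (s : k) : k[X] := X ^ 6 + C s * X ^ 3 + 1

theorem natDegree_quinticNormalForm (s : k) : (quinticNormalForm s).natDegree = 5 := by
  rw [quinticNormalForm]
  compute_degree!

theorem natDegree_sexticNormalForm (s : k) : (sexticNormalForm s).natDegree = 6 := by
  rw [sexticNormalForm]
  compute_degree!

theorem mobius_quinticNormalForm (s a b c d : k) :
    mobius (quinticNormalForm s) a b c d =
      (C a * X + C b) ^ 5 * (C c * X + C d) + C s * (C a * X + C b) ^ 3 * (C c * X + C d) ^ 3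
        + (C a * X + C b) * (C c * X + C d) ^ 5 := by
  simp [mobius, quinticNormalForm, Finset.sum_range_succ, coeff_X, coeff_X_pow]
  ring

theorem mobius_sexticNormalForm (s a b c d : k) :
    mobius (sexticNormalForm s) a b c d =
      (C a * X + C b) ^ 6 + C s * (C a * X + C b) ^ 3 * (C c * X + C d) ^ 3
        + (C c * X + C d) ^ 6 := by
  simp [mobius, sexticNormalForm, Finset.sum_range_succ, coeff_X_pow, coeff_one]
  ring

theorem separable_of_mul_add_mul_eq_C [CharZero k] {g u v : k[X]} {c : k} (hc : c ≠ 0)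
    (h : u * g + v * derivative g = C c) : g.Separable := by
  refine ⟨C c⁻¹ * u, C c⁻¹ * v, ?_⟩
  rw [mul_assoc, mul_assoc, ← mul_add, h, ← C_mul, inv_mul_cancel₀ hc, C_1]

theorem separable_sexticNormalForm [CharZero k] {s : k} (hs : s ^ 2 ≠ 4) :
    (sexticNormalForm s).Separable := by
  -- With W = 2X³ + s the derivative is 3X²W, and X³(X³ + s) = g - 1 and 4g - W² = 4 - s² for the
  -- sextic g. The quartic below uses the same identity with X² in place of X³.
  refine separable_of_mul_add_mul_eq_C (c := 3 * (4 - s ^ 2))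
    (u := 3 * (4 - (2 * X ^ 3 + C s) ^ 2)) (v := (2 * X ^ 3 + C s) * (X ^ 3 + C s) * X)
    (mul_ne_zero three_ne_zero (sub_ne_zero.2 (Ne.symm hs))) ?_
  simp only [sexticNormalForm, derivative_add, derivative_X_pow, derivative_C_mul, derivative_one,
    C_mul, C_sub, C_pow, map_ofNat, Nat.cast_ofNat]
  ring

theorem separable_quinticNormalForm [CharZero k] {s : k} (hs : s ^ 2 ≠ 4) :
    (quinticNormalForm s).Separable := by
  have hq : (X ^ 4 + C s * X ^ 2 + 1 : k[X]).Separable := by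
    refine separable_of_mul_add_mul_eq_C (c := 2 * (4 - s ^ 2))
      (u := 2 * (4 - (2 * X ^ 2 + C s) ^ 2)) (v := (2 * X ^ 2 + C s) * (X ^ 2 + C s) * X)
      (mul_ne_zero two_ne_zero (sub_ne_zero.2 (Ne.symm hs))) ?_
    simp only [derivative_add, derivative_X_pow, derivative_C_mul, derivative_one,
      C_mul, C_sub, C_pow, map_ofNat, Nat.cast_ofNat]
    ring
  have : quinticNormalForm s = X * (X ^ 4 + C s * X ^ 2 + 1) := by
    rw [quinticNormalForm]
    ring
  rw [this]
  exact separable_X.mul hq ⟨-(X ^ 3 + C s * X), 1, by ring⟩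

/-- A matrix with nonzero determinant for which the product of the entries of each column vanishes
is diagonal or antidiagonal. -/
theorem diagonal_or_antidiagonal {a b c d : k} (hdet : a * d - b * c ≠ 0) (hac : a * c = 0)
    (hbd : b * d = 0) : (b = 0 ∧ c = 0 ∧ d ≠ 0) ∨ (a = 0 ∧ d = 0 ∧ c ≠ 0) := by
  rcases mul_eq_zero.1 hac with rfl | rfl
  · have hb : b ≠ 0 := fun h => hdet (by rw [h]; ring)
    have hc : c ≠ 0 := fun h => hdet (by rw [h]; ring)
    exact Or.inr ⟨rfl, (mul_eq_zero.1 hbd).resolve_left hb, hc⟩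
  · have hd : d ≠ 0 := fun h => hdet (by rw [h]; ring)
    exact Or.inl ⟨(mul_eq_zero.1 hbd).resolve_right hd, rfl, hd⟩

/-- The quartic covariant (fourth transvectant of the form with itself) of X⁶ + sX³Z³ + Z⁶ is (s² +
50)X²Z² up to a constant. After the substitution its extreme coefficients are det⁴(s² + 50)(ac)² and
det⁴(s² + 50)(bd)². They vanish because the transformed form is again a multiple of the normal form,
so ac = bd = 0. -/
theorem sexticNormalForm_stabilizer [CharZero k] {s a b c d e : k} (hs : s ^ 2 ≠ -50)
    (hdet : a * d - b * c ≠ 0)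
    (h : mobius (sexticNormalForm s) a b c d = C (e ^ 2) * sexticNormalForm s) :
    (b = 0 ∧ c = 0 ∧ d ≠ 0) ∨ (a = 0 ∧ d = 0 ∧ c ≠ 0) := by
  rw [mobius_sexticNormalForm] at h
  obtain ⟨h0, h1, h2, h3, h4, h5, h6⟩ := sextic_coeff_eq
    (a₀ := b ^ 6 + s * b ^ 3 * d ^ 3 + d ^ 6)
    (a₁ := 6 * a * b ^ 5 + s * (3 * a * b ^ 2 * d ^ 3 + 3 * b ^ 3 * c * d ^ 2) + 6 * c * d ^ 5)
    (a₂ := 15 * a ^ 2 * b ^ 4 + s * (3 * a ^ 2 * b * d ^ 3 + 9 * a * b ^ 2 * c * d ^ 2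
      + 3 * b ^ 3 * c ^ 2 * d) + 15 * c ^ 2 * d ^ 4)
    (a₃ := 20 * a ^ 3 * b ^ 3 + s * (a ^ 3 * d ^ 3 + 9 * a ^ 2 * b * c * d ^ 2
      + 9 * a * b ^ 2 * c ^ 2 * d + b ^ 3 * c ^ 3) + 20 * c ^ 3 * d ^ 3)
    (a₄ := 15 * a ^ 4 * b ^ 2 + s * (3 * a ^ 3 * c * d ^ 2 + 9 * a ^ 2 * b * c ^ 2 * d
      + 3 * a * b ^ 2 * c ^ 3) + 15 * c ^ 4 * d ^ 2)
    (a₅ := 6 * a ^ 5 * b + s * (3 * a ^ 3 * c ^ 2 * d + 3 * a ^ 2 * b * c ^ 3) + 6 * c ^ 5 * d)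
    (a₆ := a ^ 6 + s * a ^ 3 * c ^ 3 + c ^ 6)
    (b₀ := e ^ 2) (b₁ := 0) (b₂ := 0) (b₃ := e ^ 2 * s) (b₄ := 0) (b₅ := 0) (b₆ := e ^ 2) (by
      rw [sexticNormalForm] at h
      simp only [C_add, C_mul, C_pow, map_ofNat, C_0] at h ⊢
      linear_combination h)
  have hκ : (s ^ 2 + 50) ≠ 0 := fun h => hs (by linear_combination h)
  have hdet4 : (a * d - b * c) ^ 4 ≠ 0 := pow_ne_zero 4 hdet
  have key4 : (a * d - b * c) ^ 4 * ((s ^ 2 + 50) * (a * c) ^ 2) = 0 := by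
    -- The left side is the leading coefficient A₆A₂ - 4A₅A₃ + 3A₄² of the covariant, where A_i are
    -- the coefficients divided by binomials.
    have hi : 50 * ((a ^ 6 + s * a ^ 3 * c ^ 3 + c ^ 6) * (15 * a ^ 2 * b ^ 4
      + s * (3 * a ^ 2 * b * d ^ 3 + 9 * a * b ^ 2 * c * d ^ 2
      + 3 * b ^ 3 * c ^ 2 * d) + 15 * c ^ 2 * d ^ 4) / 15
      - 4 * (6 * a ^ 5 * b + s * (3 * a ^ 3 * c ^ 2 * d + 3 * a ^ 2 * b * c ^ 3) + 6 * c ^ 5 * d) / 6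
        * (20 * a ^ 3 * b ^ 3 + s * (a ^ 3 * d ^ 3 + 9 * a ^ 2 * b * c * d ^ 2
      + 9 * a * b ^ 2 * c ^ 2 * d + b ^ 3 * c ^ 3) + 20 * c ^ 3 * d ^ 3) / 20
      + 3 * ((15 * a ^ 4 * b ^ 2 + s * (3 * a ^ 3 * c * d ^ 2 + 9 * a ^ 2 * b * c ^ 2 * d
      + 3 * a * b ^ 2 * c ^ 3) + 15 * c ^ 4 * d ^ 2) / 15) ^ 2) =
      (a * d - b * c) ^ 4 * ((s ^ 2 + 50) * (a * c) ^ 2) := by ring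
    rw [← hi, h2, h4, h5]
    ring
  have key0 : (a * d - b * c) ^ 4 * ((s ^ 2 + 50) * (b * d) ^ 2) = 0 := by
    have hi : 50 * ((15 * a ^ 4 * b ^ 2 + s * (3 * a ^ 3 * c * d ^ 2 + 9 * a ^ 2 * b * c ^ 2 * d
      + 3 * a * b ^ 2 * c ^ 3) + 15 * c ^ 4 * d ^ 2) / 15 * (b ^ 6 + s * b ^ 3 * d ^ 3 + d ^ 6)
      - 4 * (20 * a ^ 3 * b ^ 3 + s * (a ^ 3 * d ^ 3 + 9 * a ^ 2 * b * c * d ^ 2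
      + 9 * a * b ^ 2 * c ^ 2 * d + b ^ 3 * c ^ 3) + 20 * c ^ 3 * d ^ 3) / 20
      * (6 * a * b ^ 5 + s * (3 * a * b ^ 2 * d ^ 3 + 3 * b ^ 3 * c * d ^ 2) + 6 * c * d ^ 5) / 6
      + 3 * ((15 * a ^ 2 * b ^ 4 + s * (3 * a ^ 2 * b * d ^ 3 + 9 * a * b ^ 2 * c * d ^ 2
      + 3 * b ^ 3 * c ^ 2 * d) + 15 * c ^ 2 * d ^ 4) / 15) ^ 2) =
      (a * d - b * c) ^ 4 * ((s ^ 2 + 50) * (b * d) ^ 2) := by ring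
    rw [← hi, h2, h4, h1]
    ring
  refine diagonal_or_antidiagonal hdet ?_ ?_
  · simpa [hdet4, hκ, hdet] using key4
  · simpa [hdet4, hκ, hdet] using key0

-- The quartic covariant of X⁵Z + sX³Z³ + XZ⁵ is I = -10sX⁴ + 6s²X²Z² - 10sZ⁴ up to a constant; it
-- does not isolate the points 0 and ∞. The fourth transvectant of the form with I does: it is a
-- multiple of (9s³ - 100s)XZ. Invariance makes the X² and constant coefficients of its transform
-- vanish, which gives ac = bd = 0.
set_option maxHeartbeats 1600000 in
theorem quinticNormalForm_stabilizer [CharZero k] {s a b c d e : k} (hs0 : s ≠ 0)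
    (hs : 9 * s ^ 2 ≠ 100) (hdet : a * d - b * c ≠ 0)
    (h : mobius (quinticNormalForm s) a b c d = C (e ^ 2) * quinticNormalForm s) :
    (b = 0 ∧ c = 0 ∧ d ≠ 0) ∨ (a = 0 ∧ d = 0 ∧ c ≠ 0) := by
  rw [mobius_quinticNormalForm] at h
  obtain ⟨h0, h1, h2, h3, h4, h5, h6⟩ := sextic_coeff_eq
    (a₀ := b ^ 5 * d + b ^ 3 * d ^ 3 * s + b * d ^ 5)
    (a₁ := 5 * a * b ^ 4 * d + 3 * a * b ^ 2 * d ^ 3 * s + a * d ^ 5 + b ^ 5 * c + 3 * b ^ 3 * c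
      * d ^ 2 * s + 5 * b * c * d ^ 4)
    (a₂ := 10 * a ^ 2 * b ^ 3 * d + 3 * a ^ 2 * b * d ^ 3 * s + 5 * a * b ^ 4 * c + 9 * a * b ^
      2 * c * d ^ 2 * s + 5 * a * c * d ^ 4 + 3 * b ^ 3 * c ^ 2 * d * s + 10 * b * c ^ 2 * d ^
      3)
    (a₃ := 10 * a ^ 3 * b ^ 2 * d + a ^ 3 * d ^ 3 * s + 10 * a ^ 2 * b ^ 3 * c + 9 * a ^ 2 * b *
      c * d ^ 2 * s + 9 * a * b ^ 2 * c ^ 2 * d * s + 10 * a * c ^ 2 * d ^ 3 + b ^ 3 * c ^ 3 * s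
      + 10 * b * c ^ 3 * d ^ 2)
    (a₄ := 5 * a ^ 4 * b * d + 10 * a ^ 3 * b ^ 2 * c + 3 * a ^ 3 * c * d ^ 2 * s + 9 * a ^ 2 *
      b * c ^ 2 * d * s + 3 * a * b ^ 2 * c ^ 3 * s + 10 * a * c ^ 3 * d ^ 2 + 5 * b * c ^ 4 *
      d)
    (a₅ := a ^ 5 * d + 5 * a ^ 4 * b * c + 3 * a ^ 3 * c ^ 2 * d * s + 3 * a ^ 2 * b * c ^ 3 * s
      + 5 * a * c ^ 4 * d + b * c ^ 5)
    (a₆ := a ^ 5 * c + a ^ 3 * c ^ 3 * s + a * c ^ 5)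
    (b₀ := 0) (b₁ := e ^ 2) (b₂ := 0) (b₃ := e ^ 2 * s) (b₄ := 0) (b₅ := e ^ 2) (b₆ := 0) (by
      rw [quinticNormalForm] at h
      simp only [C_add, C_mul, C_pow, map_ofNat, C_0] at h ⊢
      linear_combination h)
  have hκ : 9 * s ^ 3 - 100 * s ≠ 0 := by
    rw [show 9 * s ^ 3 - 100 * s = s * (9 * s ^ 2 - 100) by ring]
    exact mul_ne_zero hs0 (sub_ne_zero.2 hs)
  have hdet4 : (a * d - b * c) ^ 4 ≠ 0 := pow_ne_zero 4 hdet
  -- A quarter of the X³ coefficient of I(aX + b, cX + d); it vanishes since the even coefficients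
  -- of the transformed sextic do. `j1` is the X coefficient.
  have j3 : -10 * a ^ 3 * b * s + 3 * a ^ 2 * c * d * s ^ 2 + 3 * a * b * c ^ 2 * s ^ 2 - 10 * c ^
      3 * d * s = 0 := by
    refine (mul_eq_zero.1 (?_ : (a * d - b * c) ^ 4 * (-10 * a ^ 3 * b * s + 3 * a ^ 2 * c * d * s
      ^ 2 + 3 * a * b * c ^ 2 * s ^ 2 - 10 * c ^ 3 * d * s) = 0)).resolve_left hdet4
    linear_combination 25 * (5 * a * b ^ 4 * d + 3 * a * b ^ 2 * d ^ 3 * s + a * d ^ 5 + b ^ 5 * c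
      + 3 * b ^ 3 * c * d ^ 2 * s + 5 * b * c * d ^ 4) * h6 - 5 * (a ^ 5 * d + 5 * a ^ 4 * b * c +
      3 * a ^ 3 * c ^ 2 * d * s + 3 * a ^ 2 * b * c ^ 3 * s + 5 * a * c ^ 4 * d + b * c ^ 5) * h2
      + (10 * a ^ 3 * b ^ 2 * d + a ^ 3 * d ^ 3 * s + 10 * a ^ 2 * b ^ 3 * c + 9 * a ^ 2 * b * c *
      d ^ 2 * s + 9 * a * b ^ 2 * c ^ 2 * d * s + 10 * a * c ^ 2 * d ^ 3 + b ^ 3 * c ^ 3 * s + 10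
      * b * c ^ 3 * d ^ 2) * h4
  have j1 : -10 * a * b ^ 3 * s + 3 * a * b * d ^ 2 * s ^ 2 + 3 * b ^ 2 * c * d * s ^ 2 - 10 * c *
      d ^ 3 * s = 0 := by
    refine (mul_eq_zero.1 (?_ : (a * d - b * c) ^ 4 * (-10 * a * b ^ 3 * s + 3 * a * b * d ^ 2 * s
      ^ 2 + 3 * b ^ 2 * c * d * s ^ 2 - 10 * c * d ^ 3 * s) = 0)).resolve_left hdet4
    linear_combination 25 * (a ^ 5 * d + 5 * a ^ 4 * b * c + 3 * a ^ 3 * c ^ 2 * d * s + 3 * a ^ 2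
      * b * c ^ 3 * s + 5 * a * c ^ 4 * d + b * c ^ 5) * h0 - 5 * (5 * a * b ^ 4 * d + 3 * a * b ^
      2 * d ^ 3 * s + a * d ^ 5 + b ^ 5 * c + 3 * b ^ 3 * c * d ^ 2 * s + 5 * b * c * d ^ 4) * h4
      + (10 * a ^ 3 * b ^ 2 * d + a ^ 3 * d ^ 3 * s + 10 * a ^ 2 * b ^ 3 * c + 9 * a ^ 2 * b * c *
      d ^ 2 * s + 9 * a * b ^ 2 * c ^ 2 * d * s + 10 * a * c ^ 2 * d ^ 3 + b ^ 3 * c ^ 3 * s + 10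
      * b * c ^ 3 * d ^ 2) * h2
  -- The X² coefficient of the transvectant of the transformed sextic with the transformed I.
  have q2 : (a * d - b * c) ^ 4 * ((9 * s ^ 3 - 100 * s) * (a * c)) = 0 := by
    linear_combination 15 * (-10 * b ^ 4 * s + 6 * b ^ 2 * d ^ 2 * s ^ 2 - 10 * d ^ 4 * s) * h6 -
      10 * (a ^ 5 * d + 5 * a ^ 4 * b * c + 3 * a ^ 3 * c ^ 2 * d * s + 3 * a ^ 2 * b * c ^ 3 * s
      + 5 * a * c ^ 4 * d + b * c ^ 5) * j1 + 6 * (-10 * a ^ 2 * b ^ 2 * s + a ^ 2 * d ^ 2 * s ^ 2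
      + 4 * a * b * c * d * s ^ 2 + b ^ 2 * c ^ 2 * s ^ 2 - 10 * c ^ 2 * d ^ 2 * s) * h4 - 3 * (10
      * a ^ 3 * b ^ 2 * d + a ^ 3 * d ^ 3 * s + 10 * a ^ 2 * b ^ 3 * c + 9 * a ^ 2 * b * c * d ^ 2
      * s + 9 * a * b ^ 2 * c ^ 2 * d * s + 10 * a * c ^ 2 * d ^ 3 + b ^ 3 * c ^ 3 * s + 10 * b *
      c ^ 3 * d ^ 2) * j3 + (-10 * a ^ 4 * s + 6 * a ^ 2 * c ^ 2 * s ^ 2 - 10 * c ^ 4 * s) * h2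
  have q0 : (a * d - b * c) ^ 4 * ((9 * s ^ 3 - 100 * s) * (b * d)) = 0 := by
    linear_combination (-10 * b ^ 4 * s + 6 * b ^ 2 * d ^ 2 * s ^ 2 - 10 * d ^ 4 * s) * h4 - 3 *
      (10 * a ^ 3 * b ^ 2 * d + a ^ 3 * d ^ 3 * s + 10 * a ^ 2 * b ^ 3 * c + 9 * a ^ 2 * b * c * d
      ^ 2 * s + 9 * a * b ^ 2 * c ^ 2 * d * s + 10 * a * c ^ 2 * d ^ 3 + b ^ 3 * c ^ 3 * s + 10 *
      b * c ^ 3 * d ^ 2) * j1 + 6 * (-10 * a ^ 2 * b ^ 2 * s + a ^ 2 * d ^ 2 * s ^ 2 + 4 * a * b *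
      c * d * s ^ 2 + b ^ 2 * c ^ 2 * s ^ 2 - 10 * c ^ 2 * d ^ 2 * s) * h2 - 10 * (5 * a * b ^ 4 *
      d + 3 * a * b ^ 2 * d ^ 3 * s + a * d ^ 5 + b ^ 5 * c + 3 * b ^ 3 * c * d ^ 2 * s + 5 * b *
      c * d ^ 4) * j3 + 15 * (-10 * a ^ 4 * s + 6 * a ^ 2 * c ^ 2 * s ^ 2 - 10 * c ^ 4 * s) * h0
  exact diagonal_or_antidiagonal hdet (by simpa [hdet4, hκ, hdet] using q2)
    (by simpa [hdet4, hκ, hdet] using q0)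

end ShaskaSurface

/-! ### Automorphism groups of the normal forms and of curves reducible to them. -/

namespace ShaskaSurface

open Polynomial

variable {k : Type*} [Field k]

theorem exists_isPrimitiveRoot [IsAlgClosed k] [CharZero k] (n : ℕ) [NeZero n] :
    ∃ ζ : k, IsPrimitiveRoot ζ n := by
  have : NeZero (n : k) := ⟨Nat.cast_ne_zero.2 (NeZero.ne n)⟩
  have hdeg : (cyclotomic n k).degree ≠ 0 := by
    rw [degree_cyclotomic]
    exact_mod_cast (Nat.totient_pos.2 (NeZero.pos n)).ne'
  obtain ⟨ζ, hζ⟩ := IsAlgClosed.exists_root _ hdeg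
  exact ⟨ζ, isRoot_cyclotomic_iff.1 hζ⟩

theorem curveAut_quinticNormalForm [IsAlgClosed k] [CharZero k] {s : k} (hs0 : s ≠ 0)
    (hs4 : s ^ 2 ≠ 4) (hs : 9 * s ^ 2 ≠ 100) :
    Nonempty (CurveAut (quinticNormalForm s) ≃* DihedralGroup 4) := by
  have hsep := separable_quinticNormalForm hs4
  have hdeg := natDegree_quinticNormalForm s
  have : Fact (Irreducible ((X : (RatFunc k)[X]) ^ 2
      - C (algebraMap k[X] (RatFunc k) (quinticNormalForm s)))) :=
    ⟨irreducible_curve hsep.squarefree (by lia)⟩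
  obtain ⟨ζ, hζ⟩ := exists_isPrimitiveRoot (k := k) 4
  have hζ4 : ζ ^ 4 = 1 := hζ.pow_eq_one
  have key {a d e : k} (hd : d ≠ 0) (h5 : a ^ 5 * d = e ^ 2) (h3 : s * (a ^ 3 * d ^ 3) = s * e ^ 2)
      (h1 : a * d ^ 5 = e ^ 2) (he : e ≠ 0) :
      ∃ i : ℕ, a = (ζ ^ i) ^ 2 * d ∧ e = (ζ ^ i) ^ 3 * d ^ 3 := by
    have ha : a ≠ 0 := by
      rintro rfl
      exact he (by simpa using h1.symm)
    have h3' := mul_left_cancel₀ hs0 h3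
    have had : a ^ 2 = d ^ 2 := by
      apply mul_left_cancel₀ (mul_ne_zero ha (pow_ne_zero 3 hd))
      linear_combination h3' - h1
    have hε2 : (e / d ^ 3) ^ 2 = a / d := by
      field_simp
      linear_combination -h1
    have hε4 : (e / d ^ 3) ^ 4 = 1 := by
      rw [show (e / d ^ 3) ^ 4 = ((e / d ^ 3) ^ 2) ^ 2 by ring, hε2, div_pow, had,
        div_self (pow_ne_zero 2 hd)]
    obtain ⟨j, -, hj⟩ := hζ.eq_pow_of_pow_eq_one hε4
    have hj4 : (ζ ^ j) ^ 4 = 1 := by rw [hj, hε4]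
    -- Put ε = e/d³ = ζ^j, so that a/d = ε². The required root of unity is (e/d³)/(a/d) = ε⁻¹ = ε³.
    refine ⟨3 * j, ?_, ?_⟩
    · rw [eq_comm, ← eq_div_iff hd, ← hε2, ← hj]
      calc (ζ ^ (3 * j)) ^ 2 = (ζ ^ j) ^ 4 * (ζ ^ j) ^ 2 := by ring
        _ = _ := by rw [hj4, one_mul]
    · rw [eq_comm, ← eq_div_iff (pow_ne_zero 3 hd), ← hj]
      calc (ζ ^ (3 * j)) ^ 3 = ((ζ ^ j) ^ 4) ^ 2 * ζ ^ j := by ring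
        _ = _ := by rw [hj4, one_pow, one_mul]
  refine CurveField.nonempty_curveAut_mulEquiv_dihedralGroup hsep.squarefree (by lia) (by lia) hζ
    ?_ ?_ ?_
  · rw [mobius_quinticNormalForm, quinticNormalForm]
    have hC : C ζ ^ 4 = (1 : k[X]) := by rw [← C_pow, hζ4, C_1]
    simp only [C_0, C_1, C_pow]
    linear_combination (C ζ ^ 6 * X ^ 5 - C ζ ^ 2 * X) * hC
  · rw [mobius_quinticNormalForm, quinticNormalForm]
    simp only [C_0, C_1]
    ring
  · intro a b c d e hdet he h
    have hst := quinticNormalForm_stabilizer hs0 hs hdet h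
    rw [mobius_quinticNormalForm] at h
    rcases hst with ⟨rfl, rfl, hd⟩ | ⟨rfl, rfl, hc⟩
    · obtain ⟨-, h1, -, h3, -, h5, -⟩ := sextic_coeff_eq
        (a₀ := 0) (a₁ := a * d ^ 5) (a₂ := 0) (a₃ := s * (a ^ 3 * d ^ 3)) (a₄ := 0)
        (a₅ := a ^ 5 * d) (a₆ := 0) (b₀ := 0) (b₁ := e ^ 2) (b₂ := 0) (b₃ := s * e ^ 2) (b₄ := 0)
        (b₅ := e ^ 2) (b₆ := 0) (by
          rw [quinticNormalForm] at h
          simp only [C_mul, C_pow, C_0] at h ⊢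
          linear_combination h)
      obtain ⟨i, hi⟩ := key hd h5 h3 h1 he
      exact ⟨i, Or.inl ⟨rfl, rfl, hi⟩⟩
    · obtain ⟨-, h1, -, h3, -, h5, -⟩ := sextic_coeff_eq
        (a₀ := 0) (a₁ := b ^ 5 * c) (a₂ := 0) (a₃ := s * (b ^ 3 * c ^ 3)) (a₄ := 0)
        (a₅ := b * c ^ 5) (a₆ := 0) (b₀ := 0) (b₁ := e ^ 2) (b₂ := 0) (b₃ := s * e ^ 2) (b₄ := 0)
        (b₅ := e ^ 2) (b₆ := 0) (by
          rw [quinticNormalForm] at h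
          simp only [C_mul, C_pow, C_0] at h ⊢
          linear_combination h)
      obtain ⟨i, hi⟩ := key hc h1 h3 h5 he
      exact ⟨i, Or.inr ⟨rfl, rfl, hi⟩⟩

theorem curveAut_sexticNormalForm [IsAlgClosed k] [CharZero k] {s : k} (hs0 : s ≠ 0)
    (hs4 : s ^ 2 ≠ 4) (hs : s ^ 2 ≠ -50) :
    Nonempty (CurveAut (sexticNormalForm s) ≃* DihedralGroup 6) := by
  have hsep := separable_sexticNormalForm hs4
  have hdeg := natDegree_sexticNormalForm s
  have : Fact (Irreducible ((X : (RatFunc k)[X]) ^ 2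
      - C (algebraMap k[X] (RatFunc k) (sexticNormalForm s)))) :=
    ⟨irreducible_curve hsep.squarefree (by lia)⟩
  obtain ⟨ζ, hζ⟩ := exists_isPrimitiveRoot (k := k) 6
  have hζ6 : ζ ^ 6 = 1 := hζ.pow_eq_one
  have key {a d e : k} (hd : d ≠ 0) (h3 : s * (a ^ 3 * d ^ 3) = s * e ^ 2) (h0 : d ^ 6 = e ^ 2) :
      ∃ i : ℕ, a = (ζ ^ i) ^ 2 * d ∧ e = (ζ ^ i) ^ 3 * d ^ 3 := by
    have h3' := mul_left_cancel₀ hs0 h3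
    have had : a ^ 3 = d ^ 3 := by
      apply mul_right_cancel₀ (pow_ne_zero 3 hd)
      linear_combination h3' - h0
    have hq : (a / d) ^ 3 = 1 := by rw [div_pow, had, div_self (pow_ne_zero 3 hd)]
    have hε : (e / d ^ 3) ^ 2 = 1 := by
      rw [div_pow, ← h0]
      field_simp
    obtain ⟨l, -, hl⟩ := hζ.eq_pow_of_pow_eq_one (ξ := a / d) (by
      rw [show (a / d) ^ 6 = ((a / d) ^ 3) ^ 2 by ring, hq, one_pow])
    obtain ⟨m, -, hm⟩ := hζ.eq_pow_of_pow_eq_one (ξ := e / d ^ 3) (by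
      rw [show (e / d ^ 3) ^ 6 = ((e / d ^ 3) ^ 2) ^ 3 by ring, hε, one_pow])
    rw [← hl, ← pow_mul, hζ.pow_eq_one_iff_dvd] at hq
    rw [← hm, ← pow_mul, hζ.pow_eq_one_iff_dvd] at hε
    obtain ⟨l, rfl⟩ : ∃ l', l = 2 * l' := ⟨l / 2, by lia⟩
    obtain ⟨m, rfl⟩ : ∃ m', m = 3 * m' := ⟨m / 3, by lia⟩
    -- Chinese remaindering modulo 6: a/d = ζ^(2l) is a cube root of unity and e/d³ = ζ^(3m) is a
    -- sign; the exponent i must satisfy 2i ≡ 2l and 3i ≡ 3m.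
    refine ⟨4 * l + 3 * m, ?_, ?_⟩
    · rw [eq_comm, ← eq_div_iff hd, ← hl]
      calc (ζ ^ (4 * l + 3 * m)) ^ 2 = (ζ ^ 6) ^ (l + m) * ζ ^ (2 * l) := by ring
        _ = _ := by rw [hζ6, one_pow, one_mul]
    · rw [eq_comm, ← eq_div_iff (pow_ne_zero 3 hd), ← hm]
      calc (ζ ^ (4 * l + 3 * m)) ^ 3 = (ζ ^ 6) ^ (2 * l + m) * ζ ^ (3 * m) := by ring
        _ = _ := by rw [hζ6, one_pow, one_mul]
  refine CurveField.nonempty_curveAut_mulEquiv_dihedralGroup hsep.squarefree (by lia) (by lia) hζ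
    ?_ ?_ ?_
  · rw [mobius_sexticNormalForm, sexticNormalForm]
    have hC : C ζ ^ 6 = (1 : k[X]) := by rw [← C_pow, hζ6, C_1]
    simp only [C_0, C_1, C_pow]
    linear_combination (C ζ ^ 6 * X ^ 6 - 1) * hC
  · rw [mobius_sexticNormalForm, sexticNormalForm]
    simp only [C_0, C_1]
    ring
  · intro a b c d e hdet he h
    have hst := sexticNormalForm_stabilizer hs hdet h
    rw [mobius_sexticNormalForm] at h
    rcases hst with ⟨rfl, rfl, hd⟩ | ⟨rfl, rfl, hc⟩
    · obtain ⟨h0, -, -, h3, -, -, h6⟩ := sextic_coeff_eq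
        (a₀ := d ^ 6) (a₁ := 0) (a₂ := 0) (a₃ := s * (a ^ 3 * d ^ 3)) (a₄ := 0)
        (a₅ := 0) (a₆ := a ^ 6) (b₀ := e ^ 2) (b₁ := 0) (b₂ := 0) (b₃ := s * e ^ 2) (b₄ := 0)
        (b₅ := 0) (b₆ := e ^ 2) (by
          rw [sexticNormalForm] at h
          simp only [C_mul, C_pow, C_0] at h ⊢
          linear_combination h)
      obtain ⟨i, hi⟩ := key hd h3 h0
      exact ⟨i, Or.inl ⟨rfl, rfl, hi⟩⟩
    · obtain ⟨h0, -, -, h3, -, -, h6⟩ := sextic_coeff_eq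
        (a₀ := b ^ 6) (a₁ := 0) (a₂ := 0) (a₃ := s * (b ^ 3 * c ^ 3)) (a₄ := 0)
        (a₅ := 0) (a₆ := c ^ 6) (b₀ := e ^ 2) (b₁ := 0) (b₂ := 0) (b₃ := s * e ^ 2) (b₄ := 0)
        (b₅ := 0) (b₆ := e ^ 2) (by
          rw [sexticNormalForm] at h
          simp only [C_mul, C_pow, C_0] at h ⊢
          linear_combination h)
      obtain ⟨i, hi⟩ := key hc h3 h6
      exact ⟨i, Or.inr ⟨rfl, rfl, hi⟩⟩

theorem nonempty_curveAut_mulEquiv_of_mobius {f g : k[X]} (hf : IsGenusTwo f)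
    (hg : Squarefree g) (hg0 : 0 < g.natDegree) {a b c d e : k} (hdet : a * d - b * c ≠ 0)
    (he : e ≠ 0) (h : mobius f a b c d = C (e ^ 2) * g) :
    Nonempty (CurveAut f ≃* CurveAut g) := by
  have hd : 0 < f.natDegree ∧ f.natDegree ≤ 6 := by
    rcases hf.2 with h | h <;> lia
  have : Fact (Irreducible ((X : (RatFunc k)[X]) ^ 2 - C (algebraMap k[X] (RatFunc k) f))) :=
    ⟨irreducible_curve hf.1.squarefree hd.1⟩
  have : Fact (Irreducible ((X : (RatFunc k)[X]) ^ 2 - C (algebraMap k[X] (RatFunc k) g))) :=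
    ⟨irreducible_curve hg hg0⟩
  obtain ⟨ψ, -⟩ := CurveField.exists_equiv_of_mobius hd.2 hdet he h
  exact ⟨AlgEquiv.autCongr ψ⟩

theorem nonempty_curveAut_mulEquiv_dihedralGroup_four [IsAlgClosed k] [CharZero k] {f : k[X]}
    (hf : IsGenusTwo f) {a b c d c₁ c₃ c₅ : k} (hdet : a * d - b * c ≠ 0)
    (h : mobius f a b c d = C c₅ * X ^ 5 + C c₃ * X ^ 3 + C c₁ * X) (h1 : c₁ ≠ 0) (h3 : c₃ ≠ 0)
    (h5 : c₅ ≠ 0) (h4 : c₃ ^ 2 ≠ 4 * (c₁ * c₅)) (h100 : 9 * c₃ ^ 2 ≠ 100 * (c₁ * c₅)) :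
    Nonempty (CurveAut f ≃* DihedralGroup 4) := by
  -- Rescaling the variable by μ makes the two outer coefficients equal; e² then absorbs their
  -- common value, and s² = c₃²/(c₁c₅).
  obtain ⟨μ, hμ⟩ := IsAlgClosed.exists_pow_nat_eq (c₁ / c₅) (n := 4) (by norm_num)
  have hμ0 : μ ≠ 0 := by
    rintro rfl
    exact div_ne_zero h1 h5 (by simpa using hμ.symm)
  rw [eq_div_iff h5] at hμ
  obtain ⟨e, he⟩ := IsAlgClosed.exists_pow_nat_eq (c₁ * μ) (n := 2) (by norm_num)
  have he0 : e ≠ 0 := by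
    rintro rfl
    exact mul_ne_zero h1 hμ0 (by simpa using he.symm)
  set s := c₃ * μ ^ 2 / c₁ with hsdef
  have hs1 : s * c₁ = c₃ * μ ^ 2 := div_mul_cancel₀ _ h1
  have hs0 : s ≠ 0 := div_ne_zero (mul_ne_zero h3 (pow_ne_zero 2 hμ0)) h1
  have hs2 : s ^ 2 * (c₁ * c₅) = c₃ ^ 2 := by
    apply mul_right_cancel₀ h1
    linear_combination c₅ * (s * c₁ + c₃ * μ ^ 2) * hs1 + c₃ ^ 2 * hμ
  have h' : mobius f (a * μ) b (c * μ) d = C (e ^ 2) * quinticNormalForm s := by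
    rw [mobius_comp_C_mul_X, h, he, quinticNormalForm]
    have hμ' := congrArg C hμ
    have hs' := congrArg C hs1
    simp only [C_mul, C_pow] at hμ' hs'
    simp only [add_comp, mul_comp, C_comp, X_comp, pow_comp, C_mul]
    linear_combination (C μ * X ^ 5) * hμ' - (C μ * X ^ 3) * hs'
  have hs4 : s ^ 2 ≠ 4 := fun h0 => h4 (by rw [← hs2, h0])
  obtain ⟨e₁⟩ := nonempty_curveAut_mulEquiv_of_mobius hf
    (separable_quinticNormalForm hs4).squarefree (by rw [natDegree_quinticNormalForm]; norm_num)
    (by rw [show a * μ * d - b * (c * μ) = (a * d - b * c) * μ by ring]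
        exact mul_ne_zero hdet hμ0) he0 h'
  obtain ⟨e₂⟩ := curveAut_quinticNormalForm hs0 hs4
    (fun h0 => h100 (by rw [← hs2]; linear_combination (c₁ * c₅) * h0))
  exact ⟨e₁.trans e₂⟩

theorem nonempty_curveAut_mulEquiv_dihedralGroup_six [IsAlgClosed k] [CharZero k] {f : k[X]}
    (hf : IsGenusTwo f) {a b c d c₀ c₃ c₆ : k} (hdet : a * d - b * c ≠ 0)
    (h : mobius f a b c d = C c₆ * X ^ 6 + C c₃ * X ^ 3 + C c₀) (h0 : c₀ ≠ 0) (h3 : c₃ ≠ 0)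
    (h6 : c₆ ≠ 0) (h4 : c₃ ^ 2 ≠ 4 * (c₀ * c₆)) (h50 : c₃ ^ 2 ≠ -50 * (c₀ * c₆)) :
    Nonempty (CurveAut f ≃* DihedralGroup 6) := by
  obtain ⟨μ, hμ⟩ := IsAlgClosed.exists_pow_nat_eq (c₀ / c₆) (n := 6) (by norm_num)
  have hμ0 : μ ≠ 0 := by
    rintro rfl
    exact div_ne_zero h0 h6 (by simpa using hμ.symm)
  rw [eq_div_iff h6] at hμ
  obtain ⟨e, he⟩ := IsAlgClosed.exists_pow_nat_eq c₀ (n := 2) (by norm_num)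
  have he0 : e ≠ 0 := by
    rintro rfl
    exact h0 (by simpa using he.symm)
  set s := c₃ * μ ^ 3 / c₀ with hsdef
  have hs1 : s * c₀ = c₃ * μ ^ 3 := div_mul_cancel₀ _ h0
  have hs0 : s ≠ 0 := div_ne_zero (mul_ne_zero h3 (pow_ne_zero 3 hμ0)) h0
  have hs2 : s ^ 2 * (c₀ * c₆) = c₃ ^ 2 := by
    apply mul_right_cancel₀ h0
    linear_combination c₆ * (s * c₀ + c₃ * μ ^ 3) * hs1 + c₃ ^ 2 * hμ
  have h' : mobius f (a * μ) b (c * μ) d = C (e ^ 2) * sexticNormalForm s := by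
    rw [mobius_comp_C_mul_X, h, he, sexticNormalForm]
    have hμ' := congrArg C hμ
    have hs' := congrArg C hs1
    simp only [C_mul, C_pow] at hμ' hs'
    simp only [add_comp, mul_comp, C_comp, X_comp, pow_comp]
    linear_combination (X ^ 6) * hμ' - (X ^ 3) * hs'
  have hs4 : s ^ 2 ≠ 4 := fun h0 => h4 (by rw [← hs2, h0])
  obtain ⟨e₁⟩ := nonempty_curveAut_mulEquiv_of_mobius hf
    (separable_sexticNormalForm hs4).squarefree (by rw [natDegree_sexticNormalForm]; norm_num)
    (by rw [show a * μ * d - b * (c * μ) = (a * d - b * c) * μ by ring]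
        exact mul_ne_zero hdet hμ0) he0 h'
  obtain ⟨e₂⟩ := curveAut_sexticNormalForm hs0 hs4
    (fun h0 => h50 (by rw [← hs2]; linear_combination (c₀ * c₆) * h0))
  exact ⟨e₁.trans e₂⟩

end ShaskaSurface

/-! ### Discriminants, resultants and Igusa invariants of the family. -/

namespace ShaskaSurface

open Polynomial

section Discriminant

variable {k : Type*} [Field k]

theorem discr_ne_zero_iff_separable [CharZero k] {f : k[X]} (hf : 0 < f.natDegree) :
    f.discr ≠ 0 ↔ f.Separable := by
  have h0 : f ≠ 0 := fun h => by simp [h] at hf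
  have h := resultant_deriv (natDegree_pos_iff_degree_pos.1 hf)
  have h1 : f.discr ≠ 0 ↔ resultant f (derivative f) ≠ 0 := by
    rw [natDegree_derivative, h]
    simp [h0]
  rw [h1, Ne, resultant_eq_zero_iff, separable_def]
  simp [h0]

/-- Both sides come from Res(fg, (fg)') = Res(f, f'g) · Res(g, fg'), since (fg)' is congruent to f'g
modulo f and to fg' modulo g. -/
theorem discr_mul_of_natDegree_eq_three [CharZero k] {f g : k[X]} (hf : f.natDegree = 3)
    (hg : g.natDegree = 3) :
    (f * g).discr = f.discr * g.discr * resultant f g 3 3 ^ 2 := by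
  have hf0 : f ≠ 0 := fun h => by simp [h] at hf
  have hg0 : g ≠ 0 := fun h => by simp [h] at hg
  have hf' : (derivative f).natDegree = 2 := by rw [natDegree_derivative, hf]
  have hg' : (derivative g).natDegree = 2 := by rw [natDegree_derivative, hg]
  have hd : (f * g).natDegree = 6 := by rw [natDegree_mul hf0 hg0, hf, hg]
  have e1 := resultant_deriv (natDegree_pos_iff_degree_pos.1 (by lia : 0 < f.natDegree))
  have e2 := resultant_deriv (natDegree_pos_iff_degree_pos.1 (by lia : 0 < g.natDegree))
  have e3 := resultant_deriv (natDegree_pos_iff_degree_pos.1 (by lia : 0 < (f * g).natDegree))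
  rw [hf] at e1
  rw [hg] at e2
  rw [hd] at e3
  have m0 := resultant_mul_left f g (derivative (f * g)) 5
    ((natDegree_derivative_le _).trans (by lia))
  rw [hf, hg] at m0
  have m1 : resultant f (derivative (f * g)) 3 5 =
      resultant f (derivative f) 3 2 * resultant f g 3 3 := by
    rw [derivative_mul, resultant_add_mul_right _ _ _ _ _ (by lia) hf.le]
    have := resultant_mul_right f (derivative f) g 3 hf.le
    rwa [hf', hg] at this
  have m2 : resultant g (derivative (f * g)) 3 5 =
      - (resultant f g 3 3 * resultant g (derivative g) 3 2) := by
    rw [derivative_mul, add_comm, mul_comm _ g, resultant_add_mul_right _ _ _ _ _ (by lia) hg.le]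
    have := resultant_mul_right g f (derivative g) 3 hg.le
    rw [hf, hg'] at this
    rw [this, resultant_comm g f]
    norm_num
  have hl : (f * g).leadingCoeff ≠ 0 := by simp [hf0, hg0]
  rw [leadingCoeff_mul] at e3 hl
  norm_num at e1 e2 e3 m0
  rw [m1, m2, e1, e2, e3] at m0
  apply mul_left_cancel₀ hl
  linear_combination -m0

end Discriminant

section Family

theorem resultant_three_two {R : Type*} [CommRing R] (f g : R[X]) : resultant f g 3 2 =
    !![g.coeff 0, 0, 0, f.coeff 0, 0;
       g.coeff 1, g.coeff 0, 0, f.coeff 1, f.coeff 0;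
       g.coeff 2, g.coeff 1, g.coeff 0, f.coeff 2, f.coeff 1;
       0, g.coeff 2, g.coeff 1, f.coeff 3, f.coeff 2;
       0, 0, g.coeff 2, 0, f.coeff 3].det := by
  rw [resultant]
  congr 1
  ext i j
  fin_cases i <;> fin_cases j <;> simp [sylvester, Fin.addCases]

variable {k : Type*} [Field k]

/-- The factor `w` of the discriminant of the second cubic. -/
def discrFactor (u v : k) : k := u ^ 2 * v - 4 * v ^ 2 - 4 * u ^ 3 - 27 * v + 18 * u * v

theorem coeff_cubicF (v : k) : (cubicF v).coeff 0 = 1 ∧ (cubicF v).coeff 1 = 2 * v ∧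
    (cubicF v).coeff 2 = v ^ 2 ∧ (cubicF v).coeff 3 = 4 * v ^ 2 := by
  refine ⟨?_, ?_, ?_, ?_⟩ <;>
  · simp only [cubicF, coeff_add, coeff_C_mul, coeff_X_pow, coeff_X, coeff_one]
    norm_num

theorem coeff_cubicG (u v : k) : (cubicG u v).coeff 0 = 1 ∧ (cubicG u v).coeff 1 = v ∧
    (cubicG u v).coeff 2 = u * v ∧ (cubicG u v).coeff 3 = v ^ 2 := by
  refine ⟨?_, ?_, ?_, ?_⟩ <;>
  · simp only [cubicG, coeff_add, coeff_C_mul, coeff_X_pow, coeff_X, coeff_one]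
    norm_num

theorem sextic_eq (u v : k) : sextic u v = C (4 * v ^ 4) * X ^ 6
    + C (v ^ 3 * (4 * u + v)) * X ^ 5 + C (v ^ 3 * (u + 6)) * X ^ 4
    + C (v ^ 2 * (2 * u + v + 5)) * X ^ 3
    + C (v * (u + 3 * v)) * X ^ 2 + C (3 * v) * X + C 1 := by
  rw [sextic, cubicF, cubicG]
  simp only [C_add, C_mul, C_pow, map_ofNat, C_1]
  ring

theorem coeff_sextic (u v : k) : (sextic u v).coeff 0 = 1 ∧ (sextic u v).coeff 1 = 3 * v ∧
    (sextic u v).coeff 2 = v * (u + 3 * v) ∧ (sextic u v).coeff 3 = v ^ 2 * (2 * u + v + 5) ∧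
    (sextic u v).coeff 4 = v ^ 3 * (u + 6) ∧ (sextic u v).coeff 5 = v ^ 3 * (4 * u + v) ∧
    (sextic u v).coeff 6 = 4 * v ^ 4 := by
  rw [sextic_eq]
  refine ⟨?_, ?_, ?_, ?_, ?_, ?_, ?_⟩ <;>
  · simp only [coeff_add, coeff_C_mul, coeff_X_pow, coeff_X, coeff_C]
    norm_num

theorem natDegree_cubicG {u v : k} (hv : v ≠ 0) : (cubicG u v).natDegree = 3 := by
  rw [cubicG]
  compute_degree!

theorem resultant_cubicG_cubicF {u v : k} (hv : v ≠ 0) :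
    resultant (cubicG u v) (cubicF v) 3 3 = v ^ 5 * discrFactor u v := by
  obtain ⟨g0, g1, g2, g3⟩ := coeff_cubicG u v
  -- Subtracting 4G from F lowers its degree to 2, so a 5 × 5 Sylvester determinant suffices, at the
  -- cost of one factor v², the leading coefficient of G.
  have h : cubicF v = (C (v ^ 2 - 4 * u * v) * X ^ 2 + C (-2 * v) * X + C (-3))
      + cubicG u v * C 4 := by
    rw [cubicF, cubicG]
    simp only [C_sub, C_neg, C_mul, C_pow, map_ofNat]
    ring
  have hd := natDegree_cubicG (u := u) hv
  rw [h, resultant_add_mul_right _ _ _ _ _ (by simp) hd.le,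
    resultant_add_right_deg (cubicG u v) _ 3 2 1 natDegree_quadratic_le, g3, resultant_three_two,
    discrFactor]
  simp only [g0, g1, g2, g3, coeff_add, coeff_C_mul, coeff_X_pow, coeff_X, coeff_C]
  simp [Matrix.det_succ_row_zero (n := 4), Matrix.det_succ_row_zero (n := 3), Fin.succAbove,
    Matrix.det_fin_three, Finset.sum_fin_eq_sum_range, Finset.sum_range_succ]
  ring

theorem cubicR_eq {u v : k} (hv : v ≠ 0) :
    cubicR (cubicF v) (cubicG u v) = v ^ 5 * discrFactor u v :=
  resultant_cubicG_cubicF hv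

theorem cubicH_eq [CharZero k] (u v : k) :
    cubicH (cubicF v) (cubicG u v) = v ^ 2 * (9 - v + 2 * u) / 3 := by
  obtain ⟨g0, g1, g2, g3⟩ := coeff_cubicG u v
  obtain ⟨f0, f1, f2, f3⟩ := coeff_cubicF v
  rw [cubicH, g0, g1, g2, g3, f0, f1, f2, f3]
  ring

theorem natDegree_cubicF [CharZero k] {v : k} (hv : v ≠ 0) : (cubicF v).natDegree = 3 := by
  rw [cubicF]
  compute_degree!

theorem discr_cubicF [CharZero k] {v : k} (hv : v ≠ 0) : (cubicF v).discr = 16 * v ^ 4 * (v - 27) := by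
  obtain ⟨f0, f1, f2, f3⟩ := coeff_cubicF v
  rw [discr_of_degree_eq_three ((degree_eq_iff_natDegree_eq_of_pos (by norm_num)).2
    (natDegree_cubicF hv)), f0, f1, f2, f3]
  ring

theorem discr_cubicG {u v : k} (hv : v ≠ 0) : (cubicG u v).discr = v ^ 3 * discrFactor u v := by
  obtain ⟨g0, g1, g2, g3⟩ := coeff_cubicG u v
  rw [discr_of_degree_eq_three ((degree_eq_iff_natDegree_eq_of_pos (by norm_num)).2
    (natDegree_cubicG hv)), g0, g1, g2, g3, discrFactor]
  ring

theorem natDegree_sextic [CharZero k] {u v : k} (hv : v ≠ 0) : (sextic u v).natDegree = 6 := by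
  have hf := natDegree_cubicF hv
  have hg := natDegree_cubicG (u := u) hv
  rw [sextic, natDegree_mul (fun h => by simp [h] at hf) (fun h => by simp [h] at hg), hf, hg]

theorem discr_sextic [CharZero k] {u v : k} (hv : v ≠ 0) :
    (sextic u v).discr = 16 * v ^ 17 * (v - 27) * discrFactor u v ^ 3 := by
  rw [sextic, discr_mul_of_natDegree_eq_three (natDegree_cubicF hv) (natDegree_cubicG hv),
    discr_cubicF hv, discr_cubicG hv, resultant_comm, resultant_cubicG_cubicF hv]
  ring

/-- The sextic is constant for v = 0 and has degree exactly 6 otherwise, so degree 5 never occurs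
and the discriminant decides. -/
theorem isGenusTwo_sextic_iff [CharZero k] {u v : k} :
    IsGenusTwo (sextic u v) ↔ v ≠ 0 ∧ v - 27 ≠ 0 ∧ discrFactor u v ≠ 0 := by
  by_cases hv : v = 0
  · have : (sextic u v).natDegree = 0 := by
      rw [sextic_eq, hv]
      simp
    have h5 : ¬IsGenusTwo (sextic u v) := fun h => by
      rcases h.2 with h | h <;> rw [this] at h <;> norm_num at h
    exact ⟨fun h => absurd h h5, fun h => absurd hv h.1⟩
  · have hd := natDegree_sextic (u := u) hv
    have hs : (sextic u v).Separable ↔ v - 27 ≠ 0 ∧ discrFactor u v ≠ 0 := by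
      rw [← discr_ne_zero_iff_separable (by lia), discr_sextic hv]
      simp [hv]
    simp [IsGenusTwo, hd, hs, hv]

/-- The factor of `J₂` that does not divide the discriminant. -/
def j2Factor (u v : k) : k := 4 * u ^ 2 - 12 * u * v + 252 * u + 3 * v ^ 2 - 54 * v - 405

theorem J2_sextic (u v : k) : J2 (sextic u v) = 2 * v ^ 4 * j2Factor u v := by
  obtain ⟨h0, h1, h2, h3, h4, h5, h6⟩ := coeff_sextic u v
  simp only [J2, h0, h1, h2, h3, h4, h5, h6, j2Factor]
  ring

theorem J4_sextic (u v : k) : J4 (sextic u v) = 4 * v ^ 7 * (u ^ 4 * v - 24 * u ^ 4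
    - 66 * u ^ 3 * v + 1188 * u ^ 3 + 9 * u ^ 2 * v ^ 2 + 297 * u ^ 2 * v + 138 * u * v ^ 2
    - 8424 * u * v - 36 * v ^ 3 + 945 * v ^ 2 + 14580 * v) := by
  obtain ⟨h0, h1, h2, h3, h4, h5, h6⟩ := coeff_sextic u v
  simp only [J4, h0, h1, h2, h3, h4, h5, h6]
  ring

theorem J6_sextic (u v : k) : J6 (sextic u v) = 4 * v ^ 10 * (2 * u ^ 6 * v ^ 2 - 40 * u ^ 6 * v
    - 144 * u ^ 6 - 8 * u ^ 5 * v ^ 3 + 106 * u ^ 5 * v ^ 2 + 1476 * u ^ 5 * v + 2 * u ^ 4 * v ^ 4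
    + 495 * u ^ 4 * v ^ 3 - 18756 * u ^ 4 * v ^ 2 + 160704 * u ^ 4 * v - 204 * u ^ 3 * v ^ 4
    + 4280 * u ^ 3 * v ^ 3 + 4464 * u ^ 3 * v ^ 2 - 104004 * u ^ 3 * v + 18 * u ^ 2 * v ^ 5
    - 1038 * u ^ 2 * v ^ 4 + 75024 * u ^ 2 * v ^ 3 - 1353996 * u ^ 2 * v ^ 2 + 564 * u * v ^ 5
    - 33480 * u * v ^ 4 + 315252 * u * v ^ 3 + 3669786 * u * v ^ 2 - 72 * v ^ 6 + 3186 * v ^ 5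
    - 4032 * v ^ 4 - 622323 * v ^ 3 - 2821230 * v ^ 2) := by
  obtain ⟨h0, h1, h2, h3, h4, h5, h6⟩ := coeff_sextic u v
  simp only [J6, h0, h1, h2, h3, h4, h5, h6]
  ring

theorem J10_sextic [CharZero k] {u v : k} (hv : v ≠ 0) :
    J10 (sextic u v) = 16 * v ^ 17 * (v - 27) * discrFactor u v ^ 3 := by
  rw [J10, if_pos (natDegree_sextic hv), discr_sextic hv]

end Family

end ShaskaSurface

/-! ### The absolute invariants in the coordinates n and τ. -/

namespace ShaskaSurface

section NormalInvariants

variable {k : Type*} [Field k]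

/-- The factor of `J₂` in the coordinates `n`, `τ`. -/
def normalJ2 (n : k) : k := 1 + 2 * n - n ^ 2 / 2

/-- The absolute invariants in the coordinates `n = 48 r₂ / r₁`, `τ = n³ / (27 r₁)`. -/
def normalInv (n τ : k) : Fin 3 → k :=
  ![9 / 4 * ((1 + n) ^ 4 + 48 * τ * (4 + n)) / normalJ2 n ^ 2,
    27 / 8 * ((1 + n) ^ 6 + 72 * τ * (n + 1) ^ 2 * (n - 8) + 864 * τ ^ 2) / normalJ2 n ^ 3,
    -243 / 32 * τ ^ 3 / normalJ2 n ^ 5]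

theorem eval_num (r : Fin 2 → k) (j : Fin 3) : MvPolynomial.eval r (num k j) =
    (![9 * (13824 * r 0 ^ 3 * r 1 ^ 2 + 442368 * r 0 ^ 2 * r 1 ^ 3 + 5308416 * r 0 * r 1 ^ 4
      + 192 * r 0 ^ 4 * r 1 + r 0 ^ 5 + 786432 * r 0 * r 1 ^ 3 + 9437184 * r 1 ^ 4),
    27 * (79626240 * r 0 ^ 4 * r 1 ^ 4 - 4076863488 * r 0 ^ 2 * r 1 ^ 5 + 34560 * r 0 ^ 6 * r 1 ^ 2
      + 12230590464 * r 0 ^ 2 * r 1 ^ 6 + 32614907904 * r 0 * r 1 ^ 6 + 14495514624 * r 1 ^ 6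
      + 288 * r 0 ^ 7 * r 1 + 2211840 * r 0 ^ 5 * r 1 ^ 3 + r 0 ^ 8 - 212336640 * r 0 ^ 3 * r 1 ^ 4
      + 1528823808 * r 0 ^ 3 * r 1 ^ 5 - 2359296 * r 0 ^ 4 * r 1 ^ 3),
    -521838526464 * r 1 ^ 9] : Fin 3 → k) j := by
  fin_cases j <;> simp [num]

theorem eval_polyJ2 (r : Fin 2 → k) : MvPolynomial.eval r (polyJ2 k) =
    r 0 ^ 2 + 96 * r 0 * r 1 - 1152 * r 1 ^ 2 := by
  simp [polyJ2]

theorem eval_den (r : Fin 2 → k) (j : Fin 3) : MvPolynomial.eval r (den k j) =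
    (![4 * r 0 * (r 0 ^ 2 + 96 * r 0 * r 1 - 1152 * r 1 ^ 2) ^ 2,
      8 * r 0 ^ 2 * (r 0 ^ 2 + 96 * r 0 * r 1 - 1152 * r 1 ^ 2) ^ 3,
      r 0 ^ 2 * (r 0 ^ 2 + 96 * r 0 * r 1 - 1152 * r 1 ^ 2) ^ 5] : Fin 3 → k) j := by
  fin_cases j <;> simp [den, eval_polyJ2]

theorem param_eq_normalInv [CharZero k] {r : Fin 2 → k} (h0 : r 0 ≠ 0) :
    param r = normalInv (48 * r 1 / r 0) ((48 * r 1 / r 0) ^ 3 / (27 * r 0)) := by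
  obtain ⟨n, hn⟩ : ∃ n, n = 48 * r 1 / r 0 := ⟨_, rfl⟩
  have h1 : r 1 = r 0 * n / 48 := by rw [hn]; field_simp
  have hq : r 0 ^ 2 + 96 * r 0 * r 1 - 1152 * r 1 ^ 2 = r 0 ^ 2 * normalJ2 n := by
    rw [h1, normalJ2]; ring
  rw [← hn]
  -- On the locus q = 0 both sides are zero by the convention for division by zero.
  by_cases hJ : normalJ2 n = 0
  · funext j
    fin_cases j <;> simp [param, eval_den, hq, hJ, normalInv]
  · funext j
    rw [param, eval_num, eval_den, hq, h1]
    fin_cases j <;> simp [normalInv] <;> generalize normalJ2 n = q at hJ <;> field_simp <;> ring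

/-- J₄ and the combination J₂J₄ - 3J₆ become short when written in h, t and w, and J₂ is homogeneous
quadratic in (h, t) up to a power of v. Dividing out v and t leaves functions of h/t and w/(vt³). -/
theorem absInv_sextic [CharZero k] {u v : k} (hv : v ≠ 0) (ht : v - 27 ≠ 0) :
    absInv (sextic u v) = normalInv ((9 - v + 2 * u) / (v - 27))
      (discrFactor u v / (v * (v - 27) ^ 3)) := by
  have e2 : J2 (sextic u v) =
      -4 * v ^ 4 * ((v - 27) ^ 2 * normalJ2 ((9 - v + 2 * u) / (v - 27))) := by
    rw [J2_sextic, j2Factor, normalJ2]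
    field_simp
    ring
  have e4 : 16 * J4 (sextic u v) = 4 * v ^ 7 * (v * ((v - 27) + (9 - v + 2 * u)) ^ 4
      + 48 * discrFactor u v * (4 * (v - 27) + (9 - v + 2 * u))) := by
    rw [J4_sextic, discrFactor]
    ring
  have e6 : 8 * (J2 (sextic u v) * J4 (sextic u v) - 3 * J6 (sextic u v)) =
      v ^ 10 * (v ^ 2 * ((v - 27) + (9 - v + 2 * u)) ^ 6
        + 72 * v * discrFactor u v * ((v - 27) + (9 - v + 2 * u)) ^ 2
          * ((9 - v + 2 * u) - 8 * (v - 27)) + 864 * discrFactor u v ^ 2) := by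
    rw [J2_sextic, J4_sextic, J6_sextic, discrFactor, j2Factor]
    ring
  have e4' : J4 (sextic u v) = v ^ 7 / 4 * (v * ((v - 27) + (9 - v + 2 * u)) ^ 4
      + 48 * discrFactor u v * (4 * (v - 27) + (9 - v + 2 * u))) := by
    linear_combination e4 / 16
  have e6' : J2 (sextic u v) * J4 (sextic u v) - 3 * J6 (sextic u v) =
      v ^ 10 / 8 * (v ^ 2 * ((v - 27) + (9 - v + 2 * u)) ^ 6
        + 72 * v * discrFactor u v * ((v - 27) + (9 - v + 2 * u)) ^ 2
          * ((9 - v + 2 * u) - 8 * (v - 27)) + 864 * discrFactor u v ^ 2) := by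
    linear_combination e6 / 8
  clear e4 e6
  rw [absInv, e6', e4', J10_sextic hv, e2, normalInv]
  generalize discrFactor u v = w
  generalize 9 - v + 2 * u = h
  generalize v - 27 = t at *
  obtain ⟨n, hn⟩ : ∃ n, n = h / t := ⟨_, rfl⟩
  have h1 : h = t * n := by rw [hn]; field_simp
  have h2 : t * n / t = n := by field_simp
  rw [h1, h2]
  by_cases hJ : normalJ2 n = 0
  · simp [hJ]
  · generalize normalJ2 n = q at hJ
    congr 1
    · field_simp
      ring
    · congr 1
      · field_simp
        ring
      · congr 1
        field_simp
        ring

theorem cubicInv_eq [CharZero k] {u v : k} (hv : v ≠ 0) (ht : v - 27 ≠ 0)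
    (hw : discrFactor u v ≠ 0) :
    cubicInv (cubicF v) (cubicG u v) =
      ![v * (9 - v + 2 * u) ^ 3 / (27 * discrFactor u v),
        v * (9 - v + 2 * u) ^ 4 / (1296 * (v - 27) * discrFactor u v)] := by
  rw [cubicInv, cubicH_eq, cubicR_eq hv, discr_cubicF hv, discr_cubicG hv]
  congr 1
  · field_simp
    norm_num
  · congr 1
    field_simp
    ring

theorem param_cubicInv [CharZero k] {u v : k} (h : IsGenusTwo (sextic u v))
    (hH : cubicH (cubicF v) (cubicG u v) ≠ 0) :
    param (cubicInv (cubicF v) (cubicG u v)) = absInv (sextic u v) := by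
  obtain ⟨hv, ht, hw⟩ := isGenusTwo_sextic_iff.1 h
  have hh : 9 - v + 2 * u ≠ 0 := fun e => hH (by rw [cubicH_eq, e]; simp)
  rw [absInv_sextic hv ht, cubicInv_eq hv ht hw, param_eq_normalInv]
  · simp only [Matrix.cons_val_zero, Matrix.cons_val_one]
    generalize discrFactor u v = w at *
    generalize 9 - v + 2 * u = h at *
    generalize v - 27 = t at *
    have e : 48 * (v * h ^ 4 / (1296 * t * w)) / (v * h ^ 3 / (27 * w)) = h / t := by
      field_simp; norm_num
    rw [e]
    congr 1
    field_simp
  · simp [hv, hh, hw]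

end NormalInvariants

end ShaskaSurface

/-! ### Fibres over the three points: the pair (n, τ), then the curves. -/

namespace ShaskaSurface

section Points

variable {k : Type*} [Field k]

theorem normalInv_eq_iff {n τ a b c : k} (hq : normalJ2 n ≠ 0) :
    normalInv n τ = ![a, b, c] ↔
      9 / 4 * ((1 + n) ^ 4 + 48 * τ * (4 + n)) = a * normalJ2 n ^ 2 ∧
      27 / 8 * ((1 + n) ^ 6 + 72 * τ * (n + 1) ^ 2 * (n - 8) + 864 * τ ^ 2) =
        b * normalJ2 n ^ 3 ∧
      -243 / 32 * τ ^ 3 = c * normalJ2 n ^ 5 := by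
  rw [← div_eq_iff (pow_ne_zero 2 hq), ← div_eq_iff (pow_ne_zero 3 hq),
    ← div_eq_iff (pow_ne_zero 5 hq)]
  constructor
  · exact fun h => ⟨congrFun h 0, congrFun h 1, congrFun h 2⟩
  · rintro ⟨h1, h2, h3⟩
    rw [normalInv, h1, h2, h3]

/-- The equation for i₁ is linear in τ. Eliminating τ from the other two leaves two polynomials in
n, both divisible by (n - 8)²; the square reflects that the Jacobian drops rank there. Their
cofactors are coprime, so n = 8. The other two points are treated by the same elimination. -/
theorem eq_of_normalInv_eq_pointA [CharZero k] {n τ : k} (hq : normalJ2 n ≠ 0)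
    (h : normalInv n τ = pointA k) : n = 8 ∧ τ = -81 := by
  obtain ⟨e1, e2, e3⟩ := (normalInv_eq_iff hq).1 h
  rw [normalJ2] at e1 e2 e3
  have hT : τ * (108 * (n + 4)) = -8199 / 80 * n ^ 4 + 7929 / 10 * n ^ 3 - 24327 / 20 * n ^ 2 -
    8064 / 5 * n - 2016 / 5 := by
    linear_combination e1
  have h2 : (n - 8) ^ 2 * (1539491 * n ^ 6 - 8779584 * n ^ 5 - 154008 * n ^ 4 + 37916032 * n ^ 3
    + 43060272 * n ^ 2 + 17634816 * n + 2502656) = 0 := by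
    -- Multiplying by the square of 108(n + 4), the coefficient of τ in `hT`, allows τ to be
    -- replaced without division; the equation for i₃ needs the cube.
    linear_combination (1600 / 19683) * (108 * (n + 4)) ^ 2 * e2 - (200 / 729) * (72 * (108 * (n
      + 4)) * (n + 1) ^ 2 * (n - 8) + 864 * (τ * (108 * (n + 4)) + (-8199 / 80 * n ^ 4 + 7929 /
      10 * n ^ 3 - 24327 / 20 * n ^ 2 - 8064 / 5 * n - 2016 / 5))) * hT
  have h3 : (n - 8) ^ 2 * ((-10460353203 / 76974550000 * n ^ 5 + 3347032038611541611463 /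
    970765328007577600000 * n ^ 4 - 4039525426181987496270467871 / 186810560697464205875200000 *
    n ^ 3 + 159507018768325678118299877050359 / 4601490830379197884272280371200 * n ^ 2 +
    1123779001963039343603694600661314866169 / 55343388437119544766064196726086400000 * n +
    1391141283613719882103398086631456929608739661 /
    85200648408449605091452936282039478022400000) * (1539491 * n ^ 6 - 8779584 * n ^ 5 - 154008 *
    n ^ 4 + 37916032 * n ^ 3 + 43060272 * n ^ 2 + 17634816 * n + 2502656) + 129140163 /
    21300162102112401272863234070509869505600000 * (1838229442421861475575905624337525472130348 *
    n ^ 5 + 5073289292547048431262640214587668666691639 * n ^ 4 -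
    39357041473361245911191641793023344893957736 * n ^ 3 -
    59327691918160522982757502672879743352362116 * n ^ 2 -
    28013331316653158824445511680123770743433856 * n -
    4352861170209091671219972024199136276066304)) = 0 := by
    linear_combination (108 * (n + 4)) ^ 3 * e3 + 243 / 32 * ((τ * (108 * (n + 4))) ^ 2 + τ *
      (108 * (n + 4)) * (-8199 / 80 * n ^ 4 + 7929 / 10 * n ^ 3 - 24327 / 20 * n ^ 2 - 8064 / 5 *
      n - 2016 / 5) + (-8199 / 80 * n ^ 4 + 7929 / 10 * n ^ 3 - 24327 / 20 * n ^ 2 - 8064 / 5 * n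
      - 2016 / 5) ^ 2) * hT
  have hn : n = 8 := by
    by_contra hne
    have hd : (n - 8) ^ 2 ≠ 0 := pow_ne_zero 2 fun e => hne (by linear_combination e)
    have s0 := (mul_eq_zero.1 h2).resolve_left hd
    have r0 := (mul_eq_zero.1 h3).resolve_left hd
    rw [s0, mul_zero, zero_add] at r0
    replace r0 := (mul_eq_zero.1 r0).resolve_left (by norm_num)
    refine one_ne_zero (α := k) ?_
    -- A Bézout identity between the sextic cofactor and the remainder of the other cofactor modulo
    -- it.
    linear_combination
      (215979522471664809715057079634667112652565334497934838870227792612376412351 /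
      6015839183165014579541067557149425406322743070044404320017305984000000 * n ^ 4 +
      665202242671348086703963505594487231912252196978008680872956434298206435393 /
      8021118910886686106054756742865900541763657426725872426689741312000000 * n ^ 3 -
      359161427532024685560417106260106924610445378021356451663789081824600922389 /
      445617717271482561447486485714772252320203190373659579260541184000000 * n ^ 2 -
      4789082610028777474074754393729194762578216907115163177150271480360406056329 /
      6015839183165014579541067557149425406322743070044404320017305984000000 * n -
      63116609625561781995160333573380247110446336406647559410590493489916182563 /
      334213287953611921085614864286079189240152392780244684445405888000000) * s0 +
      (-469972936973770743351923366020573 /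
      15630722578215824787650119571077519534242793416900532240896000000 * n ^ 5 +
      2225849611088220781442593161841493461519 /
      12031678366330029159082135114298850812645486140088808640034611968000000 * n ^ 4 -
      241311680552092784181139105711225676449 /
      3007919591582507289770533778574712703161371535022202160008652992000000 * n ^ 3 -
      1059464183308892413554247234732692821807 /
      1503959795791253644885266889287356351580685767511101080004326496000000 * n ^ 2 -
      112587433954562364590563948431863995201 /
      214851399398750520697895269898193764511526538215871582857760928000000 * n -
      6280716205629856133087886549100008469 /
      57844607530432832495587188049513705830026375673503887692474096000000) * r0
  refine ⟨hn, ?_⟩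
  rw [hn] at hT
  linear_combination hT / 1296

theorem eq_of_normalInv_eq_pointB [CharZero k] {n τ : k} (hq : normalJ2 n ≠ 0)
    (h : normalInv n τ = pointB k) : n = 1 / 2 ∧ τ = 9 / 16 := by
  obtain ⟨e1, e2, e3⟩ := (normalInv_eq_iff hq).1 h
  rw [normalJ2] at e1 e2 e3
  have hT : τ * (108 * (n + 4)) = 18 * n ^ 4 - 171 * n ^ 3 + 459 / 2 * n ^ 2 + 315 * n + 315 / 4
    := by
    linear_combination e1
  have h2 : (n - 1 / 2) ^ 2 * (1472 * n ^ 6 - 26016 * n ^ 5 + 126480 * n ^ 4 + 24400 * n ^ 3 -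
    302100 * n ^ 2 - 233772 * n - 47389) = 0 := by
    linear_combination (25 / 19683) * (108 * (n + 4)) ^ 2 * e2 - (25 / 5832) * (72 * (108 * (n +
      4)) * (n + 1) ^ 2 * (n - 8) + 864 * (τ * (108 * (n + 4)) + (18 * n ^ 4 - 171 * n ^ 3 + 459
      / 2 * n ^ 2 + 315 * n + 315 / 4))) * hT
  have h3 : (n - 1 / 2) ^ 2 * ((-14348907 / 9200000 * n ^ 5 - 9888876981 / 211600000 * n ^ 4 +
    826282518183 / 3893440000 * n ^ 3 - 562678081081839 / 447745600000 * n ^ 2 -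
    164629988988372531 / 41192595200000 * n - 13353142804768817181 / 947429689600000) * (1472 * n
    ^ 6 - 26016 * n ^ 5 + 126480 * n ^ 4 + 24400 * n ^ 3 - 302100 * n ^ 2 - 233772 * n - 47389) +
    129140163 / 37897187584000 * (30463709764752 * n ^ 5 + 487602132789664 * n ^ 4 -
    262626525128432 * n ^ 3 - 1496399943700668 * n ^ 2 - 1010708025968759 * n - 194835709387607))
    = 0 := by
    linear_combination (108 * (n + 4)) ^ 3 * e3 + 243 / 32 * ((τ * (108 * (n + 4))) ^ 2 + τ *
      (108 * (n + 4)) * (18 * n ^ 4 - 171 * n ^ 3 + 459 / 2 * n ^ 2 + 315 * n + 315 / 4) + (18 *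
      n ^ 4 - 171 * n ^ 3 + 459 / 2 * n ^ 2 + 315 * n + 315 / 4) ^ 2) * hT
  have hn : n = 1 / 2 := by
    by_contra hne
    have hd : (n - 1 / 2) ^ 2 ≠ 0 := pow_ne_zero 2 fun e => hne (by linear_combination e)
    have s0 := (mul_eq_zero.1 h2).resolve_left hd
    have r0 := (mul_eq_zero.1 h3).resolve_left hd
    rw [s0, mul_zero, zero_add] at r0
    replace r0 := (mul_eq_zero.1 r0).resolve_left (by norm_num)
    refine one_ne_zero (α := k) ?_
    linear_combination (15732706522664476446948110054416 / 1063293304209318917795335275 * n ^ 4 +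
      4842164152547847466178237437580408 / 21053207423344514572347638445 * n ^ 3 -
      745616526685151822151371177822872 / 3189879912627956753386005825 * n ^ 2 -
      124074390175070566245743649645080 / 200506737365185853069977509 * n -
      4322259357283070973989570564480401 / 21053207423344514572347638445) * s0 +
      (-3272169715946399965888 / 4576784222466198820075573575 * n ^ 5 + 54595410471993788699072 /
      4210641484668902914469527689 * n ^ 4 - 545910152110289688577376 /
      8097387470517120989364476325 * n ^ 3 + 41421016756854587702008 /
      2148286471769848425749759025 * n ^ 2 + 2901201077030736038640892 /
      21053207423344514572347638445 * n + 1051283408493406282352192 /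
      21053207423344514572347638445) * r0
  refine ⟨hn, ?_⟩
  rw [hn] at hT
  linear_combination hT / 486

theorem eq_of_normalInv_eq_pointC [CharZero k] {n τ : k} (hq : normalJ2 n ≠ 0)
    (h : normalInv n τ = pointC k) : n = -10 ∧ τ = 81 / 4 := by
  obtain ⟨e1, e2, e3⟩ := (normalInv_eq_iff hq).1 h
  rw [normalJ2] at e1 e2 e3
  have hT : τ * (108 * (n + 4)) = -18315 / 8464 * n ^ 4 - 10251 / 1058 * n ^ 3 - 26379 / 2116 * n
    ^ 2 - 4032 / 529 * n - 1008 / 529 := by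
    linear_combination e1
  have h2 : (n + 10) ^ 2 * (13471739 * n ^ 6 + 147666804 * n ^ 5 + 459518796 * n ^ 4 + 338852800
    * n ^ 3 + 52336896 * n ^ 2 - 13160448 * n - 1245184) = 0 := by
    linear_combination (17909824 / 19683) * (108 * (n + 4)) ^ 2 * e2 - (2238728 / 729) * (72 *
      (108 * (n + 4)) * (n + 1) ^ 2 * (n - 8) + 864 * (τ * (108 * (n + 4)) + (-18315 / 8464 * n ^
      4 - 10251 / 1058 * n ^ 3 - 26379 / 2116 * n ^ 2 - 4032 / 529 * n - 1008 / 529))) * hT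
  have h3 : (n + 10) ^ 2 * ((10460353203 / 88789742602728448 * n ^ 5 + 3948101171096043692403 /
    3521472189323031270990675968 * n ^ 4 - 27092880981850555304647202403 /
    5930044278789807996453082259308544 * n ^ 3 + 3997879189599084624493873043625690759 /
    159776017564599058376657699885870050476032 * n ^ 2 -
    16903384396310025800160898680068820431198715 /
    134528800443105884631006014075173194245620553728 * n +
    1348574642631343195437139891914090766321671221477493 /
    1812336887552606827113024329051059652673301992859092992) * (13471739 * n ^ 6 + 147666804 * n
    ^ 5 + 459518796 * n ^ 4 + 338852800 * n ^ 3 + 52336896 * n ^ 2 - 13160448 * n - 1245184) +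
    -129140163 / 37238778818784557144592428886559128229499917663744 *
    (17117795759358779730035860267039840399380809588 * n ^ 5 +
    87180877738364974062918462076458174988089782099 * n ^ 4 +
    71446433240969482124642233434748178193853203540 * n ^ 3 +
    12091581510437574064328778195359903738013866096 * n ^ 2 -
    2681633526167250944828943146379950074431472192 * n -
    257958499605283198113075323278526750721986304)) = 0 := by
    linear_combination (108 * (n + 4)) ^ 3 * e3 + 243 / 32 * ((τ * (108 * (n + 4))) ^ 2 + τ *
      (108 * (n + 4)) * (-18315 / 8464 * n ^ 4 - 10251 / 1058 * n ^ 3 - 26379 / 2116 * n ^ 2 -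
      4032 / 529 * n - 1008 / 529) + (-18315 / 8464 * n ^ 4 - 10251 / 1058 * n ^ 3 - 26379 / 2116
      * n ^ 2 - 4032 / 529 * n - 1008 / 529) ^ 2) * hT
  have hn : n = -10 := by
    by_contra hne
    have hd : (n + 10) ^ 2 ≠ 0 := pow_ne_zero 2 fun e => hne (by linear_combination e)
    have s0 := (mul_eq_zero.1 h2).resolve_left hd
    have r0 := (mul_eq_zero.1 h3).resolve_left hd
    rw [s0, mul_zero, zero_add] at r0
    replace r0 := (mul_eq_zero.1 r0).resolve_left (by norm_num)
    refine one_ne_zero (α := k) ?_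
    linear_combination
      (-8891182077357262325352052730060300239871953250391939827692972587947807756033 /
      31100475718213152681289838640706822349872002518275499707305527998263446151168 * n ^ 4 -
      605911252498388649070130222737269845348186967904133493530075347599463703729543 /
      456140310533792905992250966730366727798122703601373995707147743974530543550464 * n ^ 3 -
      11344450414808521962961524506806500223125738763626428300835928569576671587843 /
      19005846272241371083010456947098613658255112650057249821131155998938772647936 * n ^ 2 +
      3569627147013986994209801954537093677220297331306747040469787514489907947 /
      46192983108337115783714316101508917883957875736028962568236674045489860608 * n +
      72173658820373216171472751072108499292789525580878736694598139224534001 /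
      7814903894836090083474694468379364168690424609398540222504587170616271648) * s0 +
      (22854111411501854594190114691079 /
      101577155822375917316743807179689287581534062588662234854864931091939328 * n ^ 5 +
      404662282299068609003888313115475497255 /
      171052616450172339747094112523887522924296013850515248390180403990448953831424 * n ^ 4 +
      2263202713639906539438752738463512544151 /
      342105232900344679494188225047775045848592027701030496780360807980897907662848 * n ^ 3 +
      32749756937132317756605167507089506409 /
      12218044032155167124792436608849108780306858132179660599298600285032068130816 * n ^ 2 -
      16280445262444742353504752018928104725 /
      42763154112543084936773528130971880731074003462628812097545100997612238457856 * n -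
      25086072435188721767207112877203151 /
      562673080428198486010178001723314220145710571876694896020330276284371558656) * r0
  refine ⟨hn, ?_⟩
  rw [hn] at hT
  linear_combination hT / (-648)

theorem normalInv_pointA [CharZero k] : normalInv (8 : k) (-81) = pointA k := by
  rw [pointA, normalInv_eq_iff] <;> norm_num [normalJ2]

theorem normalInv_pointB [CharZero k] : normalInv (1 / 2 : k) (9 / 16) = pointB k := by
  rw [pointB, normalInv_eq_iff] <;> norm_num [normalJ2]

theorem normalInv_pointC [CharZero k] : normalInv (-10 : k) (81 / 4) = pointC k := by
  rw [pointC, normalInv_eq_iff] <;> norm_num [normalJ2]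

theorem J2_sextic_eq_normalJ2 [CharZero k] {u v n : k} (hn : 9 - v + 2 * u = n * (v - 27)) :
    J2 (sextic u v) = -4 * v ^ 4 * ((v - 27) ^ 2 * normalJ2 n) := by
  have hu : u = (n * (v - 27) + v - 9) / 2 := by linear_combination hn / 2
  rw [J2_sextic, j2Factor, normalJ2, hu]
  ring

theorem CurveOver.exists_normalInv [CharZero k] {u v : k} {P : Fin 3 → k} (h : CurveOver u v P) :
    v ≠ 0 ∧ v - 27 ≠ 0 ∧ ∃ n τ, normalJ2 n ≠ 0 ∧ 9 - v + 2 * u = n * (v - 27) ∧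
      discrFactor u v = τ * (v * (v - 27) ^ 3) ∧ normalInv n τ = P := by
  obtain ⟨h1, h2, h3⟩ := h
  obtain ⟨hv, ht, hw⟩ := isGenusTwo_sextic_iff.1 h1
  have hn : 9 - v + 2 * u = (9 - v + 2 * u) / (v - 27) * (v - 27) := (div_mul_cancel₀ _ ht).symm
  refine ⟨hv, ht, (9 - v + 2 * u) / (v - 27), discrFactor u v / (v * (v - 27) ^ 3), ?_, hn,
    (div_mul_cancel₀ _ (mul_ne_zero hv (pow_ne_zero 3 ht))).symm, (absInv_sextic hv ht).symm.trans h3⟩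
  intro h0
  rw [J2_sextic_eq_normalJ2 hn, h0] at h2
  simp at h2

theorem curveOver_of_normalInv [CharZero k] {u v n τ : k} {P : Fin 3 → k} (hv : v ≠ 0)
    (ht : v - 27 ≠ 0) (hτ : τ ≠ 0) (hq : normalJ2 n ≠ 0) (hn : 9 - v + 2 * u = n * (v - 27))
    (hw : discrFactor u v = τ * (v * (v - 27) ^ 3)) (hP : normalInv n τ = P) :
    CurveOver u v P := by
  have h3 : v * (v - 27) ^ 3 ≠ 0 := mul_ne_zero hv (pow_ne_zero 3 ht)
  refine ⟨isGenusTwo_sextic_iff.2 ⟨hv, ht, ?_⟩, ?_, ?_⟩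
  · rw [hw]
    exact mul_ne_zero hτ h3
  · rw [J2_sextic_eq_normalJ2 hn]
    simp [hv, ht, hq]
  · rw [absInv_sextic hv ht, hn, hw, mul_div_cancel_right₀ _ ht, mul_div_cancel_right₀ _ h3, hP]

/-- With n fixed, u is an affine function of v. The equation w = τv(v - 27)³ then splits off (v -
27)², leaving a quadratic in v. The same holds at the other two points, where the quadratic has
roots in k involving √5 and √-1. -/
theorem CurveOver.eq_of_pointA [CharZero k] {u v : k} (h : CurveOver u v (pointA k)) :
    (u = 25 / 2 ∧ v = 250 / 9) ∨ (u = -775 / 8 ∧ v = 125 / 36) := by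
  obtain ⟨hv, ht, n, τ, hq, hn, hw, hP⟩ := h.exists_normalInv
  obtain ⟨rfl, rfl⟩ := eq_of_normalInv_eq_pointA hq hP
  have hu : u = 9 + 9 / 2 * (v - 27) := by linear_combination hn / 2
  have h2 : (v - 27) ^ 2 * ((9 * v - 250) * (36 * v - 125)) = 0 := by
    rw [discrFactor, hu] at hw
    linear_combination 4 * hw
  rcases mul_eq_zero.1 ((mul_eq_zero.1 h2).resolve_left (pow_ne_zero 2 ht)) with h | h
  · exact Or.inl ⟨by rw [hu]; linear_combination h / 2, by linear_combination h / 9⟩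
  · exact Or.inr ⟨by rw [hu]; linear_combination h / 8, by linear_combination h / 36⟩

theorem exists_curveOver_pointA [CharZero k] : ∃ u v : k, CurveOver u v (pointA k) :=
  ⟨25 / 2, 250 / 9, curveOver_of_normalInv (by norm_num) (by norm_num) (by norm_num)
    (by norm_num [normalJ2]) (by norm_num) (by norm_num [discrFactor]) normalInv_pointA⟩

theorem CurveOver.exists_eq_of_pointB [CharZero k] {u v : k} (h : CurveOver u v (pointB k)) :
    ∃ s : k, s ^ 2 = 5 ∧ u = -15 / 8 + 35 / 8 * s ∧ v = 25 / 2 + 35 / 6 * s := by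
  obtain ⟨hv, ht, n, τ, hq, hn, hw, hP⟩ := h.exists_normalInv
  obtain ⟨rfl, rfl⟩ := eq_of_normalInv_eq_pointB hq hP
  have hu : u = 9 + 3 / 4 * (v - 27) := by linear_combination hn / 2
  have h2 : (v - 27) ^ 2 * (9 * v ^ 2 - 225 * v - 125) = 0 := by
    rw [discrFactor, hu] at hw
    linear_combination (-16) * hw
  have h3 := (mul_eq_zero.1 h2).resolve_left (pow_ne_zero 2 ht)
  refine ⟨(v - 25 / 2) * (6 / 35), ?_, ?_, ?_⟩
  · linear_combination 4 / 1225 * h3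
  · rw [hu]
    ring
  · ring

theorem exists_curveOver_pointB [IsAlgClosed k] [CharZero k] :
    ∃ u v : k, CurveOver u v (pointB k) := by
  obtain ⟨s, hs⟩ := IsAlgClosed.exists_pow_nat_eq (5 : k) two_pos
  refine ⟨-15 / 8 + 35 / 8 * s, 25 / 2 + 35 / 6 * s, curveOver_of_normalInv ?_ ?_
    (by norm_num) (by norm_num [normalJ2]) ?_ ?_ normalInv_pointB⟩
  · intro h
    have : (1 : k) = 0 := by
      -- Multiplication by the conjugate under s ↦ -s: the norm of v is -125/9.
      linear_combination (-9 / 125) * (25 / 2 - 35 / 6 * s) * h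
        - 49 / 20 * hs
    simp at this
  · intro h
    have : (1 : k) = 0 := by
      linear_combination (-9 / 361) * (29 / 2 + 35 / 6 * s) * h
        + 1225 / 1444 * hs
    simp at this
  · ring
  · rw [discrFactor]
    linear_combination (-1225 / 64) * (25 / 2 + 35 / 6 * s - 27) ^ 2 * hs

theorem CurveOver.exists_eq_of_pointC [CharZero k] {u v : k} (h : CurveOver u v (pointC k)) :
    ∃ s : k, s ^ 2 = -1 ∧ u = 27 - 77 / 2 * s ∧ v = 23 + 77 / 9 * s := by
  obtain ⟨hv, ht, n, τ, hq, hn, hw, hP⟩ := h.exists_normalInv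
  obtain ⟨rfl, rfl⟩ := eq_of_normalInv_eq_pointC hq hP
  have hu : u = 9 - 9 / 2 * (v - 27) := by linear_combination hn / 2
  have h2 : (v - 27) ^ 2 * (81 * v ^ 2 - 3726 * v + 48778) = 0 := by
    rw [discrFactor, hu] at hw
    linear_combination (-4) * hw
  have h3 := (mul_eq_zero.1 h2).resolve_left (pow_ne_zero 2 ht)
  refine ⟨(v - 23) * (9 / 77), ?_, ?_, ?_⟩
  · linear_combination 1 / 5929 * h3
  · rw [hu]
    ring
  · ring

theorem exists_curveOver_pointC [IsAlgClosed k] [CharZero k] :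
    ∃ u v : k, CurveOver u v (pointC k) := by
  obtain ⟨s, hs⟩ := IsAlgClosed.exists_pow_nat_eq (-1 : k) two_pos
  refine ⟨27 - 77 / 2 * s, 23 + 77 / 9 * s, curveOver_of_normalInv ?_ ?_
    (by norm_num) (by norm_num [normalJ2]) ?_ ?_ normalInv_pointC⟩
  · intro h
    have : (1 : k) = 0 := by
      linear_combination 81 / 48778 * (23 - 77 / 9 * s) * h + 5929 / 48778 * hs
    simp at this
  · intro h
    have : (1 : k) = 0 := by
      linear_combination 81 / 7225 * (-4 - 77 / 9 * s) * h + 5929 / 7225 * hs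
    simp at this
  · ring
  · rw [discrFactor]
    linear_combination (-5929 / 4) * (23 + 77 / 9 * s - 27) ^ 2 * hs

end Points

end ShaskaSurface

/-! ### Reduction of the explicit curves to normal form. -/

namespace ShaskaSurface

open Polynomial

section AutomorphismGroups

variable {k : Type*} [Field k]

/-- The substitution is x = (aX + b)/(v(X + 1)), so X = ∞ and X = 0 go to a/v and b/v. The f_i and
g_i are the coefficients of the transformed cubics after removing v² from each. -/
theorem mobius_sextic {u v a b f0 f1 f2 f3 g0 g1 g2 g3 : k}
    (hf0 : 4 * b ^ 3 + v * b ^ 2 + 2 * v * b + v = f0)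
    (hf1 : 12 * a * b ^ 2 + v * (2 * a * b + b ^ 2) + 2 * v * (a + 2 * b) + 3 * v = f1)
    (hf2 : 12 * a ^ 2 * b + v * (2 * a * b + a ^ 2) + 2 * v * (2 * a + b) + 3 * v = f2)
    (hf3 : 4 * a ^ 3 + v * a ^ 2 + 2 * v * a + v = f3)
    (hg0 : b ^ 3 + u * b ^ 2 + v * b + v = g0)
    (hg1 : 3 * a * b ^ 2 + u * (2 * a * b + b ^ 2) + v * (a + 2 * b) + 3 * v = g1)
    (hg2 : 3 * a ^ 2 * b + u * (2 * a * b + a ^ 2) + v * (2 * a + b) + 3 * v = g2)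
    (hg3 : a ^ 3 + u * a ^ 2 + v * a + v = g3) :
    mobius (sextic u v) a b v v = C (v ^ 4 * (f3 * g3)) * X ^ 6
      + C (v ^ 4 * (f3 * g2 + f2 * g3)) * X ^ 5 + C (v ^ 4 * (f3 * g1 + f2 * g2 + f1 * g3)) * X ^ 4
      + C (v ^ 4 * (f3 * g0 + f2 * g1 + f1 * g2 + f0 * g3)) * X ^ 3
      + C (v ^ 4 * (f2 * g0 + f1 * g1 + f0 * g2)) * X ^ 2 + C (v ^ 4 * (f1 * g0 + f0 * g1)) * X
      + C (v ^ 4 * (f0 * g0)) := by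
  obtain ⟨h0, h1, h2, h3, h4, h5, h6⟩ := coeff_sextic u v
  rw [mobius]
  simp only [Finset.sum_range_succ, Finset.sum_range_zero, h0, h1, h2, h3, h4, h5, h6, ← hf0, ← hf1,
    ← hf2, ← hf3, ← hg0, ← hg1, ← hg2, ← hg3, C_add, C_mul, C_pow, map_ofNat, C_1]
  ring

/-- For D₄ the points a/v and b/v are roots of the sextic, and the even coefficients must vanish. N
is the product of the coefficients of X and X⁵ and M is the coefficient of X³, up to powers of v;
only these enter the conditions on s² = M²/N. -/
theorem nonempty_curveAut_sextic_four [IsAlgClosed k] [CharZero k]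
    {u v a b f0 f1 f2 f3 g0 g1 g2 g3 N M : k} (hf : IsGenusTwo (sextic u v)) (hab : a ≠ b)
    (hf0 : 4 * b ^ 3 + v * b ^ 2 + 2 * v * b + v = f0)
    (hf1 : 12 * a * b ^ 2 + v * (2 * a * b + b ^ 2) + 2 * v * (a + 2 * b) + 3 * v = f1)
    (hf2 : 12 * a ^ 2 * b + v * (2 * a * b + a ^ 2) + 2 * v * (2 * a + b) + 3 * v = f2)
    (hf3 : 4 * a ^ 3 + v * a ^ 2 + 2 * v * a + v = f3)
    (hg0 : b ^ 3 + u * b ^ 2 + v * b + v = g0)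
    (hg1 : 3 * a * b ^ 2 + u * (2 * a * b + b ^ 2) + v * (a + 2 * b) + 3 * v = g1)
    (hg2 : 3 * a ^ 2 * b + u * (2 * a * b + a ^ 2) + v * (2 * a + b) + 3 * v = g2)
    (hg3 : a ^ 3 + u * a ^ 2 + v * a + v = g3)
    (e0 : f0 * g0 = 0) (e2 : f2 * g0 + f1 * g1 + f0 * g2 = 0)
    (e4 : f3 * g1 + f2 * g2 + f1 * g3 = 0) (e6 : f3 * g3 = 0)
    (hN : (f1 * g0 + f0 * g1) * (f3 * g2 + f2 * g3) = N)
    (hM : f3 * g0 + f2 * g1 + f1 * g2 + f0 * g3 = M) (hN0 : N ≠ 0) (hM0 : M ≠ 0)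
    (h4 : M ^ 2 - 4 * N ≠ 0) (h100 : 9 * M ^ 2 - 100 * N ≠ 0) :
    Nonempty (CurveAut (sextic u v) ≃* DihedralGroup 4) := by
  have h := mobius_sextic hf0 hf1 hf2 hf3 hg0 hg1 hg2 hg3
  have hv := pow_ne_zero 4 (isGenusTwo_sextic_iff.1 hf).1
  rw [e0, e2, e4, e6, hM, mul_zero, C_0, zero_mul, zero_mul, zero_mul, zero_add, add_zero,
    add_zero, add_zero] at h
  subst hN
  have hc := mul_ne_zero_iff.1 hN0
  refine nonempty_curveAut_mulEquiv_dihedralGroup_four hf ?_ h (mul_ne_zero hv hc.1)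
    (mul_ne_zero hv hM0) (mul_ne_zero hv hc.2) ?_ ?_
  · rw [← sub_mul]
    exact mul_ne_zero (sub_ne_zero.2 hab) (isGenusTwo_sextic_iff.1 hf).1
  · exact fun e => mul_ne_zero (pow_ne_zero 2 hv) h4 (by linear_combination e)
  · exact fun e => mul_ne_zero (pow_ne_zero 2 hv) h100 (by linear_combination e)

/-- For D₆ only the coefficients of 1, X³ and X⁶ may survive. N is the product of the outer two and
M is the middle one, up to powers of v, so s² = M²/N. -/
theorem nonempty_curveAut_sextic_six [IsAlgClosed k] [CharZero k]
    {u v a b f0 f1 f2 f3 g0 g1 g2 g3 N M : k} (hf : IsGenusTwo (sextic u v)) (hab : a ≠ b)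
    (hf0 : 4 * b ^ 3 + v * b ^ 2 + 2 * v * b + v = f0)
    (hf1 : 12 * a * b ^ 2 + v * (2 * a * b + b ^ 2) + 2 * v * (a + 2 * b) + 3 * v = f1)
    (hf2 : 12 * a ^ 2 * b + v * (2 * a * b + a ^ 2) + 2 * v * (2 * a + b) + 3 * v = f2)
    (hf3 : 4 * a ^ 3 + v * a ^ 2 + 2 * v * a + v = f3)
    (hg0 : b ^ 3 + u * b ^ 2 + v * b + v = g0)
    (hg1 : 3 * a * b ^ 2 + u * (2 * a * b + b ^ 2) + v * (a + 2 * b) + 3 * v = g1)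
    (hg2 : 3 * a ^ 2 * b + u * (2 * a * b + a ^ 2) + v * (2 * a + b) + 3 * v = g2)
    (hg3 : a ^ 3 + u * a ^ 2 + v * a + v = g3)
    (e1 : f1 * g0 + f0 * g1 = 0) (e2 : f2 * g0 + f1 * g1 + f0 * g2 = 0)
    (e4 : f3 * g1 + f2 * g2 + f1 * g3 = 0) (e5 : f3 * g2 + f2 * g3 = 0)
    (hN : (f0 * g0) * (f3 * g3) = N)
    (hM : f3 * g0 + f2 * g1 + f1 * g2 + f0 * g3 = M) (hN0 : N ≠ 0) (hM0 : M ≠ 0)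
    (h4 : M ^ 2 - 4 * N ≠ 0) (h50 : 1 * M ^ 2 + 50 * N ≠ 0) :
    Nonempty (CurveAut (sextic u v) ≃* DihedralGroup 6) := by
  have h := mobius_sextic hf0 hf1 hf2 hf3 hg0 hg1 hg2 hg3
  have hv := pow_ne_zero 4 (isGenusTwo_sextic_iff.1 hf).1
  rw [e1, e2, e4, e5, hM, mul_zero, C_0, zero_mul, zero_mul, zero_mul, zero_mul, add_zero, add_zero,
    add_zero, add_zero] at h
  subst hN
  have hc := mul_ne_zero_iff.1 hN0
  refine nonempty_curveAut_mulEquiv_dihedralGroup_six hf ?_ h (mul_ne_zero hv hc.1)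
    (mul_ne_zero hv hM0) (mul_ne_zero hv hc.2) ?_ ?_
  · rw [← sub_mul]
    exact mul_ne_zero (sub_ne_zero.2 hab) (isGenusTwo_sextic_iff.1 hf).1
  · exact fun e => mul_ne_zero (pow_ne_zero 2 hv) h4 (by linear_combination e)
  · exact fun e => mul_ne_zero (pow_ne_zero 2 hv) h50 (by linear_combination e)

theorem nonempty_curveAut_sextic_250_9 [IsAlgClosed k] [CharZero k] (hf : IsGenusTwo (sextic (25 /
  2 : k) (250 / 9))) : Nonempty (CurveAut (sextic (25 / 2 : k) (250 / 9)) ≃* DihedralGroup 4) :=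
  by
  -- Here a and b are the roots of T² + (40/9)T + 25/9, a factor of 4T³ + vT² + 2vT + v; hence `f0`
  -- and `f3` are zero.
  obtain ⟨ω, hω⟩ := IsAlgClosed.exists_pow_nat_eq (700 / 81 : k) two_pos
  refine nonempty_curveAut_sextic_four hf (a := (-40 / 9 + ω) / 2) (b := (-40 / 9 - ω) / 2) (f0 :=
    0) (f1 := 1400 / 81 * ω - 7000 / 729) (f2 := -1400 / 81 * ω - 7000 / 729) (f3 := 0) (g0 := 875
    / 162 * ω + 42875 / 1458) (g1 := 175 / 18 * ω + 6125 / 162) (g2 := -175 / 18 * ω + 6125 / 162)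
    (g3 := -875 / 162 * ω + 42875 / 1458) (N := -65652343750000 / 43046721) (M := -214375000 /
    59049) ?_ ?_ ?_ ?_ ?_ ?_ ?_ ?_ ?_ ?_ ?_ ?_ ?_ ?_ ?_ ?_ ?_ ?_ ?_
  · intro h
    refine one_ne_zero (α := k) ?_
    linear_combination (81 / 700) * ω * h - (81 / 700) * hω
  · linear_combination (-1 / 2 * ω + 5 / 18) * hω
  · linear_combination (3 / 2 * ω - 5 / 18) * hω
  · linear_combination (-3 / 2 * ω - 5 / 18) * hω
  · linear_combination (1 / 2 * ω + 5 / 18) * hω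
  · linear_combination (-1 / 8 * ω + 35 / 24) * hω
  · linear_combination (3 / 8 * ω - 35 / 24) * hω
  · linear_combination (-3 / 8 * ω - 35 / 24) * hω
  · linear_combination (1 / 8 * ω + 35 / 24) * hω
  · ring
  · linear_combination (490000 / 6561) * hω
  · linear_combination (490000 / 6561) * hω
  · ring
  · linear_combination (375156250000 / 43046721 * ω ^ 2 - 647519687500000 / 3486784401) * hω
  · linear_combination (-245000 / 729) * hω
  · norm_num
  · norm_num
  · norm_num
  · norm_num

theorem nonempty_curveAut_sextic_125_36 [IsAlgClosed k] [CharZero k] (hf : IsGenusTwo (sextic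
  (-775 / 8 : k) (125 / 36))) : Nonempty (CurveAut (sextic (-775 / 8 : k) (125 / 36)) ≃*
  DihedralGroup 4) := by
  -- This time a and b are the roots of T² - (290/3)T - 50/3, a factor of T³ + uT² + vT + v coming
  -- from the second cubic.
  obtain ⟨ω, hω⟩ := IsAlgClosed.exists_pow_nat_eq (84700 / 9 : k) two_pos
  refine nonempty_curveAut_sextic_four hf (a := (290 / 3 + ω) / 2) (b := (290 / 3 - ω) / 2) (f0 :=
    -510125 / 27 * ω + 593852875 / 324) (f1 := -1925 / 27 * ω + 2435125 / 324) (f2 := 1925 / 27 *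
    ω + 2435125 / 324) (f3 := 510125 / 27 * ω + 593852875 / 324) (g0 := 0) (g1 := 42350 / 9 * ω -
    8152375 / 18) (g2 := -42350 / 9 * ω - 8152375 / 18) (g3 := 0) (N := -106428294743409912109375
    / 3779136) (M := -4315663515625 / 8748) ?_ ?_ ?_ ?_ ?_ ?_ ?_ ?_ ?_ ?_ ?_ ?_ ?_ ?_ ?_ ?_ ?_ ?_
    ?_
  · intro h
    refine one_ne_zero (α := k) ?_
    linear_combination (9 / 84700) * ω * h - (9 / 84700) * hω
  · linear_combination (-1 / 2 * ω + 21005 / 144) * hω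
  · linear_combination (3 / 2 * ω - 21005 / 144) * hω
  · linear_combination (-3 / 2 * ω - 21005 / 144) * hω
  · linear_combination (1 / 2 * ω + 21005 / 144) * hω
  · linear_combination (-1 / 8 * ω + 385 / 32) * hω
  · linear_combination (3 / 8 * ω - 385 / 32) * hω
  · linear_combination (-3 / 8 * ω - 385 / 32) * hω
  · linear_combination (1 / 8 * ω + 385 / 32) * hω
  · ring
  · linear_combination (7174090000 / 81) * hω
  · linear_combination (7174090000 / 81) * hω
  · ring
  · linear_combination (466723904392539062500 / 59049 * ω ^ 2 - 8647541458656311298828125 /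
    118098) * hω
  · linear_combination (163047500 / 243) * hω
  · norm_num
  · norm_num
  · norm_num
  · norm_num

theorem nonempty_curveAut_sextic_pointB [IsAlgClosed k] [CharZero k] {s : k} (hs : s ^ 2 = 5) (hf
  : IsGenusTwo (sextic (-15 / 8 + 35 / 8 * s) (25 / 2 + 35 / 6 * s))) : Nonempty (CurveAut (sextic
  (-15 / 8 + 35 / 8 * s) (25 / 2 + 35 / 6 * s)) ≃* DihedralGroup 6) := by
  obtain ⟨ω, hω⟩ := IsAlgClosed.exists_pow_nat_eq (1840 / 121 * s + 4245 / 121 : k) two_pos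
  refine nonempty_curveAut_sextic_six hf (a := (10 / 11 * s + 15 / 11 + ω) / 2) (b := (10 / 11 * s
    + 15 / 11 - ω) / 2) (f0 := -38935 / 1452 * ω * s - 88295 / 1452 * ω + 1190865 / 5324 * s +
    2654225 / 5324) (f1 := 475 / 132 * ω * s + 1235 / 132 * ω - 19105 / 484 * s - 128075 / 1452)
    (f2 := -475 / 132 * ω * s - 1235 / 132 * ω - 19105 / 484 * s - 128075 / 1452) (f3 := 38935 /
    1452 * ω * s + 88295 / 1452 * ω + 1190865 / 5324 * s + 2654225 / 5324) (g0 := -45755 / 5808 *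
    ω * s - 41715 / 1936 * ω + 4661705 / 63888 * s + 10096675 / 63888) (g1 := -145 / 528 * ω * s -
    705 / 176 * ω + 29005 / 1936 * s + 61575 / 1936) (g2 := 145 / 528 * ω * s + 705 / 176 * ω +
    29005 / 1936 * s + 61575 / 1936) (g3 := 45755 / 5808 * ω * s + 41715 / 1936 * ω + 4661705 /
    63888 * s + 10096675 / 63888) (N := 1830004479484375 / 286992882 * s + 10912051941296875 /
    765314352) (M := -128038375 / 23958 * s - 142926250 / 11979) ?_ ?_ ?_ ?_ ?_ ?_ ?_ ?_ ?_ ?_ ?_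
    ?_ ?_ ?_ ?_ ?_ ?_ ?_ ?_
  · intro h
    refine one_ne_zero (α := k) ?_
    linear_combination (-368 / 1805 * s + 849 / 1805) * ω * h - (-368 / 1805 * s + 849 / 1805) *
      hω + (135424 / 43681) * hs
  · linear_combination (-1 / 2 * ω + 745 / 264 * s + 455 / 88) * hω + (-2825 / 726 * ω + 12625 /
    7986 * s + 74675 / 1331) * hs
  · linear_combination (3 / 2 * ω - 745 / 264 * s - 455 / 88) * hω + (-2825 / 726 * ω + 12625 /
    2662 * s - 13325 / 3993) * hs
  · linear_combination (-3 / 2 * ω - 745 / 264 * s - 455 / 88) * hω + (2825 / 726 * ω + 12625 /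
    2662 * s - 13325 / 3993) * hs
  · linear_combination (1 / 2 * ω + 745 / 264 * s + 455 / 88) * hω + (2825 / 726 * ω + 12625 /
    7986 * s + 74675 / 1331) * hs
  · linear_combination (-1 / 8 * ω + 505 / 352 * s + 15 / 352) * hω + (-2225 / 968 * ω + 10625 /
    10648 * s + 434675 / 15972) * hs
  · linear_combination (3 / 8 * ω - 505 / 352 * s - 15 / 352) * hω + (-2225 / 968 * ω + 31875 /
    10648 * s - 29925 / 5324) * hs
  · linear_combination (-3 / 8 * ω - 505 / 352 * s - 15 / 352) * hω + (2225 / 968 * ω + 31875 /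
    10648 * s - 29925 / 5324) * hs
  · linear_combination (1 / 8 * ω + 505 / 352 * s + 15 / 352) * hω + (2225 / 968 * ω + 10625 /
    10648 * s + 434675 / 15972) * hs
  · linear_combination (-731275 / 34848 * s ^ 2 - 236375 / 8712 * s + 162575 / 3872) * hω +
    (2644325 / 23958 * ω - 84096625 / 263538 * s - 357294775 / 527076) * hs
  · linear_combination (1393675 / 69696 * s ^ 2 + 16075 / 1584 * s - 615375 / 7744) * hω +
    (-10884625 / 47916 * ω + 160272625 / 527076 * s + 387597875 / 527076) * hs
  · linear_combination (1393675 / 69696 * s ^ 2 + 16075 / 1584 * s - 615375 / 7744) * hω +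
    (10884625 / 47916 * ω + 160272625 / 527076 * s + 387597875 / 527076) * hs
  · linear_combination (-731275 / 34848 * s ^ 2 - 236375 / 8712 * s + 162575 / 3872) * hω +
    (-2644325 / 23958 * ω - 84096625 / 263538 * s - 357294775 / 527076) * hs
  · linear_combination (3173638656620355625 / 71119132102656 * ω ^ 2 * s ^ 4 + 3969321332931231875
    / 8889891512832 * ω ^ 2 * s ^ 3 + 59400636161400636875 / 35559566051328 * ω ^ 2 * s ^ 2 +
    303949976537420625 / 109751747072 * ω ^ 2 * s + 1507350357176900625 / 878013976576 * ω ^ 2 +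
    364968445511340896875 / 537838436526336 * s ^ 5 + 4078828172972924515625 / 2868471661473792 *
    s ^ 4 - 25500471390811594926875 / 1075676873052672 * s ^ 3 - 60481215352230520774375 /
    478078610245632 * s ^ 2 - 22627206756734028678125 / 97788806641152 * s -
    1269442513566347773628125 / 8605414984421376) * hω + (41971371233804203140625 /
    4067403176230416 * s ^ 4 + 123186948786304211046875 / 2711602117486944 * s ^ 3 +
    360105121082954256875 / 48894403320576 * s ^ 2 - 21127799571457802928125 / 112983421561956 * s
    - 163576225808221962053125 / 803437664440576) * hs
  · linear_combination (-886568525 / 2108304 * s ^ 2 - 1096153825 / 527076 * s - 596312375 /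
    234256) * hω + (-101955380375 / 15944049 * s - 1902856534625 / 127552392) * hs
  -- The remaining inequalities follow by multiplying with the conjugate under s ↦ -s and dividing
  -- by the nonzero rational norm.
  · intro h
    refine one_ne_zero (α := k) ?_
    linear_combination (-1214303132370816 / 95797910278140625 * s + 2715267708656784 /
      95797910278140625) * h + (877898339433284443902016 / 10861557870736197361) * hs
  · intro h
    refine one_ne_zero (α := k) ?_
    linear_combination (-18437526 / 1547561875 * s + 8232552 / 309512375) * h + (-1049204830249 /
      16478438845) * hs
  · intro h
    refine one_ne_zero (α := k) ?_
    linear_combination (-75893945773176 / 95797910278140625 * s + 169704231791049 /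
      95797910278140625) * h + (245766341024296099190126 / 10861557870736197361 * s +
      1313389657623699315328543 / 43446231482944789444) * hs
  · intro h
    refine one_ne_zero (α := k) ?_
    linear_combination (-607151566185408 / 3352926859734921875 * s + 1357633854328392 /
      3352926859734921875) * h + (1966130728194368793521008 / 380154525475766907635 * s +
      26330034479946078616011518 / 380154525475766907635) * hs

set_option maxHeartbeats 800000 in
theorem nonempty_curveAut_sextic_pointC [IsAlgClosed k] [CharZero k] {s : k} (hs : s ^ 2 = -1) (hf
  : IsGenusTwo (sextic (27 - 77 / 2 * s) (23 + 77 / 9 * s))) : Nonempty (CurveAut (sextic (27 - 77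
  / 2 * s) (23 + 77 / 9 * s)) ≃* DihedralGroup 4) := by
  -- The right side is the square of (25 - 19s)/12, so ω is this element up to sign, and the points
  -- sent to 0 and ∞ are one root of F and one of G.
  obtain ⟨ω, hω⟩ := IsAlgClosed.exists_pow_nat_eq (-475 / 72 * s + 11 / 6 : k) two_pos
  refine nonempty_curveAut_sextic_four hf (a := (-1 / 12 * s - 17 / 12 + ω) / 2) (b := (-1 / 12 *
    s - 17 / 12 - ω) / 2) (f0 := 38 / 27 * ω * s - 593 / 54 * ω - 1463 / 72 * s + 13381 / 648) (f1
    := -1273 / 108 * ω * s - 395 / 54 * ω + 8611 / 432 * s - 23041 / 1296) (f2 := 1273 / 108 * ω *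
    s + 395 / 54 * ω + 8611 / 432 * s - 23041 / 1296) (f3 := -38 / 27 * ω * s + 593 / 54 * ω -
    1463 / 72 * s + 13381 / 648) (g0 := -475 / 16 * ω * s + 33 / 4 * ω - 14383 / 192 * s - 5725 /
    192) (g1 := -2375 / 72 * ω * s + 55 / 6 * ω + 2933 / 288 * s + 11497 / 96) (g2 := 2375 / 72 *
    ω * s - 55 / 6 * ω + 2933 / 288 * s + 11497 / 96) (g3 := 475 / 16 * ω * s - 33 / 4 * ω - 14383
    / 192 * s - 5725 / 192) (N := 1946325458278483 / 30233088 * s + 1584498906219097 / 26873856)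
    (M := -102443117 / 17496 * s - 930955151 / 69984) ?_ ?_ ?_ ?_ ?_ ?_ ?_ ?_ ?_ ?_ ?_ ?_ ?_ ?_ ?_
    ?_ ?_ ?_ ?_
  · intro h
    refine one_ne_zero (α := k) ?_
    linear_combination (34200 / 243049 * s + 9504 / 243049) * ω * h - (34200 / 243049 * s + 9504 /
      243049) * hω + (225625 / 243049) * hs
  · linear_combination (-1 / 2 * ω + 145 / 72 * s + 29 / 8) * hω + (299 / 864 * ω + 151 / 10368 *
    s - 139645 / 10368) * hs
  · linear_combination (3 / 2 * ω - 145 / 72 * s - 29 / 8) * hω + (299 / 864 * ω + 151 / 3456 * s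
    + 132065 / 10368) * hs
  · linear_combination (-3 / 2 * ω - 145 / 72 * s - 29 / 8) * hω + (-299 / 864 * ω + 151 / 3456 *
    s + 132065 / 10368) * hs
  · linear_combination (1 / 2 * ω + 145 / 72 * s + 29 / 8) * hω + (-299 / 864 * ω + 151 / 10368 *
    s - 139645 / 10368) * hs
  · linear_combination (-1 / 8 * ω - 309 / 32 * s + 199 / 32) * hω + (-617 / 384 * ω - 925 / 13824
    * s + 844903 / 13824) * hs
  · linear_combination (3 / 8 * ω + 309 / 32 * s - 199 / 32) * hω + (-617 / 384 * ω - 925 / 4608 *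
    s - 329297 / 4608) * hs
  · linear_combination (-3 / 8 * ω + 309 / 32 * s - 199 / 32) * hω + (617 / 384 * ω - 925 / 4608 *
    s - 329297 / 4608) * hs
  · linear_combination (1 / 8 * ω - 309 / 32 * s + 199 / 32) * hω + (617 / 384 * ω - 925 / 13824 *
    s + 844903 / 13824) * hs
  · linear_combination (-9025 / 216 * s ^ 2 + 291707 / 864 * s - 6523 / 72) * hω + (5161217 /
    10368 * ω + 4286875 / 15552 * s - 97271089 / 124416) * hs
  · linear_combination (442225 / 5184 * s ^ 2 - 312607 / 864 * s + 2255 / 24) * hω + (-10050791 /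
    3456 * ω - 210056875 / 373248 * s + 86777813 / 82944) * hs
  · linear_combination (442225 / 5184 * s ^ 2 - 312607 / 864 * s + 2255 / 24) * hω + (10050791 /
    3456 * ω - 210056875 / 373248 * s + 86777813 / 82944) * hs
  · linear_combination (-9025 / 216 * s ^ 2 + 291707 / 864 * s - 6523 / 72) * hω + (-5161217 /
    10368 * ω + 4286875 / 15552 * s - 97271089 / 124416) * hs
  · linear_combination (22279108005625 / 241864704 * ω ^ 2 * s ^ 4 + 18170084474975 / 60466176 * ω
    ^ 2 * s ^ 3 + 8909276016589 / 60466176 * ω ^ 2 * s ^ 2 - 401641025555 / 2519424 * ω ^ 2 * s +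
    10885792225 / 419904 * ω ^ 2 - 10582576302671875 / 17414258688 * s ^ 5 - 66135946058360177 /
    17414258688 * s ^ 4 - 19723660171044391 / 4353564672 * s ^ 3 + 63895758627349597 / 17414258688
    * s ^ 2 + 13453970500259449 / 2902376448 * s - 1965244004129701 / 967458816) * hω +
    (5026723743769140625 / 1253826625536 * s ^ 4 + 30017674305768396575 / 1253826625536 * s ^ 3 +
    4050728394184445279 / 185752092672 * s ^ 2 - 2386969719918665527 / 46438023168 * s -
    9968561866366532989 / 185752092672) * hs
  · linear_combination (-2698475 / 3888 * s ^ 2 - 3661433 / 3888 * s + 102157 / 324) * hω +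
    (1281775625 / 279936 * s + 2348848583 / 279936) * hs
  · intro h
    refine one_ne_zero (α := k) ?_
    linear_combination (-3765979446833517122912256 / 445805278019319294346315937130625 * s +
      3449109230469050895470592 / 445805278019319294346315937130625) * h +
      (242443698530748599623550770002496 / 445805278019319294346315937130625) * hs
  · intro h
    refine one_ne_zero (α := k) ?_
    linear_combination (4096788057216 / 147798709814891975 * s - 9307423612512 /
      147798709814891975) * h + (3426805623077776 / 21114101402127425) * hs
  · intro h
    refine one_ne_zero (α := k) ?_
    linear_combination (2383158868699335054342912 / 445805278019319294346315937130625 * s -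
      2182639434906196269789984 / 445805278019319294346315937130625) * h +
      (-81703568053409651951123959599148 / 445805278019319294346315937130625 * s +
      634545426115381860504728078900489 / 891610556038638588692631874261250) * hs
  · intro h
    refine one_ne_zero (α := k) ?_
    linear_combination (529590859710963345409536 / 4903858058212512237809475308436875 * s -
      44093725957700934743232 / 445805278019319294346315937130625) * h +
      (-163407136106819303902247919198296 / 4903858058212512237809475308436875 * s +
      256048973899283568828789546265723 / 445805278019319294346315937130625) * hs

theorem CurveOver.nonempty_curveAut_pointA [IsAlgClosed k] [CharZero k] {u v : k}
    (h : CurveOver u v (pointA k)) : Nonempty (CurveAut (sextic u v) ≃* DihedralGroup 4) := by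
  rcases h.eq_of_pointA with ⟨rfl, rfl⟩ | ⟨rfl, rfl⟩
  · exact nonempty_curveAut_sextic_250_9 h.1
  · exact nonempty_curveAut_sextic_125_36 h.1

theorem CurveOver.nonempty_curveAut_pointB [IsAlgClosed k] [CharZero k] {u v : k}
    (h : CurveOver u v (pointB k)) : Nonempty (CurveAut (sextic u v) ≃* DihedralGroup 6) := by
  obtain ⟨s, hs, rfl, rfl⟩ := h.exists_eq_of_pointB
  exact nonempty_curveAut_sextic_pointB hs h.1

theorem CurveOver.nonempty_curveAut_pointC [IsAlgClosed k] [CharZero k] {u v : k}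
    (h : CurveOver u v (pointC k)) : Nonempty (CurveAut (sextic u v) ≃* DihedralGroup 4) := by
  obtain ⟨s, hs, rfl, rfl⟩ := h.exists_eq_of_pointC
  exact nonempty_curveAut_sextic_pointC hs h.1

end AutomorphismGroups

end ShaskaSurface

/-! ### The minors of the Jacobian matrix and the singular locus. -/

namespace ShaskaSurface

section SingularLocus

variable {k : Type*} [Field k]

theorem pderiv_ofNat (l : Fin 2) (m : ℕ) [m.AtLeastTwo] :
    MvPolynomial.pderiv l (no_index (OfNat.ofNat m) : MvPolynomial (Fin 2) k) = 0 :=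
  Derivation.map_natCast _ m

theorem eval_pderiv_num (r : Fin 2 → k) (j : Fin 3) (l : Fin 2) :
    MvPolynomial.eval r (MvPolynomial.pderiv l (num k j)) =
      (![![45 * r 0 ^ 4 + 6912 * r 0 ^ 3 * r 1 + 373248 * r 0 ^ 2 * r 1 ^ 2 + 7962624 * r 0 * r 1
        ^ 3 + 47775744 * r 1 ^ 4 + 7077888 * r 1 ^ 3, 1728 * r 0 ^ 4 + 248832 * r 0 ^ 3 * r 1 +
        11943936 * r 0 ^ 2 * r 1 ^ 2 + 191102976 * r 0 * r 1 ^ 3 + 21233664 * r 0 * r 1 ^ 2 +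
        339738624 * r 1 ^ 3], ![216 * r 0 ^ 7 + 54432 * r 0 ^ 6 * r 1 + 5598720 * r 0 ^ 5 * r 1 ^
        2 + 298598400 * r 0 ^ 4 * r 1 ^ 3 + 8599633920 * r 0 ^ 3 * r 1 ^ 4 + 123834728448 * r 0 ^
        2 * r 1 ^ 5 + 660451885056 * r 0 * r 1 ^ 6 - 254803968 * r 0 ^ 3 * r 1 ^ 3 - 17199267840 *
        r 0 ^ 2 * r 1 ^ 4 - 220150628352 * r 0 * r 1 ^ 5 + 880602513408 * r 1 ^ 6, 7776 * r 0 ^ 7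
        + 1866240 * r 0 ^ 6 * r 1 + 179159040 * r 0 ^ 5 * r 1 ^ 2 + 8599633920 * r 0 ^ 4 * r 1 ^ 3
        + 206391214080 * r 0 ^ 3 * r 1 ^ 4 + 1981355655168 * r 0 ^ 2 * r 1 ^ 5 - 191102976 * r 0 ^
        4 * r 1 ^ 2 - 22932357120 * r 0 ^ 3 * r 1 ^ 3 - 550376570880 * r 0 ^ 2 * r 1 ^ 4 +
        5283615080448 * r 0 * r 1 ^ 5 + 2348273369088 * r 1 ^ 5], ![0, -4696546738176 * r 1 ^ 8]]
        : Fin 3 → Fin 2 → k) j l := by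
  fin_cases j <;> fin_cases l <;>
  · simp [num, MvPolynomial.pderiv_X, pderiv_ofNat]
    try ring

theorem eval_pderiv_den (r : Fin 2 → k) (j : Fin 3) (l : Fin 2) :
    MvPolynomial.eval r (MvPolynomial.pderiv l (den k j)) =
      (![![4 * (r 0 ^ 2 + 96 * r 0 * r 1 - 1152 * r 1 ^ 2) ^ 2 + 8 * r 0 * (r 0 ^ 2 + 96 * r 0 *
        r 1 - 1152 * r 1 ^ 2) * (2 * r 0 + 96 * r 1), 8 * r 0 * (r 0 ^ 2 + 96 * r 0 * r 1 - 1152 *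
        r 1 ^ 2) * (96 * r 0 - 2304 * r 1)], ![16 * r 0 * (r 0 ^ 2 + 96 * r 0 * r 1 - 1152 * r 1 ^
        2) ^ 3 + 24 * r 0 ^ 2 * (r 0 ^ 2 + 96 * r 0 * r 1 - 1152 * r 1 ^ 2) ^ 2 * (2 * r 0 + 96 *
        r 1), 24 * r 0 ^ 2 * (r 0 ^ 2 + 96 * r 0 * r 1 - 1152 * r 1 ^ 2) ^ 2 * (96 * r 0 - 2304 *
        r 1)], ![2 * r 0 * (r 0 ^ 2 + 96 * r 0 * r 1 - 1152 * r 1 ^ 2) ^ 5 + 5 * r 0 ^ 2 * (r 0 ^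
        2 + 96 * r 0 * r 1 - 1152 * r 1 ^ 2) ^ 4 * (2 * r 0 + 96 * r 1), 5 * r 0 ^ 2 * (r 0 ^ 2 +
        96 * r 0 * r 1 - 1152 * r 1 ^ 2) ^ 4 * (96 * r 0 - 2304 * r 1)]] : Fin 3 → Fin 2 → k) j l
        := by
  fin_cases j <;> fin_cases l <;>
  · simp [den, polyJ2, MvPolynomial.pderiv_X, pderiv_ofNat]
    try ring

/-- The factor of the minor of the Jacobian matrix with rows `0`, `1` that is nontrivial on the
domain of definition. -/
def minor01 (r s : k) : k := 3 * r ^ 8 + 720 * r ^ 7 * s + 69120 * r ^ 6 * s ^ 2 + 3317760 * r ^ 5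
  * s ^ 3 + 79626240 * r ^ 4 * s ^ 4 + 764411904 * r ^ 3 * s ^ 5 + 2048 * r ^ 5 * s ^ 2 - 417792 *
  r ^ 4 * s ^ 3 - 24772608 * r ^ 3 * s ^ 4 - 113246208 * r ^ 2 * s ^ 5 - 5435817984 * r * s ^ 6 +
  50331648 * r * s ^ 5 - 2415919104 * s ^ 6

/-- The factor of the minor of the Jacobian matrix with rows `0`, `2` that is nontrivial on the
domain of definition. -/
def minor02 (r s : k) : k := 9 * r ^ 5 + 1296 * r ^ 4 * s + 62208 * r ^ 3 * s ^ 2 + 995328 * r ^ 2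
  * s ^ 3 - 10240 * r ^ 2 * s ^ 2 + 786432 * r * s ^ 3 - 2359296 * s ^ 4

/-- The factor of the minor of the Jacobian matrix with rows `1`, `2` that is nontrivial on the
domain of definition. -/
def minor12 (r s : k) : k := 9 * r ^ 8 + 2160 * r ^ 7 * s + 207360 * r ^ 6 * s ^ 2 + 9953280 * r ^
  5 * s ^ 3 + 238878720 * r ^ 4 * s ^ 4 + 2293235712 * r ^ 3 * s ^ 5 + 38912 * r ^ 5 * s ^ 2 -
  3735552 * r ^ 4 * s ^ 3 - 247726080 * r ^ 3 * s ^ 4 + 905969664 * r ^ 2 * s ^ 5 - 5435817984 * r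
  * s ^ 6 + 201326592 * r * s ^ 5 - 4831838208 * s ^ 6

theorem det_jacobian_01 (r : Fin 2 → k) : ((jacobian r).submatrix ![0, 1] id).det =
    -126806761930752 * r 0 ^ 3 * r 1 ^ 4 * (r 0 ^ 2 + 96 * r 0 * r 1 - 1152 * r 1 ^ 2) ^ 4 * minor01 (r 0) (r 1) /
      (MvPolynomial.eval r (den k 0) ^ 2 * MvPolynomial.eval r (den k 1) ^ 2) := by
  rw [Matrix.det_fin_two]
  simp only [jacobian, Matrix.submatrix_apply, Matrix.of_apply, id_eq, Matrix.cons_val_zero,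
    Matrix.cons_val_one]
  rw [div_mul_div_comm, div_mul_div_comm, ← sub_div]
  congr 1
  simp only [eval_num, eval_den, eval_pderiv_num, eval_pderiv_den, Matrix.cons_val_zero,
    Matrix.cons_val_one, minor01]
  ring

theorem det_jacobian_02 (r : Fin 2 → k) : ((jacobian r).submatrix ![0, 2] id).det =
    -86566749478060032 * r 0 ^ 2 * r 1 ^ 10 * (r 0 ^ 2 + 96 * r 0 * r 1 - 1152 * r 1 ^ 2) ^ 6 * minor02 (r 0) (r 1) /
      (MvPolynomial.eval r (den k 0) ^ 2 * MvPolynomial.eval r (den k 2) ^ 2) := by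
  rw [Matrix.det_fin_two]
  simp only [jacobian, Matrix.submatrix_apply, Matrix.of_apply, id_eq, Matrix.cons_val_zero,
    Matrix.cons_val_one]
  rw [div_mul_div_comm, div_mul_div_comm, ← sub_div]
  congr 1
  simp only [eval_num, eval_den, eval_pderiv_num, eval_pderiv_den, Matrix.cons_val_zero,
    Matrix.cons_val_one, Matrix.cons_val, minor02]
  ring

theorem det_jacobian_12 (r : Fin 2 → k) : ((jacobian r).submatrix ![1, 2] id).det =
    -779100745302540288 * r 0 ^ 3 * r 1 ^ 10 * (r 0 ^ 2 + 96 * r 0 * r 1 - 1152 * r 1 ^ 2) ^ 7 * minor12 (r 0) (r 1) /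
      (MvPolynomial.eval r (den k 1) ^ 2 * MvPolynomial.eval r (den k 2) ^ 2) := by
  rw [Matrix.det_fin_two]
  simp only [jacobian, Matrix.submatrix_apply, Matrix.of_apply, id_eq, Matrix.cons_val_zero,
    Matrix.cons_val_one]
  rw [div_mul_div_comm, div_mul_div_comm, ← sub_div]
  congr 1
  simp only [eval_num, eval_den, eval_pderiv_num, eval_pderiv_den, Matrix.cons_val_zero,
    Matrix.cons_val_one, Matrix.cons_val, minor12]
  ring

theorem jacobian_minors_iff [CharZero k] {r : Fin 2 → k} (h0 : r 0 ≠ 0) (h1 : r 1 ≠ 0)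
    (hq : r 0 ^ 2 + 96 * r 0 * r 1 - 1152 * r 1 ^ 2 ≠ 0) :
    (∀ a b : Fin 3, ((jacobian r).submatrix ![a, b] id).det = 0) ↔
      minor01 (r 0) (r 1) = 0 ∧ minor02 (r 0) (r 1) = 0 ∧ minor12 (r 0) (r 1) = 0 := by
  have hd : ∀ j, MvPolynomial.eval r (den k j) ≠ 0 := by
    intro j
    rw [eval_den]
    fin_cases j <;> simp [h0, hq]
  have e01 : ((jacobian r).submatrix ![0, 1] id).det = 0 ↔ minor01 (r 0) (r 1) = 0 := by
    rw [det_jacobian_01]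
    simp [hd, h0, h1, hq]
  have e02 : ((jacobian r).submatrix ![0, 2] id).det = 0 ↔ minor02 (r 0) (r 1) = 0 := by
    rw [det_jacobian_02]
    simp [hd, h0, h1, hq]
  have e12 : ((jacobian r).submatrix ![1, 2] id).det = 0 ↔ minor12 (r 0) (r 1) = 0 := by
    rw [det_jacobian_12]
    simp [hd, h0, h1, hq]
  rw [← e01, ← e02, ← e12]
  refine ⟨fun h => ⟨h 0 1, h 0 2, h 1 2⟩, fun ⟨g1, g2, g3⟩ a b => ?_⟩
  simp only [Matrix.det_fin_two, Matrix.submatrix_apply, id_eq, Matrix.cons_val_zero,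
    Matrix.cons_val_one] at g1 g2 g3 ⊢
  fin_cases a <;> fin_cases b <;> simp only [Fin.zero_eta, Fin.mk_one, Fin.reduceFinMk]
  · ring
  · exact g1
  · exact g2
  · linear_combination -g1
  · ring
  · exact g3
  · linear_combination -g2
  · linear_combination -g3
  · ring

/-- With r₂ = rn/48 the second index pair gives r⁴ times a polynomial linear in r, and the third
gives r⁶ times a quadratic one. Eliminating r leaves a polynomial in n alone, and the linear
equation then determines r. -/
theorem eq_of_minors_eq_zero [CharZero k] {r n : k} (hr : r ≠ 0) (hn : n ≠ 0)
    (h02 : minor02 r (r * n / 48) = 0) (h12 : minor12 r (r * n / 48) = 0) :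
    (n = 8 ∧ r = -512 / 2187) ∨ (n = 1 / 2 ∧ r = 2 / 243) ∨ (n = -10 ∧ r = -4000 / 2187) := by
  have e1 : 9 * r * (n + 1) ^ 3 - 4 / 9 * n ^ 2 * (n ^ 2 - 16 * n + 10) = 0 := by
    refine (mul_eq_zero.1 ?_).resolve_left (pow_ne_zero 4 hr)
    rw [minor02] at h02
    linear_combination h02
  have e2 : 9 * (n + 1) ^ 5 * r ^ 2 + (152 / 9 * n ^ 2 - 304 / 9 * n ^ 3 - 140 / 3 * n ^ 4
      + 32 / 9 * n ^ 5 - 4 / 9 * n ^ 6) * r + (64 / 81 * n ^ 5 - 32 / 81 * n ^ 6) = 0 := by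
    refine (mul_eq_zero.1 ?_).resolve_left (pow_ne_zero 6 hr)
    rw [minor12] at h12
    linear_combination h12
  have hn1 : n + 1 ≠ 0 := by
    intro h
    obtain rfl : n = -1 := by linear_combination h
    norm_num at e1
  -- The resultant in r of `e1` and `e2`, up to a constant and further powers of n + 1; n = -1 was
  -- excluded by `e1`.
  have e3 : n ^ 4 * (n + 1) * ((2 * n - 1) ^ 2 * ((n - 8) * (n + 10))) = 0 := by
    linear_combination (-27 / 32 * 9 * (n + 1) ^ 3) * e2 + 27 / 32 * ((n + 1) ^ 2 *
      (9 * r * (n + 1) ^ 3 + 4 / 9 * n ^ 2 * (n ^ 2 - 16 * n + 10)) + (152 / 9 * n ^ 2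
        - 304 / 9 * n ^ 3 - 140 / 3 * n ^ 4 + 32 / 9 * n ^ 5 - 4 / 9 * n ^ 6)) * e1
  rcases mul_eq_zero.1 ((mul_eq_zero.1 e3).resolve_left
    (mul_ne_zero (pow_ne_zero 4 hn) hn1)) with h | h
  · right; left
    have h' : n = 1 / 2 := by linear_combination (pow_eq_zero_iff two_ne_zero).1 h / 2
    rw [h'] at e1
    exact ⟨h', by linear_combination 8 / 243 * e1⟩
  rcases mul_eq_zero.1 h with h | h
  · left
    have h' : n = 8 := by linear_combination h
    rw [h'] at e1
    exact ⟨h', by linear_combination e1 / 6561⟩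
  · right; right
    have h' : n = -10 := by linear_combination h
    rw [h'] at e1
    exact ⟨h', by linear_combination -e1 / 6561⟩

theorem mem_singularLocus [CharZero k] {r : Fin 2 → k} (h0 : r 0 ≠ 0) (h1 : r 1 ≠ 0)
    (hq : r 0 ^ 2 + 96 * r 0 * r 1 - 1152 * r 1 ^ 2 ≠ 0)
    (h : minor01 (r 0) (r 1) = 0 ∧ minor02 (r 0) (r 1) = 0 ∧ minor12 (r 0) (r 1) = 0) :
    param r ∈ singularLocus k := by
  refine ⟨r, fun j => ?_, ?_, (jacobian_minors_iff h0 h1 hq).2 h, rfl⟩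
  · rw [eval_den]
    fin_cases j <;> simp [h0, hq]
  · rw [param, eval_num, eval_den]
    simp [h0, h1, hq]

theorem singularLocus_eq [CharZero k] : singularLocus k = {pointA k, pointB k, pointC k} := by
  apply Set.Subset.antisymm
  · rintro P ⟨r, hd, h2, hJ, rfl⟩
    have h0 : r 0 ≠ 0 := fun h => hd 0 (by rw [eval_den]; simp [h])
    have hq : r 0 ^ 2 + 96 * r 0 * r 1 - 1152 * r 1 ^ 2 ≠ 0 := fun h =>
      hd 0 (by rw [eval_den]; simp [h])
    have h1 : r 1 ≠ 0 := fun h => h2 (by rw [param, eval_num]; simp [h])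
    obtain ⟨-, h02, h12⟩ := (jacobian_minors_iff h0 h1 hq).1 hJ
    rw [param_eq_normalInv h0]
    obtain ⟨n, hn⟩ : ∃ n, n = 48 * r 1 / r 0 := ⟨_, rfl⟩
    have hr1 : r 1 = r 0 * n / 48 := by
      rw [hn]
      field_simp
    have hn0 : n ≠ 0 := fun h => h1 (by rw [hr1, h]; simp)
    rw [← hn]
    rw [hr1] at h02 h12
    rcases eq_of_minors_eq_zero h0 hn0 h02 h12 with ⟨rfl, hr⟩ | ⟨rfl, hr⟩ | ⟨rfl, hr⟩
    · left
      rw [hr, ← normalInv_pointA]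
      norm_num
    · right; left
      rw [hr, ← normalInv_pointB]
      norm_num
    · right; right
      rw [hr, ← normalInv_pointC]
      norm_num
  -- The preimages are recovered from r₁ = n³/(27τ) and r₂ = r₁n/48.
  · rintro P (rfl | rfl | rfl)
    · have : param ![-512 / 2187, -256 / 6561] = pointA k := by
        rw [param_eq_normalInv (by simp), ← normalInv_pointA]
        norm_num
      rw [← this]
      apply mem_singularLocus <;> norm_num [minor01, minor02, minor12]
    · have : param ![2 / 243, 1 / 11664] = pointB k := by
        rw [param_eq_normalInv (by simp), ← normalInv_pointB]
        norm_num
      rw [← this]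
      apply mem_singularLocus <;> norm_num [minor01, minor02, minor12]
    · have : param ![-4000 / 2187, 2500 / 6561] = pointC k := by
        rw [param_eq_normalInv (by simp), ← normalInv_pointC]
        norm_num
      rw [← this]
      apply mem_singularLocus <;> norm_num [minor01, minor02, minor12]

theorem ncard_singularLocus [CharZero k] : (singularLocus k).ncard = 3 := by
  rw [Set.ncard_eq_three]
  refine ⟨_, _, _, ?_, ?_, ?_, singularLocus_eq⟩ <;>
  · intro h
    have := congrFun h 0
    norm_num [pointA, pointB, pointC] at this

end SingularLocus

end ShaskaSurface

/-! ### The elliptic subcover of degree 3. -/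

namespace ShaskaSurface

open Polynomial IntermediateField

section Subcover

variable {k : Type*} [Field k]

theorem natDegree_num_div {p q : k[X]} (hp : p ≠ 0) (hq : q ≠ 0) (h : IsCoprime p q) :
    (algebraMap k[X] (RatFunc k) p / algebraMap k[X] (RatFunc k) q).num.natDegree = p.natDegree ∧
    (algebraMap k[X] (RatFunc k) p / algebraMap k[X] (RatFunc k) q).denom.natDegree =
      q.natDegree := by
  set A := algebraMap k[X] (RatFunc k) p / algebraMap k[X] (RatFunc k) q
  have e : A.num * q = p * A.denom := (RatFunc.num_mul_eq_mul_denom_iff hq).2 rfl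
  have h1 : p ∣ A.num := h.dvd_of_dvd_mul_right (Dvd.intro _ e.symm)
  have h2 : q ∣ A.denom := h.symm.dvd_of_dvd_mul_left (Dvd.intro_left _ e)
  have h3 : A.num ∣ p := RatFunc.num_div_dvd p hq
  have h4 : A.denom ∣ q := RatFunc.denom_div_dvd p q
  have h0 : A.num ≠ 0 := ne_zero_of_dvd_ne_zero hp h3
  exact ⟨(natDegree_le_of_dvd h3 hp).antisymm (natDegree_le_of_dvd h1 h0),
    (natDegree_le_of_dvd h4 hq).antisymm (natDegree_le_of_dvd h2 A.denom_ne_zero)⟩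

namespace CurveField

variable {f g : k[X]}

theorem fieldRange_toAlgHom (f : k[X])
    [Fact (Irreducible ((X : (RatFunc k)[X]) ^ 2 - C (algebraMap k[X] (RatFunc k) f)))] :
    (IsScalarTower.toAlgHom k (RatFunc k) (CurveField f)).fieldRange = k⟮x f⟯ := by
  rw [AlgHom.fieldRange_eq_map, ← RatFunc.adjoin_X, adjoin_map, Set.image_singleton]
  rfl

theorem finrank_adjoin_x (f : k[X])
    [Fact (Irreducible ((X : (RatFunc k)[X]) ^ 2 - C (algebraMap k[X] (RatFunc k) f)))] :
    Module.finrank k⟮x f⟯ (CurveField f) = 2 := by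
  rw [← fieldRange_toAlgHom f]
  refine Eq.trans ?_ (finrank_eq_two f)
  exact (Algebra.finrank_eq_of_equiv_equiv
    (AlgEquiv.ofInjectiveField (IsScalarTower.toAlgHom k (RatFunc k) (CurveField f))).toRingEquiv
    (RingEquiv.refl _) (by ext; rfl)).symm

/-- Compute the degree of k(x, y) over k(ψ(x)) in two ways: through k(x) it is 2 · deg A, and
through the image of ψ it is 2 times the index sought. -/
theorem finrank_range_eq
    [Fact (Irreducible ((X : (RatFunc k)[X]) ^ 2 - C (algebraMap k[X] (RatFunc k) f)))]
    [Fact (Irreducible ((X : (RatFunc k)[X]) ^ 2 - C (algebraMap k[X] (RatFunc k) g)))]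
    {ψ : CurveField g →ₐ[k] CurveField f} {A : RatFunc k}
    (hA : ψ (x g) = algebraMap (RatFunc k) (CurveField f) A) :
    Module.finrank ψ.range (CurveField f) = max A.num.natDegree A.denom.natDegree := by
  let i := IsScalarTower.toAlgHom k (RatFunc k) (CurveField f)
  have e1 : k⟮A⟯.map i = k⟮ψ (x g)⟯ := by
    rw [adjoin_map, Set.image_singleton, hA]
    rfl
  have e2 : k⟮x g⟯.map ψ = k⟮ψ (x g)⟯ := by
    rw [adjoin_map, Set.image_singleton]
  have e3 : (⊤ : IntermediateField k (RatFunc k)).map i = k⟮x f⟯ := by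
    rw [← AlgHom.fieldRange_eq_map, fieldRange_toAlgHom]
  have e4 : (⊤ : IntermediateField k (CurveField g)).map ψ = ψ.fieldRange :=
    (AlgHom.fieldRange_eq_map ψ).symm
  have r1 : relfinrank k⟮ψ (x g)⟯ k⟮x f⟯ = max A.num.natDegree A.denom.natDegree := by
    rw [← e1, ← e3, relfinrank_map_map, relfinrank_top_right, RatFunc.finrank_eq_max_natDegree]
  have r2 : relfinrank k⟮ψ (x g)⟯ ψ.fieldRange = 2 := by
    rw [← e2, ← e4, relfinrank_map_map, relfinrank_top_right, finrank_adjoin_x]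
  have m1 := relfinrank_mul_finrank_top (A := k⟮ψ (x g)⟯) (B := k⟮x f⟯)
    (by rw [← e1, ← e3]; exact map_mono i le_top)
  have m2 := relfinrank_mul_finrank_top (A := k⟮ψ (x g)⟯) (B := ψ.fieldRange)
    (by rw [← e2, ← e4]; exact map_mono ψ le_top)
  rw [r1, finrank_adjoin_x, ← m2, r2] at m1
  have h : Module.finrank ψ.range (CurveField f) = Module.finrank ψ.fieldRange (CurveField f) := rfl
  rw [h]
  lia

end CurveField

/-- The cubic of the elliptic subcover. -/
noncomputable def ellipticCubic (u v : k) : k[X] :=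
  C (v ^ 3 * discrFactor u v) * X ^ 3 + C (2 * v ^ 2 * (6 * u ^ 2 - u * v - 9 * v)) * X ^ 2
    + C (v * (v - 12 * u)) * X + C 4

/-- Divided by G³, the right side is the elliptic cubic at x²/G. Hence y(v²x³ - vx - 2)/G² is a
square root of its value, as y² = FG. -/
theorem cubicF_mul_sq (u v : k) : cubicF v * (C (v ^ 2) * X ^ 3 - C v * X - 2) ^ 2 =
    C (v ^ 3 * discrFactor u v) * (X ^ 2) ^ 3
      + C (2 * v ^ 2 * (6 * u ^ 2 - u * v - 9 * v)) * (X ^ 2) ^ 2 * cubicG u v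
      + C (v * (v - 12 * u)) * X ^ 2 * cubicG u v ^ 2 + C 4 * cubicG u v ^ 3 := by
  rw [cubicF, cubicG, discrFactor]
  simp only [C_add, C_sub, C_mul, C_pow, map_ofNat]
  ring

theorem natDegree_ellipticCubic {u v : k} (hv : v ≠ 0) (hw : discrFactor u v ≠ 0) :
    (ellipticCubic u v).natDegree = 3 := by
  rw [ellipticCubic]
  compute_degree!

theorem separable_ellipticCubic [CharZero k] {u v : k} (hv : v ≠ 0) (ht : v - 27 ≠ 0)
    (hw : discrFactor u v ≠ 0) : (ellipticCubic u v).Separable := by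
  have hd := natDegree_ellipticCubic hv hw
  rw [← discr_ne_zero_iff_separable (by lia),
    discr_of_degree_eq_three ((degree_eq_iff_natDegree_eq_of_pos (by norm_num)).2 hd)]
  -- This is the discriminant of the elliptic cubic; u drops out.
  have : 16 * v ^ 8 * (v - 27) ^ 3 ≠ 0 := by simp [hv, ht]
  convert this using 1
  simp only [ellipticCubic, coeff_add, coeff_C_mul, coeff_X_pow, coeff_X, coeff_C]
  norm_num [discrFactor]
  ring

theorem hasDegreeThreeEllipticSubcover_sextic [CharZero k] {u v : k}
    (h : IsGenusTwo (sextic u v)) : HasDegreeThreeEllipticSubcover (sextic u v) := by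
  obtain ⟨hv, ht, hw⟩ := isGenusTwo_sextic_iff.1 h
  have hg := natDegree_ellipticCubic hv hw
  have hs := separable_ellipticCubic hv ht hw
  have hG3 := natDegree_cubicG (u := u) hv
  have hG0 : cubicG u v ≠ 0 := fun h => by simp [h] at hG3
  have : Fact (Irreducible ((X : (RatFunc k)[X]) ^ 2 -
      C (algebraMap k[X] (RatFunc k) (sextic u v)))) :=
    ⟨irreducible_curve h.1.squarefree (by rw [natDegree_sextic hv]; norm_num)⟩
  have : Fact (Irreducible ((X : (RatFunc k)[X]) ^ 2 -
      C (algebraMap k[X] (RatFunc k) (ellipticCubic u v)))) :=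
    ⟨irreducible_curve hs.squarefree (by lia)⟩
  -- G has constant term 1, so x²/G is in lowest terms and has degree max(2, 3) = 3.
  have hcop : IsCoprime (X ^ 2) (cubicG u v) := by
    refine IsCoprime.pow_left ⟨-(C (v ^ 2) * X ^ 2 + C (u * v) * X + C v), 1, ?_⟩
    rw [cubicG]
    ring
  let A : RatFunc k := algebraMap k[X] (RatFunc k) (X ^ 2) / algebraMap k[X] (RatFunc k) (cubicG u v)
  obtain ⟨n1, n2⟩ := natDegree_num_div (pow_ne_zero 2 X_ne_zero) hG0 hcop
  have hA : Transcendental k A := by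
    apply RatFunc.transcendental_of_ne_C
    rintro ⟨c, hc⟩
    have : A.num.natDegree = 2 := n1.trans (natDegree_X_pow 2)
    rw [hc] at this
    simp at this
  let z := CurveField.x (sextic u v)
  have hGz : aeval z (cubicG u v) ≠ 0 := fun e =>
    hG0 ((transcendental_iff.1 (CurveField.transcendental_x (sextic u v))) _ e)
  obtain ⟨ψ, hx, -⟩ := CurveField.exists_lift (f := ellipticCubic u v)
    (U := algebraMap (RatFunc k) (CurveField (sextic u v)) A)
    (V := CurveField.y (sextic u v) * aeval z (C (v ^ 2) * X ^ 3 - C v * X - 2 : k[X]) /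
      aeval z (cubicG u v) ^ 2)
    ((transcendental_algebraMap_iff (algebraMap (RatFunc k) (CurveField _)).injective).2 hA) (by
      have e := congrArg (aeval z) (cubicF_mul_sq u v)
      have hU : algebraMap (RatFunc k) (CurveField (sextic u v)) A =
          z ^ 2 / aeval z (cubicG u v) := by
        rw [map_div₀, CurveField.algebraMap_algebraMap, CurveField.algebraMap_algebraMap]
        simp [z]
      have hy : CurveField.y (sextic u v) ^ 2 = aeval z (cubicF v) * aeval z (cubicG u v) :=
        (CurveField.y_sq _).trans (map_mul (aeval z) _ _)
      rw [hU, div_pow, mul_pow, hy, ellipticCubic]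
      simp only [map_add, map_mul, map_pow, aeval_X, aeval_C] at e ⊢
      rw [mul_right_comm, e]
      field_simp)
  refine ⟨ellipticCubic u v, hs, hg, ψ, ?_⟩
  rw [CurveField.finrank_range_eq hx, n1, n2, hG3, natDegree_X_pow]
  norm_num

end Subcover

end ShaskaSurface

theorem mainTheorem3 {k : Type*} [Field k] [IsAlgClosed k] [CharZero k] :
    -- the curves of the family are degree 3 covers of elliptic curves, and the parametrization
    -- computes their absolute invariants from the invariants of the pair of cubics
    (∀ u v : k, ShaskaSurface.IsGenusTwo (ShaskaSurface.sextic u v) →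
      ShaskaSurface.HasDegreeThreeEllipticSubcover (ShaskaSurface.sextic u v)) ∧
    (∀ u v : k, ShaskaSurface.IsGenusTwo (ShaskaSurface.sextic u v) →
      ShaskaSurface.J2 (ShaskaSurface.sextic u v) ≠ 0 →
      ShaskaSurface.cubicH (ShaskaSurface.cubicF v) (ShaskaSurface.cubicG u v) ≠ 0 →
      ShaskaSurface.param
          (ShaskaSurface.cubicInv (ShaskaSurface.cubicF v) (ShaskaSurface.cubicG u v)) =
        ShaskaSurface.absInv (ShaskaSurface.sextic u v)) ∧
    -- the singular locus consists of exactly three points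
    ShaskaSurface.singularLocus k =
      {ShaskaSurface.pointA k, ShaskaSurface.pointB k, ShaskaSurface.pointC k} ∧
    (ShaskaSurface.singularLocus k).ncard = 3 ∧
    -- each of them is the point of a curve of the family
    (∃ u v : k, ShaskaSurface.CurveOver u v (ShaskaSurface.pointA k)) ∧
    (∃ u v : k, ShaskaSurface.CurveOver u v (ShaskaSurface.pointB k)) ∧
    (∃ u v : k, ShaskaSurface.CurveOver u v (ShaskaSurface.pointC k)) ∧
    -- automorphism groups of the corresponding curves
    (∀ u v : k, ShaskaSurface.CurveOver u v (ShaskaSurface.pointA k) →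
      Nonempty (ShaskaSurface.CurveAut (ShaskaSurface.sextic u v) ≃* DihedralGroup 4)) ∧
    (∀ u v : k, ShaskaSurface.CurveOver u v (ShaskaSurface.pointB k) →
      Nonempty (ShaskaSurface.CurveAut (ShaskaSurface.sextic u v) ≃* DihedralGroup 6)) ∧
    (∀ u v : k, ShaskaSurface.CurveOver u v (ShaskaSurface.pointC k) →
      Nonempty (ShaskaSurface.CurveAut (ShaskaSurface.sextic u v) ≃* DihedralGroup 4)) := by
  exact ⟨fun u v h => ShaskaSurface.hasDegreeThreeEllipticSubcover_sextic h,
    fun u v h _ hH => ShaskaSurface.param_cubicInv h hH,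
    ShaskaSurface.singularLocus_eq, ShaskaSurface.ncard_singularLocus,
    ShaskaSurface.exists_curveOver_pointA, ShaskaSurface.exists_curveOver_pointB,
    ShaskaSurface.exists_curveOver_pointC,
    fun u v h => h.nonempty_curveAut_pointA, fun u v h => h.nonempty_curveAut_pointB,
    fun u v h => h.nonempty_curveAut_pointC⟩
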